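/- All manifolds are smooth, finite-dimensional, Hausdorff, second countable and without boundary. A double vector bundle $\mathbb E=(E;E_1,E_2;M)$ consists of vector bundles $\delta_i:E_i\to M$ and of vector bundle structures on $\sigma_1:E\to E_1$ and $\sigma_2:E\to E_2$ with $\delta_1\sigma_1=\delta_2\sigma_2$, such that the structure maps (projection, zero section, addition $+_i$, scalar multiplication) of each structure on $E$ are vector bundle morphisms for the other one; its core $E_0$ is the set of points of $E$ that $\sigma_1$ and $\sigma_2$ map to zero vectors over the same point of $M$. Let $\mathbb E$ have fiber dimension $[\mathbf n]$, i.e. $\operatorname{rank}E_i=n_i$ for $i=1,2,0$. Let $\mathbb R^{[\mathbf n]}=(\mathbb R^{n_1}\oplus\mathbb R^{n_2}\oplus\mathbb R^{n_0};\mathbb R^{n_1},\mathbb R^{n_2})$ be the trivial double vector space. Its automorphism group $\operatorname{Aut}(\mathbb R^{[\mathbf n]})$ consists of the maps $a=(a_1,a_2,a_0,\tilde\mu):(x,y,z)\mapsto(a_1x,a_2y,a_0z+\tilde\mu(x,y))$ with $a_i\in GL(n_i)$ and $\tilde\mu:\mathbb R^{n_1}\times\mathbb R^{n_2}\to\mathbb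 R^{n_0}$ bilinear, and is a double Lie group, that is, there is an exact sequence of Lie groups $$1\to GL(n_0)\ltimes \operatorname{Hom}(\mathbb R^{n_1}\otimes\mathbb R^{n_2},\mathbb R^{n_0})\to\operatorname{Aut}(\mathbb R^{[\mathbf n]})\to GL(n_1)\times GL(n_2)\to1 .$$ Let $K_1$ and $K_2$ be its subgroups given by $a_1=1$ and $a_2=1$. A frame $\Omega=(\mathbf u,\mathbf v,\mathbf w;\Psi)$ of $\mathbb E$ at $m\in M$ consists of bases $\mathbf u,\mathbf v,\mathbf w$ of $E_{1,m},E_{2,m},E_{0,m}$ and a decomposition $\Psi:E_{1,m}\oplus E_{2,m}\oplus E_{0,m}\to E_m$, i.e. an isomorphism of double vector spaces inducing the identity on $E_{1,m}$, $E_{2,m}$ and $E_{0,m}$. For $\xi=(x,y,z)$ put $\Omega\xi=\Psi(\mathbf ux,\mathbf vy,\mathbf wz)$. The group $\operatorname{Aut}(\mathbb R^{[\mathbf n]})$ acts from the right on the set $\mathcal F(E)$ of frames by $\Omega a=(\mathbf ua_1,\mathbf va_2,\mathbf wa_0;\Psi_\mu)$, where $\mu(\mathbf ua_1x,\mathbf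 va_2y)=\mathbf w\tilde\mu(x,y)$ and $\Psi_\mu(e_1,e_2,e_0)=\Psi(e_1,e_2,e_0+\mu(e_1,e_2))$. The sets $\mathcal F(E),\mathcal F(E_1),\mathcal F(E_2)$ of frames carry natural manifold structures: the smooth local frames of $\mathbb E$, $E_1$, $E_2$ over open sets $U\subset M$ induce diffeomorphisms of $U\times\operatorname{Aut}(\mathbb R^{[\mathbf n]})$, $U\times GL(n_1)$, $U\times GL(n_2)$ onto the sets of frames over $U$. **Theorem.** (1) With these structures, $\mathcal F(\mathbb E)=(\mathcal F(E);\mathcal F(E_1),\mathcal F(E_2);M)$, with the projections $\Omega\mapsto\mathbf u$ and $\Omega\mapsto\mathbf v$, is a double principal bundle with structure group $\operatorname{Aut}(\mathbb R^{[\mathbf n]})$: $\mathcal F(E_i)\to M$ is a principal $GL(n_i)$-bundle and $\mathcal F(E)\to\mathcal F(E_i)$ is a principal $K_i$-bundle for the restriction of the smooth action of $\operatorname{Aut}(\mathbb R^{[\mathbf n]})$ ($i=1,2$), and the projections $\mathcal F(E)\to\mathcal F(E_1)$ and $\mathcal F(E)\to\mathcal F(E_2)$ are homomorphisms of principal bundles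 from the $K_2$-bundle $\mathcal F(E)\to\mathcal F(E_2)$ to $\mathcal F(E_1)\to M$ and from the $K_1$-bundle $\mathcal F(E)\to\mathcal F(E_1)$ to $\mathcal F(E_2)\to M$, respectively. (2) The associated bundle $\mathcal F(E)\times_{\operatorname{Aut}(\mathbb R^{[\mathbf n]})}\mathbb R^{[\mathbf n]}$, i.e. the quotient of $\mathcal F(E)\times\mathbb R^{[\mathbf n]}$ by $(\Omega,\xi)\sim(\Omega a,a^{-1}\xi)$, with its natural manifold structure and the operations of $\mathbb R^{[\mathbf n]}$, is a double vector bundle with side bundles $\mathcal F(E_i)\times_{GL(n_i)}\mathbb R^{n_i}$, and it is naturally isomorphic to $\mathbb E$: the map $[\Omega,\xi]\mapsto\Omega\xi$, together with $[\mathbf u,x]\mapsto\mathbf ux$, $[\mathbf v,y]\mapsto\mathbf vy$ and $\mathrm{id}_M$, is an isomorphism of double vector bundles. -/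

import Mathlib

open scoped Manifold ContDiff Topology

noncomputable section

namespace DPB

/-- A (finite-dimensional, Hausdorff, second countable, boundaryless) smooth manifold structure on a
topological space, modelled on a normed space that is part of the data. -/
class Mfd (X : Type*) [TopologicalSpace X] where
  /-- the model vector space -/
  V : Type
  [normed : NormedAddCommGroup V]
  [space : NormedSpace ℝ V]
  [finDim : FiniteDimensional ℝ V]
  /-- the model space of the charts -/
  H : Type
  [topH : TopologicalSpace H]
  /-- the identification of the model space with the model vector space -/
  I : ModelWithCorners ℝ V H
  [boundaryless : I.Boundaryless]
  [charted : ChartedSpace H X]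
  [isManifold : IsManifold I ∞ X]
  [t2 : T2Space X]
  [secondCountable : SecondCountableTopology X]

attribute [reducible] Mfd.normed Mfd.space Mfd.topH Mfd.charted

attribute [instance] Mfd.normed Mfd.space Mfd.finDim Mfd.topH Mfd.boundaryless Mfd.charted
  Mfd.isManifold

/-- The model with corners of a manifold. -/
abbrev mdl (X : Type*) [TopologicalSpace X] [Mfd X] : ModelWithCorners ℝ (Mfd.V X) (Mfd.H X) :=
  Mfd.I (X := X)

instance Mfd.prod (X Y : Type*) [TopologicalSpace X] [Mfd X] [TopologicalSpace Y] [Mfd Y] :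
    Mfd (X × Y) where
  V := Mfd.V X × Mfd.V Y
  H := ModelProd (Mfd.H X) (Mfd.H Y)
  I := (mdl X).prod (mdl Y)
  t2 := by
    have := Mfd.t2 (X := X)
    have := Mfd.t2 (X := Y)
    infer_instance
  secondCountable := by
    have := Mfd.secondCountable (X := X)
    have := Mfd.secondCountable (X := Y)
    infer_instance

instance (G G' : Type*) [TopologicalSpace G] [Mfd G] [Group G] [LieGroup (mdl G) ∞ G]
    [TopologicalSpace G'] [Mfd G'] [Group G'] [LieGroup (mdl G') ∞ G'] :
    LieGroup (mdl (G × G')) ∞ (G × G') :=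
  inferInstanceAs (LieGroup ((mdl G).prod (mdl G')) ∞ (G × G'))

/-! ### The linear groups -/

/-- The vector space of `n`-tuples of real numbers. -/
abbrev R (n : ℕ) : Type := Fin n → ℝ

/-- The general linear group of `R n`, an open subset of the space of endomorphisms. -/
abbrev GLin (n : ℕ) : Type := (R n →L[ℝ] R n)ˣ

instance (n : ℕ) : Mfd (GLin n) where
  V := R n →L[ℝ] R n
  H := R n →L[ℝ] R n
  I := 𝓘(ℝ, R n →L[ℝ] R n)
  secondCountable := Units.isOpenEmbedding_val.isEmbedding.secondCountableTopology

instance (n : ℕ) : LieGroup (mdl (GLin n)) ∞ (GLin n) :=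
  inferInstanceAs (LieGroup 𝓘(ℝ, R n →L[ℝ] R n) ∞ (R n →L[ℝ] R n)ˣ)

/-- The underlying space of the trivial double vector space with sides `R n₁`, `R n₂` and core
`R n₀`. -/
abbrev RR (n₁ n₂ n₀ : ℕ) : Type := R n₁ × R n₂ × R n₀

/-- The space `T = Hom(R n₁ ⊗ R n₂, R n₀)` of bilinear maps. -/
abbrev Bil (n₁ n₂ n₀ : ℕ) : Type := R n₁ →L[ℝ] R n₂ →L[ℝ] R n₀

instance (n₁ n₂ n₀ : ℕ) : FiniteDimensional ℝ (Bil n₁ n₂ n₀) :=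
  have : FiniteDimensional ℝ (R n₂ →L[ℝ] R n₀) := inferInstance
  ContinuousLinearMap.finiteDimensional

section Semidirect

variable {n₁ n₂ n₀ : ℕ} {H : Type} [TopologicalSpace H] [Mfd H] [Group H]

/-- For a homomorphism `ρ = (ρ₁, ρ₂, ρ₀)` of Lie groups from `H` to
`GL(n₁) × GL(n₂) × GL(n₀)`, the semidirect product `H ⋉ T`: the manifold `H × T` with the product
`(h, μ)(k, ν) = (hk, μ ∘ (ρ₁ k × ρ₂ k) + ρ₀ h ∘ ν)`. -/
@[nolint unusedArguments]
def SemiT (_ρ : ContMDiffMonoidMorphism (mdl H) (mdl (GLin n₁ × GLin n₂ × GLin n₀)) ∞ H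
    (GLin n₁ × GLin n₂ × GLin n₀)) : Type := H × Bil n₁ n₂ n₀

namespace SemiT

variable (ρ : ContMDiffMonoidMorphism (mdl H) (mdl (GLin n₁ × GLin n₂ × GLin n₀)) ∞ H
    (GLin n₁ × GLin n₂ × GLin n₀))

instance : TopologicalSpace (SemiT ρ) := inferInstanceAs (TopologicalSpace (H × Bil n₁ n₂ n₀))

instance : Mfd (SemiT ρ) where
  V := Mfd.V H × Bil n₁ n₂ n₀
  H := ModelProd (Mfd.H H) (Bil n₁ n₂ n₀)
  finDim := by
    have h : FiniteDimensional ℝ (Bil n₁ n₂ n₀) := inferInstance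
    have h' : FiniteDimensional ℝ (Mfd.V H) := inferInstance
    exact @Module.Finite.prod ℝ (Mfd.V H) (Bil n₁ n₂ n₀) _ _ _ _ _ h' h
  I := (mdl H).prod 𝓘(ℝ, Bil n₁ n₂ n₀)
  charted := inferInstanceAs (ChartedSpace (ModelProd (Mfd.H H) (Bil n₁ n₂ n₀))
    (H × Bil n₁ n₂ n₀))
  isManifold := inferInstanceAs
    (IsManifold ((mdl H).prod 𝓘(ℝ, Bil n₁ n₂ n₀)) ∞ (H × Bil n₁ n₂ n₀))
  t2 := by
    have := Mfd.t2 (X := H)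
    exact inferInstanceAs (T2Space (H × Bil n₁ n₂ n₀))
  secondCountable := by
    have := Mfd.secondCountable (X := H)
    exact inferInstanceAs (SecondCountableTopology (H × Bil n₁ n₂ n₀))

variable {ρ}

/-- The linear part of an element of `H ⋉ T`. -/
def lin (a : SemiT ρ) : H := Prod.fst (α := H) (β := Bil n₁ n₂ n₀) a

/-- The bilinear part of an element of `H ⋉ T`. -/
def bil (a : SemiT ρ) : Bil n₁ n₂ n₀ := Prod.snd (α := H) (β := Bil n₁ n₂ n₀) a

variable (ρ) in
/-- The element `(h, μ)` of `H ⋉ T`. -/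
def mk (h : H) (μ : Bil n₁ n₂ n₀) : SemiT ρ := ((h, μ) : H × Bil n₁ n₂ n₀)

/-- The three linear components of an element of `H ⋉ T`. -/
def a₁ (a : SemiT ρ) : GLin n₁ := (ρ a.lin).1
/-- The second linear component. -/
def a₂ (a : SemiT ρ) : GLin n₂ := (ρ a.lin).2.1
/-- The linear component on the core. -/
def a₀ (a : SemiT ρ) : GLin n₀ := (ρ a.lin).2.2

@[ext] lemma ext {a b : SemiT ρ} (h : a.lin = b.lin) (h' : a.bil = b.bil) : a = b :=
  Prod.ext h h'

instance : One (SemiT ρ) := ⟨mk ρ 1 0⟩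

instance : Mul (SemiT ρ) := ⟨fun a b => mk ρ (a.lin * b.lin)
  (a.bil.bilinearComp (b.a₁ : R n₁ →L[ℝ] R n₁) (b.a₂ : R n₂ →L[ℝ] R n₂) +
    (ContinuousLinearMap.compL ℝ (R n₂) (R n₀) (R n₀) (a.a₀ : R n₀ →L[ℝ] R n₀)).comp b.bil)⟩

instance : Inv (SemiT ρ) := ⟨fun a => mk ρ a.lin⁻¹
  (-(ContinuousLinearMap.compL ℝ (R n₂) (R n₀) (R n₀)
    ((a.a₀⁻¹ : GLin n₀) : R n₀ →L[ℝ] R n₀)).comp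
      (a.bil.bilinearComp ((a.a₁⁻¹ : GLin n₁) : R n₁ →L[ℝ] R n₁)
        ((a.a₂⁻¹ : GLin n₂) : R n₂ →L[ℝ] R n₂)))⟩

@[simp] lemma lin_mk (h : H) (μ : Bil n₁ n₂ n₀) : (mk ρ h μ).lin = h := rfl
@[simp] lemma bil_mk (h : H) (μ : Bil n₁ n₂ n₀) : (mk ρ h μ).bil = μ := rfl
@[simp] lemma lin_one : (1 : SemiT ρ).lin = 1 := rfl
@[simp] lemma bil_one : (1 : SemiT ρ).bil = 0 := rfl
@[simp] lemma lin_mul (a b : SemiT ρ) : (a * b).lin = a.lin * b.lin := rfl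
@[simp] lemma bil_mul (a b : SemiT ρ) (x : R n₁) (y : R n₂) : (a * b).bil x y =
    a.bil ((b.a₁ : R n₁ →L[ℝ] R n₁) x) ((b.a₂ : R n₂ →L[ℝ] R n₂) y) +
      (a.a₀ : R n₀ →L[ℝ] R n₀) (b.bil x y) := rfl
@[simp] lemma lin_inv (a : SemiT ρ) : (a⁻¹).lin = a.lin⁻¹ := rfl
@[simp] lemma bil_inv (a : SemiT ρ) (x : R n₁) (y : R n₂) : (a⁻¹).bil x y =
    -((a.a₀⁻¹ : GLin n₀) : R n₀ →L[ℝ] R n₀) (a.bil (((a.a₁⁻¹ : GLin n₁) : R n₁ →L[ℝ] R n₁) x)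
      (((a.a₂⁻¹ : GLin n₂) : R n₂ →L[ℝ] R n₂) y)) := rfl
@[simp] lemma a₁_mul (a b : SemiT ρ) : (a * b).a₁ = a.a₁ * b.a₁ := by simp [a₁]
@[simp] lemma a₂_mul (a b : SemiT ρ) : (a * b).a₂ = a.a₂ * b.a₂ := by simp [a₂]
@[simp] lemma a₀_mul (a b : SemiT ρ) : (a * b).a₀ = a.a₀ * b.a₀ := by simp [a₀]
@[simp] lemma a₁_one : (1 : SemiT ρ).a₁ = 1 := by simp [a₁]
@[simp] lemma a₂_one : (1 : SemiT ρ).a₂ = 1 := by simp [a₂]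
@[simp] lemma a₀_one : (1 : SemiT ρ).a₀ = 1 := by simp [a₀]

lemma gl_inv_apply {n : ℕ} (u : GLin n) (x : R n) :
    ((u⁻¹ : GLin n) : R n →L[ℝ] R n) ((u : R n →L[ℝ] R n) x) = x := by
  rw [← mul_apply_eq_comp, Units.inv_mul, one_apply_eq_self]

instance : Group (SemiT ρ) :=
  Group.ofLeftAxioms
    (fun a b c => by
      refine ext (by simp [mul_assoc]) ?_
      ext x y : 2
      simp [add_assoc])
    (fun a => by
      refine ext (by simp) ?_
      ext x y : 2
      simp)
    (fun a => by
      refine ext (by simp) ?_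
      ext x y : 2
      simp only [bil_mul, bil_inv, bil_one]
      rw [gl_inv_apply, gl_inv_apply]
      simp [a₀])

lemma contMDiff_lin : ContMDiff (mdl (SemiT ρ)) (mdl H) ∞ (lin : SemiT ρ → H) :=
  contMDiff_fst (I := mdl H) (J := 𝓘(ℝ, Bil n₁ n₂ n₀)) (M := H) (N := Bil n₁ n₂ n₀)

lemma contMDiff_bil : ContMDiff (mdl (SemiT ρ)) 𝓘(ℝ, Bil n₁ n₂ n₀) ∞
    (bil : SemiT ρ → Bil n₁ n₂ n₀) :=
  contMDiff_snd (I := mdl H) (J := 𝓘(ℝ, Bil n₁ n₂ n₀)) (M := H) (N := Bil n₁ n₂ n₀)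

lemma contMDiff_of {V' H' X : Type*} [NormedAddCommGroup V'] [NormedSpace ℝ V']
    [TopologicalSpace H'] {J : ModelWithCorners ℝ V' H'} [TopologicalSpace X] [ChartedSpace H' X]
    {f : X → SemiT ρ} (h : ContMDiff J (mdl H) ∞ (fun x => (f x).lin))
    (h' : ContMDiff J 𝓘(ℝ, Bil n₁ n₂ n₀) ∞ (fun x => (f x).bil)) :
    ContMDiff J (mdl (SemiT ρ)) ∞ f :=
  ContMDiff.prodMk h h'

lemma contMDiff_a₁ : ContMDiff (mdl (SemiT ρ)) 𝓘(ℝ, R n₁ →L[ℝ] R n₁) ∞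
    (fun a : SemiT ρ => (a.a₁ : R n₁ →L[ℝ] R n₁)) :=
  Units.contMDiff_val.comp ((contMDiff_fst (I := mdl (GLin n₁)) (J := mdl (GLin n₂ × GLin n₀))).comp
    (ρ.contMDiff_toFun.comp contMDiff_lin))

lemma contMDiff_a₂ : ContMDiff (mdl (SemiT ρ)) 𝓘(ℝ, R n₂ →L[ℝ] R n₂) ∞
    (fun a : SemiT ρ => (a.a₂ : R n₂ →L[ℝ] R n₂)) :=
  Units.contMDiff_val.comp ((contMDiff_fst (I := mdl (GLin n₂)) (J := mdl (GLin n₀))).comp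
    ((contMDiff_snd (I := mdl (GLin n₁)) (J := mdl (GLin n₂ × GLin n₀))).comp
    (ρ.contMDiff_toFun.comp contMDiff_lin)))

lemma contMDiff_a₀ : ContMDiff (mdl (SemiT ρ)) 𝓘(ℝ, R n₀ →L[ℝ] R n₀) ∞
    (fun a : SemiT ρ => (a.a₀ : R n₀ →L[ℝ] R n₀)) :=
  Units.contMDiff_val.comp ((contMDiff_snd (I := mdl (GLin n₂)) (J := mdl (GLin n₀))).comp
    ((contMDiff_snd (I := mdl (GLin n₁)) (J := mdl (GLin n₂ × GLin n₀))).comp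
    (ρ.contMDiff_toFun.comp contMDiff_lin)))

lemma contMDiff_bilinearComp {V' H' X : Type*} [NormedAddCommGroup V'] [NormedSpace ℝ V']
    [TopologicalSpace H'] {J : ModelWithCorners ℝ V' H'} [TopologicalSpace X] [ChartedSpace H' X]
    {μ : X → Bil n₁ n₂ n₀} {f : X → (R n₁ →L[ℝ] R n₁)} {g : X → (R n₂ →L[ℝ] R n₂)}
    (hμ : ContMDiff J 𝓘(ℝ, Bil n₁ n₂ n₀) ∞ μ) (hf : ContMDiff J 𝓘(ℝ, R n₁ →L[ℝ] R n₁) ∞ f)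
    (hg : ContMDiff J 𝓘(ℝ, R n₂ →L[ℝ] R n₂) ∞ g) :
    ContMDiff J 𝓘(ℝ, Bil n₁ n₂ n₀) ∞ (fun x => (μ x).bilinearComp (f x) (g x)) := by
  have flip_smooth : ∀ {p q : ℕ}, ContMDiff 𝓘(ℝ, Bil p q n₀) 𝓘(ℝ, Bil q p n₀) ∞
      (fun ν : Bil p q n₀ => ν.flip) := by
    intro p q
    rw [contMDiff_iff_contDiff]
    exact ContinuousLinearMap.contDiff (𝕜 := ℝ) (E := Bil p q n₀) (F := Bil q p n₀)
      (ContinuousLinearMap.flipₗᵢ ℝ (R p) (R q) (R n₀)).toContinuousLinearEquiv.toContinuousLinearMap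
  exact flip_smooth.comp ((flip_smooth.comp (hμ.clm_comp hf)).clm_comp hg)

lemma contMDiff_postcomp {V' H' X : Type*} [NormedAddCommGroup V'] [NormedSpace ℝ V']
    [TopologicalSpace H'] {J : ModelWithCorners ℝ V' H'} [TopologicalSpace X] [ChartedSpace H' X]
    {μ : X → Bil n₁ n₂ n₀} {f : X → (R n₀ →L[ℝ] R n₀)}
    (hμ : ContMDiff J 𝓘(ℝ, Bil n₁ n₂ n₀) ∞ μ) (hf : ContMDiff J 𝓘(ℝ, R n₀ →L[ℝ] R n₀) ∞ f) :
    ContMDiff J 𝓘(ℝ, Bil n₁ n₂ n₀) ∞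
      (fun x => (ContinuousLinearMap.compL ℝ (R n₂) (R n₀) (R n₀) (f x)).comp (μ x)) := by
  have h : ContMDiff 𝓘(ℝ, R n₀ →L[ℝ] R n₀) 𝓘(ℝ, (R n₂ →L[ℝ] R n₀) →L[ℝ] (R n₂ →L[ℝ] R n₀)) ∞
      (fun u : R n₀ →L[ℝ] R n₀ => ContinuousLinearMap.compL ℝ (R n₂) (R n₀) (R n₀) u) := by
    rw [contMDiff_iff_contDiff]
    exact ContinuousLinearMap.contDiff (𝕜 := ℝ) (E := R n₀ →L[ℝ] R n₀)
      (F := (R n₂ →L[ℝ] R n₀) →L[ℝ] (R n₂ →L[ℝ] R n₀))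
      (ContinuousLinearMap.compL ℝ (R n₂) (R n₀) (R n₀))
  exact (h.comp hf).clm_comp hμ

instance [LieGroup (mdl H) ∞ H] : LieGroup (mdl (SemiT ρ)) ∞ (SemiT ρ) where
  contMDiff_mul := by
    have l : ContMDiff ((mdl (SemiT ρ)).prod (mdl (SemiT ρ))) (mdl (SemiT ρ)) ∞
      (Prod.fst : SemiT ρ × SemiT ρ → SemiT ρ) := contMDiff_fst
    have r : ContMDiff ((mdl (SemiT ρ)).prod (mdl (SemiT ρ))) (mdl (SemiT ρ)) ∞
      (Prod.snd : SemiT ρ × SemiT ρ → SemiT ρ) := contMDiff_snd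
    refine contMDiff_of ((contMDiff_lin.comp l).mul (contMDiff_lin.comp r)) ?_
    exact (contMDiff_bilinearComp (contMDiff_bil.comp l) (contMDiff_a₁.comp r)
      (contMDiff_a₂.comp r)).add (contMDiff_postcomp (contMDiff_bil.comp r) (contMDiff_a₀.comp l))
  contMDiff_inv := by
    have hl : ContMDiff (mdl (SemiT ρ)) (mdl H) ∞ (fun a : SemiT ρ => a.lin⁻¹) :=
      contMDiff_lin.inv
    have hi : ContMDiff (mdl (SemiT ρ)) (mdl (SemiT ρ)) ∞ (fun a : SemiT ρ => mk ρ a.lin⁻¹ 0) :=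
      contMDiff_of hl contMDiff_const
    have key : ∀ a : SemiT ρ, (a⁻¹).bil = -(ContinuousLinearMap.compL ℝ (R n₂) (R n₀) (R n₀)
        ((mk ρ a.lin⁻¹ 0).a₀ : R n₀ →L[ℝ] R n₀)).comp (a.bil.bilinearComp
          ((mk ρ a.lin⁻¹ 0).a₁ : R n₁ →L[ℝ] R n₁) ((mk ρ a.lin⁻¹ 0).a₂ : R n₂ →L[ℝ] R n₂)) := by
      intro a
      ext x y : 2
      simp [a₀, a₁, a₂]
    refine contMDiff_of hl ?_
    simp_rw [key]
    exact (contMDiff_postcomp (contMDiff_bilinearComp contMDiff_bil (contMDiff_a₁.comp hi)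
      (contMDiff_a₂.comp hi)) (contMDiff_a₀.comp hi)).neg

end SemiT

end Semidirect

/-! ### Double Lie groups -/

/-- A double Lie group `1 → G₀ → G → G₁ × G₂ → 1`, together with its two subgroups
`K₁ = φ⁻¹({e} × G₂)` and `K₂ = φ⁻¹(G₁ × {e})`, given as Lie groups with embeddings into `G`.
As usual, `G` is supposed to be connected or equal to `K₁K₂`. -/
structure DoubleLieGroup (G G₁ G₂ G₀ K₁ K₂ : Type)
    [TopologicalSpace G] [Mfd G] [Group G] [LieGroup (mdl G) ∞ G]
    [TopologicalSpace G₁] [Mfd G₁] [Group G₁] [LieGroup (mdl G₁) ∞ G₁]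
    [TopologicalSpace G₂] [Mfd G₂] [Group G₂] [LieGroup (mdl G₂) ∞ G₂]
    [TopologicalSpace G₀] [Mfd G₀] [Group G₀] [LieGroup (mdl G₀) ∞ G₀]
    [TopologicalSpace K₁] [Mfd K₁] [Group K₁] [LieGroup (mdl K₁) ∞ K₁]
    [TopologicalSpace K₂] [Mfd K₂] [Group K₂] [LieGroup (mdl K₂) ∞ K₂] where
  /-- the inclusion of the core -/
  i : G₀ →* G
  /-- the epimorphism onto the product of the sides -/
  φ : G →* G₁ × G₂
  contMDiff_i : ContMDiff (mdl G₀) (mdl G) ∞ i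
  contMDiff_φ : ContMDiff (mdl G) (mdl (G₁ × G₂)) ∞ φ
  injective_i : Function.Injective i
  range_i : i.range = φ.ker
  surjective_φ : Function.Surjective φ
  /-- the inclusion of `K₁` -/
  κ₁ : K₁ →* G
  /-- the inclusion of `K₂` -/
  κ₂ : K₂ →* G
  contMDiff_κ₁ : ContMDiff (mdl K₁) (mdl G) ∞ κ₁
  contMDiff_κ₂ : ContMDiff (mdl K₂) (mdl G) ∞ κ₂
  isEmbedding_κ₁ : Topology.IsEmbedding κ₁
  isEmbedding_κ₂ : Topology.IsEmbedding κ₂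
  range_κ₁ : Set.range κ₁ = {g | (φ g).1 = 1}
  range_κ₂ : Set.range κ₂ = {g | (φ g).2 = 1}
  /-- the inclusion of the core into `K₁` -/
  i₁ : G₀ →* K₁
  /-- the inclusion of the core into `K₂` -/
  i₂ : G₀ →* K₂
  κ₁_i₁ : ∀ g, κ₁ (i₁ g) = i g
  κ₂_i₂ : ∀ g, κ₂ (i₂ g) = i g
  connected_or : ConnectedSpace G ∨ ∀ g, ∃ k₁ k₂, κ₁ k₁ * κ₂ k₂ = g

namespace DoubleLieGroup

variable {G G₁ G₂ G₀ K₁ K₂ : Type}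
    [TopologicalSpace G] [Mfd G] [Group G] [LieGroup (mdl G) ∞ G]
    [TopologicalSpace G₁] [Mfd G₁] [Group G₁] [LieGroup (mdl G₁) ∞ G₁]
    [TopologicalSpace G₂] [Mfd G₂] [Group G₂] [LieGroup (mdl G₂) ∞ G₂]
    [TopologicalSpace G₀] [Mfd G₀] [Group G₀] [LieGroup (mdl G₀) ∞ G₀]
    [TopologicalSpace K₁] [Mfd K₁] [Group K₁] [LieGroup (mdl K₁) ∞ K₁]
    [TopologicalSpace K₂] [Mfd K₂] [Group K₂] [LieGroup (mdl K₂) ∞ K₂]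

/-- The restriction `φ₂ : K₁ → G₂` of `φ`. -/
def φ₂ (𝔾 : DoubleLieGroup G G₁ G₂ G₀ K₁ K₂) : K₁ →* G₂ :=
  (MonoidHom.snd G₁ G₂).comp (𝔾.φ.comp 𝔾.κ₁)

/-- The restriction `φ₁ : K₂ → G₁` of `φ`. -/
def φ₁ (𝔾 : DoubleLieGroup G G₁ G₂ G₀ K₁ K₂) : K₂ →* G₁ :=
  (MonoidHom.fst G₁ G₂).comp (𝔾.φ.comp 𝔾.κ₂)

end DoubleLieGroup

/-! ### The automorphism group of the trivial double vector space -/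

section Aut

variable (n₁ n₂ n₀ : ℕ)

/-- The identity of `GL(n₁) × GL(n₂) × GL(n₀)`. -/
def ρG : ContMDiffMonoidMorphism (mdl (GLin n₁ × GLin n₂ × GLin n₀))
    (mdl (GLin n₁ × GLin n₂ × GLin n₀)) ∞ (GLin n₁ × GLin n₂ × GLin n₀)
    (GLin n₁ × GLin n₂ × GLin n₀) :=
  { MonoidHom.id _ with contMDiff_toFun := contMDiff_id }

/-- The inclusion of `GL(n₂) × GL(n₀)` into `GL(n₁) × GL(n₂) × GL(n₀)`. -/
def ρK₁ : ContMDiffMonoidMorphism (mdl (GLin n₂ × GLin n₀))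
    (mdl (GLin n₁ × GLin n₂ × GLin n₀)) ∞ (GLin n₂ × GLin n₀)
    (GLin n₁ × GLin n₂ × GLin n₀) :=
  { MonoidHom.prod 1 (MonoidHom.id _) with
    contMDiff_toFun := ContMDiff.prodMk (I' := mdl (GLin n₁)) contMDiff_const contMDiff_id }

/-- The inclusion of `GL(n₁) × GL(n₀)` into `GL(n₁) × GL(n₂) × GL(n₀)`. -/
def ρK₂ : ContMDiffMonoidMorphism (mdl (GLin n₁ × GLin n₀))
    (mdl (GLin n₁ × GLin n₂ × GLin n₀)) ∞ (GLin n₁ × GLin n₀)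
    (GLin n₁ × GLin n₂ × GLin n₀) :=
  { MonoidHom.prod (MonoidHom.fst _ _) (MonoidHom.prod 1 (MonoidHom.snd _ _)) with
    contMDiff_toFun := ContMDiff.prodMk (I' := mdl (GLin n₁))
      (contMDiff_fst (I := mdl (GLin n₁)) (J := mdl (GLin n₀)))
      (ContMDiff.prodMk (I' := mdl (GLin n₂)) contMDiff_const
        (contMDiff_snd (I := mdl (GLin n₁)) (J := mdl (GLin n₀)))) }

/-- The inclusion of `GL(n₀)` into `GL(n₁) × GL(n₂) × GL(n₀)`. -/
def ρG₀ : ContMDiffMonoidMorphism (mdl (GLin n₀))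
    (mdl (GLin n₁ × GLin n₂ × GLin n₀)) ∞ (GLin n₀)
    (GLin n₁ × GLin n₂ × GLin n₀) :=
  { MonoidHom.prod 1 (MonoidHom.prod 1 (MonoidHom.id _)) with
    contMDiff_toFun := ContMDiff.prodMk (I' := mdl (GLin n₁)) contMDiff_const
      (ContMDiff.prodMk (I' := mdl (GLin n₂)) contMDiff_const contMDiff_id) }

/-- The automorphism group of the trivial double vector space `RR n₁ n₂ n₀`: quadruples
`(a₁, a₂, a₀, μ)` of three invertible linear maps and a bilinear map, with product
`(a₁b₁, a₂b₂, a₀b₀, μ ∘ (b₁ × b₂) + a₀ ∘ ν)`; see `isAut_iff` below. -/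
abbrev AutR : Type := SemiT (ρG n₁ n₂ n₀)

/-- The subgroup `a₁ = 1` of `AutR`, as a Lie group. -/
abbrev AutK₁ : Type := SemiT (ρK₁ n₁ n₂ n₀)

/-- The subgroup `a₂ = 1` of `AutR`, as a Lie group. -/
abbrev AutK₂ : Type := SemiT (ρK₂ n₁ n₂ n₀)

/-- The core `GL(n₀) ⋉ T` of `AutR`, the subgroup `a₁ = 1`, `a₂ = 1`, as a Lie group. -/
abbrev AutCore : Type := SemiT (ρG₀ n₁ n₂ n₀)

variable {n₁ n₂ n₀}

/-- The homomorphism `H' ⋉ T → H ⋉ T` induced by a homomorphism `H' → H` over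
`GL(n₁) × GL(n₂) × GL(n₀)`. -/
def SemiT.map {H H' : Type} [TopologicalSpace H] [Mfd H] [Group H]
    [TopologicalSpace H'] [Mfd H'] [Group H']
    (ρ : ContMDiffMonoidMorphism (mdl H) (mdl (GLin n₁ × GLin n₂ × GLin n₀)) ∞ H
      (GLin n₁ × GLin n₂ × GLin n₀))
    (ρ' : ContMDiffMonoidMorphism (mdl H') (mdl (GLin n₁ × GLin n₂ × GLin n₀)) ∞ H'
      (GLin n₁ × GLin n₂ × GLin n₀))
    (α : H' →* H) (hα : ∀ h, ρ (α h) = ρ' h) : SemiT ρ' →* SemiT ρ where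
  toFun a := SemiT.mk ρ (α a.lin) a.bil
  map_one' := by
    refine SemiT.ext ?_ ?_ <;> simp
  map_mul' a b := by
    refine SemiT.ext (by simp) ?_
    ext x y : 2
    simp [SemiT.a₀, SemiT.a₁, SemiT.a₂, hα]

lemma SemiT.contMDiff_map {H H' : Type} [TopologicalSpace H] [Mfd H] [Group H]
    [TopologicalSpace H'] [Mfd H'] [Group H']
    {ρ : ContMDiffMonoidMorphism (mdl H) (mdl (GLin n₁ × GLin n₂ × GLin n₀)) ∞ H
      (GLin n₁ × GLin n₂ × GLin n₀)}
    {ρ' : ContMDiffMonoidMorphism (mdl H') (mdl (GLin n₁ × GLin n₂ × GLin n₀)) ∞ H'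
      (GLin n₁ × GLin n₂ × GLin n₀)}
    {α : H' →* H} (hα : ∀ h, ρ (α h) = ρ' h) (h : ContMDiff (mdl H') (mdl H) ∞ α) :
    ContMDiff (mdl (SemiT ρ')) (mdl (SemiT ρ)) ∞ (SemiT.map ρ ρ' α hα) :=
  SemiT.contMDiff_of (h.comp SemiT.contMDiff_lin) SemiT.contMDiff_bil

/-- The action `(a₁, a₂, a₀, μ)(x, y, z) = (a₁ x, a₂ y, a₀ z + μ(x, y))` of `AutR` on the trivial
double vector space. -/
def AutR.act (a : AutR n₁ n₂ n₀) (ξ : RR n₁ n₂ n₀) : RR n₁ n₂ n₀ :=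
  ((a.a₁ : R n₁ →L[ℝ] R n₁) ξ.1, (a.a₂ : R n₂ →L[ℝ] R n₂) ξ.2.1,
    (a.a₀ : R n₀ →L[ℝ] R n₀) ξ.2.2 + a.bil ξ.1 ξ.2.1)

variable (n₁ n₂ n₀) in
/-- The double Lie group `1 → GL(n₀) ⋉ T → AutR → GL(n₁) × GL(n₂) → 1`. -/
def autDLG : DoubleLieGroup (AutR n₁ n₂ n₀) (GLin n₁) (GLin n₂) (AutCore n₁ n₂ n₀)
    (AutK₁ n₁ n₂ n₀) (AutK₂ n₁ n₂ n₀) where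
  i := SemiT.map _ _ (ρG₀ n₁ n₂ n₀).toMonoidHom (fun _ => rfl)
  φ :=
    { toFun := fun a => (a.a₁, a.a₂)
      map_one' := by simp
      map_mul' := by simp }
  contMDiff_i := SemiT.contMDiff_map _ (ρG₀ n₁ n₂ n₀).contMDiff_toFun
  contMDiff_φ := ContMDiff.prodMk (I' := mdl (GLin n₁)) (J' := mdl (GLin n₂))
    ((contMDiff_fst (I := mdl (GLin n₁)) (J := mdl (GLin n₂ × GLin n₀))).comp
      SemiT.contMDiff_lin)
    ((contMDiff_fst (I := mdl (GLin n₂)) (J := mdl (GLin n₀))).comp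
      ((contMDiff_snd (I := mdl (GLin n₁)) (J := mdl (GLin n₂ × GLin n₀))).comp
        SemiT.contMDiff_lin))
  injective_i := fun a b h => by
    have h1 := congrArg SemiT.lin h
    have h2 := congrArg SemiT.bil h
    exact SemiT.ext (congrArg (fun x => x.2.2) h1) h2
  range_i := by
    ext g
    constructor
    · rintro ⟨a, rfl⟩
      rfl
    · intro hg
      have h1 : g.a₁ = 1 := congrArg Prod.fst hg
      have h2 : g.a₂ = 1 := congrArg Prod.snd hg
      refine ⟨SemiT.mk _ g.a₀ g.bil, SemiT.ext ?_ rfl⟩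
      exact Prod.ext h1.symm (Prod.ext h2.symm rfl)
  surjective_φ := fun ⟨a, b⟩ => ⟨SemiT.mk _ (a, b, 1) 0, rfl⟩
  κ₁ := SemiT.map _ _ (ρK₁ n₁ n₂ n₀).toMonoidHom (fun _ => rfl)
  κ₂ := SemiT.map _ _ (ρK₂ n₁ n₂ n₀).toMonoidHom (fun _ => rfl)
  contMDiff_κ₁ := SemiT.contMDiff_map _ (ρK₁ n₁ n₂ n₀).contMDiff_toFun
  contMDiff_κ₂ := SemiT.contMDiff_map _ (ρK₂ n₁ n₂ n₀).contMDiff_toFun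
  isEmbedding_κ₁ := by
    refine Function.LeftInverse.isEmbedding
      (f := fun a : AutR n₁ n₂ n₀ => SemiT.mk (ρK₁ n₁ n₂ n₀) a.lin.2 a.bil) (fun a => rfl) ?_ ?_
    · exact Continuous.prodMk (continuous_snd.comp SemiT.contMDiff_lin.continuous)
        SemiT.contMDiff_bil.continuous
    · exact (SemiT.contMDiff_map (fun _ => rfl) (ρK₁ n₁ n₂ n₀).contMDiff_toFun).continuous
  isEmbedding_κ₂ := by
    refine Function.LeftInverse.isEmbedding
      (f := fun a : AutR n₁ n₂ n₀ => SemiT.mk (ρK₂ n₁ n₂ n₀) (a.lin.1, a.lin.2.2) a.bil)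
      (fun a => rfl) ?_ ?_
    · exact Continuous.prodMk ((continuous_fst.prodMk (continuous_snd.comp continuous_snd)).comp
        SemiT.contMDiff_lin.continuous) SemiT.contMDiff_bil.continuous
    · exact (SemiT.contMDiff_map (fun _ => rfl) (ρK₂ n₁ n₂ n₀).contMDiff_toFun).continuous
  range_κ₁ := by
    ext g
    constructor
    · rintro ⟨a, rfl⟩
      rfl
    · intro (hg : g.a₁ = 1)
      exact ⟨SemiT.mk _ (g.a₂, g.a₀) g.bil, SemiT.ext (Prod.ext hg.symm rfl) rfl⟩
  range_κ₂ := by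
    ext g
    constructor
    · rintro ⟨a, rfl⟩
      rfl
    · intro (hg : g.a₂ = 1)
      exact ⟨SemiT.mk _ (g.a₁, g.a₀) g.bil,
        SemiT.ext (Prod.ext rfl (Prod.ext hg.symm rfl)) rfl⟩
  i₁ := SemiT.map _ _ (MonoidHom.prod 1 (MonoidHom.id _)) (fun _ => rfl)
  i₂ := SemiT.map _ _ (MonoidHom.prod 1 (MonoidHom.id _)) (fun _ => rfl)
  κ₁_i₁ := fun _ => rfl
  κ₂_i₂ := fun _ => rfl
  connected_or := Or.inr fun g => by
    refine ⟨SemiT.mk _ (g.a₂, g.a₀) (g.bil.bilinearComp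
      ((g.a₁⁻¹ : GLin n₁) : R n₁ →L[ℝ] R n₁) (ContinuousLinearMap.id ℝ (R n₂))),
      SemiT.mk _ (g.a₁, 1) 0, SemiT.ext ?_ ?_⟩
    · change ((1, g.a₂, g.a₀) * (g.a₁, 1, 1) : GLin n₁ × GLin n₂ × GLin n₀) = _
      simp only [Prod.mk_mul_mk, one_mul, mul_one]
      rfl
    · ext x y : 2
      change g.bil (((g.a₁⁻¹ : GLin n₁) : R n₁ →L[ℝ] R n₁) ((g.a₁ : R n₁ →L[ℝ] R n₁) x)) y +
        (g.a₀ : R n₀ →L[ℝ] R n₀) 0 = _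
      rw [SemiT.gl_inv_apply, map_zero, add_zero]

/-- A morphism of the trivial double vector space `RR n₁ n₂ n₀` to itself: a map that covers linear
maps of the two sides and is linear on the fibres over either side. -/
structure IsDVSHom (f : RR n₁ n₂ n₀ → RR n₁ n₂ n₀) : Prop where
  side₁ : ∃ a₁ : R n₁ →ₗ[ℝ] R n₁, ∀ ξ, (f ξ).1 = a₁ ξ.1
  side₂ : ∃ a₂ : R n₂ →ₗ[ℝ] R n₂, ∀ ξ, (f ξ).2.1 = a₂ ξ.2.1
  linear₁ : ∀ x, IsLinearMap ℝ (fun η : R n₂ × R n₀ => (f (x, η)).2)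
  linear₂ : ∀ y, IsLinearMap ℝ
    (fun η : R n₁ × R n₀ => ((f (η.1, y, η.2)).1, (f (η.1, y, η.2)).2.2))

/-- An automorphism of the trivial double vector space: an invertible morphism. -/
def IsDVSAut (f : RR n₁ n₂ n₀ → RR n₁ n₂ n₀) : Prop :=
  IsDVSHom f ∧ ∃ g, IsDVSHom g ∧ (∀ ξ, g (f ξ) = ξ) ∧ ∀ ξ, f (g ξ) = ξ

lemma AutR.act_mul (a b : AutR n₁ n₂ n₀) (ξ : RR n₁ n₂ n₀) :
    AutR.act (a * b) ξ = AutR.act a (AutR.act b ξ) := by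
  simp only [AutR.act, SemiT.a₁_mul, SemiT.a₂_mul, SemiT.a₀_mul, SemiT.bil_mul, Units.val_mul,
    mul_apply_eq_comp, map_add]
  abel_nf

lemma AutR.act_one (ξ : RR n₁ n₂ n₀) : AutR.act (1 : AutR n₁ n₂ n₀) ξ = ξ := by
  simp [AutR.act]

lemma AutR.act_injective {a b : AutR n₁ n₂ n₀} (h : ∀ ξ, AutR.act a ξ = AutR.act b ξ) : a = b := by
  have h1 : a.a₁ = b.a₁ := by
    ext x : 2
    exact congrArg (fun t => t.1) (h (x, 0, 0))
  have h2 : a.a₂ = b.a₂ := by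
    ext x : 2
    exact congrArg (fun t => t.2.1) (h (0, x, 0))
  have h0 : a.a₀ = b.a₀ := by
    ext x : 2
    have := congrArg (fun t => t.2.2) (h (0, 0, x))
    simpa [AutR.act] using this
  refine SemiT.ext (Prod.ext h1 (Prod.ext h2 h0)) ?_
  ext x y : 2
  have := congrArg (fun t => t.2.2) (h (x, y, 0))
  simpa [AutR.act] using this

lemma AutR.isDVSHom_act (a : AutR n₁ n₂ n₀) : IsDVSHom (AutR.act a) where
  side₁ := ⟨(a.a₁ : R n₁ →L[ℝ] R n₁), fun _ => rfl⟩
  side₂ := ⟨(a.a₂ : R n₂ →L[ℝ] R n₂), fun _ => rfl⟩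
  linear₁ x := by
    constructor
    · intro u v
      refine Prod.ext (by simp [AutR.act]) ?_
      simp [AutR.act]
      abel
    · intro c u
      refine Prod.ext (by simp [AutR.act]) (by simp [AutR.act])
  linear₂ y := by
    constructor
    · intro u v
      refine Prod.ext (by simp [AutR.act]) ?_
      simp [AutR.act]
      abel
    · intro c u
      refine Prod.ext (by simp [AutR.act]) (by simp [AutR.act])

/-- `AutR n₁ n₂ n₀` is the automorphism group of the trivial double vector space. -/
theorem isAut_iff (f : RR n₁ n₂ n₀ → RR n₁ n₂ n₀) :
    IsDVSAut f ↔ ∃ a : AutR n₁ n₂ n₀, f = AutR.act a := by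
  constructor
  · rintro ⟨hf, g, hg, hgf, hfg⟩
    obtain ⟨a₁, h₁⟩ := hf.side₁
    obtain ⟨a₂, h₂⟩ := hf.side₂
    obtain ⟨b₁, k₁⟩ := hg.side₁
    obtain ⟨b₂, k₂⟩ := hg.side₂
    have p : ∀ {f : RR n₁ n₂ n₀ → RR n₁ n₂ n₀}, IsDVSHom f → ∀ x z, (f (x, 0, z)).2.2 =
        (f (0, 0, z)).2.2 := by
      intro f hf x z
      have e := (hf.linear₂ 0).map_add (x, 0) (0, z)
      have e' := congrArg Prod.snd e
      have z1 : (f (x, 0, 0)).2 = 0 := (hf.linear₁ x).map_zero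
      simp only [Prod.mk_add_mk, add_zero, zero_add] at e'
      rw [e', z1, Prod.snd_zero, zero_add]
    have q : ∀ {f : RR n₁ n₂ n₀ → RR n₁ n₂ n₀}, IsDVSHom f → ∀ x y z, (f (x, y, z)).2.2 =
        (f (0, 0, z)).2.2 + (f (x, y, 0)).2.2 := by
      intro f hf x y z
      have e := (hf.linear₁ x).map_add (0, z) (y, 0)
      have e' := congrArg Prod.snd e
      simp only [Prod.mk_add_mk, add_zero, zero_add, Prod.snd_add] at e'
      rw [e', p hf x z]
    have lin₀ : ∀ {f : RR n₁ n₂ n₀ → RR n₁ n₂ n₀}, IsDVSHom f → IsLinearMap ℝ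
        (fun z => (f (0, 0, z)).2.2) := by
      intro f hf
      constructor
      · intro u v
        have e := congrArg Prod.snd ((hf.linear₁ 0).map_add (0, u) (0, v))
        simpa using e
      · intro c u
        have e := congrArg Prod.snd ((hf.linear₁ 0).map_smul c (0, u))
        simpa using e
    have key₁ : ∀ x, b₁ (a₁ x) = x := fun x => by
      have := congrArg Prod.fst (hgf (x, 0, 0))
      rwa [k₁, h₁] at this
    have key₁' : ∀ x, a₁ (b₁ x) = x := fun x => by
      have := congrArg Prod.fst (hfg (x, 0, 0))
      rwa [h₁, k₁] at this
    have key₂ : ∀ y, b₂ (a₂ y) = y := fun y => by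
      have := congrArg (fun t => t.2.1) (hgf (0, y, 0))
      simpa only [k₂, h₂] using this
    have key₂' : ∀ y, a₂ (b₂ y) = y := fun y => by
      have := congrArg (fun t => t.2.1) (hfg (0, y, 0))
      simpa only [k₂, h₂] using this
    have v : ∀ {f : RR n₁ n₂ n₀ → RR n₁ n₂ n₀}, IsDVSHom f → ∀ z,
        f (0, 0, z) = (0, 0, (f (0, 0, z)).2.2) := by
      intro f hf z
      obtain ⟨a₁, h₁⟩ := hf.side₁
      obtain ⟨a₂, h₂⟩ := hf.side₂
      exact Prod.ext (by simp [h₁]) (Prod.ext (by simp [h₂]) rfl)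
    have key₀ : ∀ z, (g (0, 0, (f (0, 0, z)).2.2)).2.2 = z := fun z => by
      rw [← v hf z, hgf]
    have key₀' : ∀ z, (f (0, 0, (g (0, 0, z)).2.2)).2.2 = z := fun z => by
      rw [← v hg z, hfg]
    let u₁ : GLin n₁ := ⟨LinearMap.toContinuousLinearMap a₁, LinearMap.toContinuousLinearMap b₁,
      by ext x : 1; exact key₁' x, by ext x : 1; exact key₁ x⟩
    let u₂ : GLin n₂ := ⟨LinearMap.toContinuousLinearMap a₂, LinearMap.toContinuousLinearMap b₂,
      by ext x : 1; exact key₂' x, by ext x : 1; exact key₂ x⟩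
    let u₀ : GLin n₀ := ⟨LinearMap.toContinuousLinearMap ((lin₀ hf).mk' _),
      LinearMap.toContinuousLinearMap ((lin₀ hg).mk' _),
      by ext x : 1; exact key₀' x, by ext x : 1; exact key₀ x⟩
    let μ : R n₁ →ₗ[ℝ] R n₂ →ₗ[ℝ] R n₀ := LinearMap.mk₂ ℝ (fun x y => (f (x, y, 0)).2.2)
      (fun x x' y => by
        simpa using congrArg Prod.snd ((hf.linear₂ y).map_add (x, 0) (x', 0)))
      (fun c x y => by
        simpa using congrArg Prod.snd ((hf.linear₂ y).map_smul c (x, 0)))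
      (fun x y y' => by
        simpa using congrArg Prod.snd ((hf.linear₁ x).map_add (y, 0) (y', 0)))
      (fun c x y => by
        simpa using congrArg Prod.snd ((hf.linear₁ x).map_smul c (y, 0)))
    let μ' : Bil n₁ n₂ n₀ := LinearMap.toContinuousLinearMap
      ((LinearMap.toContinuousLinearMap :
        (R n₂ →ₗ[ℝ] R n₀) ≃ₗ[ℝ] (R n₂ →L[ℝ] R n₀)).toLinearMap ∘ₗ μ)
    refine ⟨SemiT.mk _ (u₁, u₂, u₀) μ', ?_⟩
    funext ξ
    exact Prod.ext (h₁ ξ) (Prod.ext (h₂ ξ) (q hf ξ.1 ξ.2.1 ξ.2.2))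
  · rintro ⟨a, rfl⟩
    refine ⟨a.isDVSHom_act, AutR.act a⁻¹, a⁻¹.isDVSHom_act, fun ξ => ?_, fun ξ => ?_⟩
    · rw [← AutR.act_mul, inv_mul_cancel, AutR.act_one]
    · rw [← AutR.act_mul, mul_inv_cancel, AutR.act_one]

end Aut

/-! ### Smooth vector bundles -/

/-- A local trivialization with fibre `F` is smooth if it is a diffeomorphism. -/
def IsSmoothTriv {Z B F V' H' : Type*} [TopologicalSpace Z] [Mfd Z] [TopologicalSpace B] [Mfd B]
    [TopologicalSpace F] [NormedAddCommGroup V'] [NormedSpace ℝ V'] [TopologicalSpace H']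
    [ChartedSpace H' F] (J : ModelWithCorners ℝ V' H') {π : Z → B}
    (e : Bundle.Trivialization F π) : Prop :=
  ContMDiffOn (mdl Z) ((mdl B).prod J) ∞ e e.source ∧
    ContMDiffOn ((mdl B).prod J) (mdl Z) ∞ e.toOpenPartialHomeomorph.symm e.target

/-- A smooth real vector bundle structure on a map `π` of manifolds. The sum `add u v` is meaningful
only if `π u = π v`. The trivializations are bijective on the fibres and carry the operations to
those of a space `R r`, so every fibre is a finite-dimensional real vector space (`VBundle.Fiber`).
The rank may vary. -/
structure VBundle {Z B : Type*} [TopologicalSpace Z] [Mfd Z] [TopologicalSpace B] [Mfd B]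
    (π : Z → B) where
  /-- addition in the fibres -/
  add : Z → Z → Z
  /-- scalar multiplication in the fibres -/
  smul : ℝ → Z → Z
  /-- the zero section -/
  zero : B → Z
  contMDiff_proj : ContMDiff (mdl Z) (mdl B) ∞ π
  proj_add : ∀ u v, π u = π v → π (add u v) = π u
  proj_smul : ∀ c u, π (smul c u) = π u
  proj_zero : ∀ b, π (zero b) = b
  exists_triv : ∀ b, ∃ (r : ℕ) (e : Bundle.Trivialization (R r) π),
    b ∈ e.baseSet ∧ IsSmoothTriv 𝓘(ℝ, R r) e ∧
    (∀ u v, π u ∈ e.baseSet → π u = π v → (e (add u v)).2 = (e u).2 + (e v).2) ∧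
    (∀ c u, π u ∈ e.baseSet → (e (smul c u)).2 = c • (e u).2) ∧
    ∀ x ∈ e.baseSet, (e (zero x)).2 = 0

namespace VBundle

section

variable {Z B : Type*} [TopologicalSpace Z] [Mfd Z] [TopologicalSpace B] [Mfd B] {π : Z → B}
  (A : VBundle π)

/-- The fibre over `b`. -/
@[nolint unusedArguments]
def Fiber (_A : VBundle π) (b : B) : Type _ := {u : Z // π u = b}

variable {A} in
/-- A point of a fibre as a point of the total space. -/
def Fiber.pt {b : B} (u : A.Fiber b) : Z := u.1

variable {A} in
lemma Fiber.proj_pt {b : B} (u : A.Fiber b) : π u.pt = b := u.2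

variable {A} in
@[ext] lemma Fiber.ext {b : B} {u v : A.Fiber b} (h : u.pt = v.pt) : u = v := Subtype.ext h

variable (b : B)

instance : Zero (A.Fiber b) := ⟨⟨A.zero b, A.proj_zero b⟩⟩
instance : Add (A.Fiber b) :=
  ⟨fun u v => ⟨A.add u.pt v.pt, (A.proj_add _ _ (u.2.trans v.2.symm)).trans u.2⟩⟩
instance : SMul ℝ (A.Fiber b) := ⟨fun c u => ⟨A.smul c u.pt, (A.proj_smul _ _).trans u.2⟩⟩
instance : Neg (A.Fiber b) := ⟨fun u => (-1 : ℝ) • u⟩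
instance : Sub (A.Fiber b) := ⟨fun u v => u + -v⟩
instance : SMul ℕ (A.Fiber b) := ⟨fun c u => (c : ℝ) • u⟩
instance : SMul ℤ (A.Fiber b) := ⟨fun c u => (c : ℝ) • u⟩

lemma exists_coord : ∃ (r : ℕ) (f : A.Fiber b → R r), Function.Injective f ∧ f 0 = 0 ∧
    (∀ u v, f (u + v) = f u + f v) ∧ ∀ (c : ℝ) u, f (c • u) = c • f u := by
  obtain ⟨r, e, hb, -, hadd, hsmul, hzero⟩ := A.exists_triv b
  refine ⟨r, fun u => (e u.pt).2, fun u v h => ?_, hzero b hb, fun u v => ?_, fun c u => ?_⟩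
  · have hu : u.pt ∈ e.source := e.mem_source.2 (u.proj_pt.symm ▸ hb)
    have hv : v.pt ∈ e.source := e.mem_source.2 (v.proj_pt.symm ▸ hb)
    refine Fiber.ext (e.injOn hu hv (Prod.ext ?_ h))
    exact (e.coe_fst hu).trans ((u.proj_pt.trans v.proj_pt.symm).trans (e.coe_fst hv).symm)
  · exact hadd _ _ (u.proj_pt.symm ▸ hb) (u.proj_pt.trans v.proj_pt.symm)
  · exact hsmul _ _ (u.proj_pt.symm ▸ hb)

instance : AddCommGroup (A.Fiber b) :=
  let f := (A.exists_coord b).choose_spec.choose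
  have hf := (A.exists_coord b).choose_spec.choose_spec
  have hneg : ∀ u, f (-u) = -f u := fun u => (hf.2.2.2 (-1) u).trans (by simp [f])
  Function.Injective.addCommGroup f hf.1 hf.2.1 hf.2.2.1 hneg
    (fun u v => by rw [sub_eq_add_neg, ← hneg]; exact hf.2.2.1 u (-v))
    (fun u n => (hf.2.2.2 n u).trans (Nat.cast_smul_eq_nsmul ℝ n _))
    (fun u n => (hf.2.2.2 n u).trans (Int.cast_smul_eq_zsmul ℝ n _))

instance : Module ℝ (A.Fiber b) :=
  let f := (A.exists_coord b).choose_spec.choose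
  have hf := (A.exists_coord b).choose_spec.choose_spec
  Function.Injective.module ℝ (⟨⟨f, hf.2.1⟩, hf.2.2.1⟩ : A.Fiber b →+ R _) hf.1 hf.2.2.2

variable {A b}

@[simp] lemma Fiber.pt_zero : (0 : A.Fiber b).pt = A.zero b := rfl
@[simp] lemma Fiber.pt_add (u v : A.Fiber b) : (u + v).pt = A.add u.pt v.pt := rfl
@[simp] lemma Fiber.pt_smul (c : ℝ) (u : A.Fiber b) : (c • u).pt = A.smul c u.pt := rfl

end

end VBundle

/-- A morphism `(f, g)` of vector bundles: smooth maps, `f` being linear on the fibres over `g`. -/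
structure IsVBHom {Z B Z' B' : Type*} [TopologicalSpace Z] [Mfd Z] [TopologicalSpace B] [Mfd B]
    [TopologicalSpace Z'] [Mfd Z'] [TopologicalSpace B'] [Mfd B'] {π : Z → B} {π' : Z' → B'}
    (A : VBundle π) (A' : VBundle π') (f : Z → Z') (g : B → B') : Prop where
  contMDiff_total : ContMDiff (mdl Z) (mdl Z') ∞ f
  contMDiff_base : ContMDiff (mdl B) (mdl B') ∞ g
  comm : ∀ u, π' (f u) = g (π u)
  map_add : ∀ u v, π u = π v → f (A.add u v) = A'.add (f u) (f v)
  map_smul : ∀ c u, f (A.smul c u) = A'.smul c (f u)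

/-! ### Frame bundles of vector bundles -/

/-- The vector `∑ xⁱ uᵢ` with coordinates `x` in the basis `u`. -/
def lincomb {n : ℕ} {W : Type*} [AddCommGroup W] [Module ℝ W] (u : Module.Basis (Fin n) ℝ W)
    (x : R n) : W := ∑ i, x i • u i

/-- The basis `u a`, whose `j`-th vector is `∑ aⁱⱼ uᵢ`, the image under `u` of the `j`-th column of
`a`. -/
def basisMul {n : ℕ} {W : Type*} [AddCommGroup W] [Module ℝ W] (u : Module.Basis (Fin n) ℝ W)
    (a : GLin n) : Module.Basis (Fin n) ℝ W :=
  Module.Basis.ofEquivFun (u.equivFun.trans (ContinuousLinearEquiv.ofUnit a).symm.toLinearEquiv)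

lemma lincomb_eq {n : ℕ} {W : Type*} [AddCommGroup W] [Module ℝ W] (u : Module.Basis (Fin n) ℝ W)
    (x : R n) : lincomb u x = u.equivFun.symm x := (u.equivFun_symm_apply x).symm

lemma basisMul_apply {n : ℕ} {W : Type*} [AddCommGroup W] [Module ℝ W]
    (u : Module.Basis (Fin n) ℝ W) (a : GLin n) (j : Fin n) :
    basisMul u a j = lincomb u ((a : R n →L[ℝ] R n) (Pi.single j 1)) := by
  rw [lincomb_eq, basisMul, Module.Basis.coe_ofEquivFun]
  rfl

lemma lincomb_basisMul {n : ℕ} {W : Type*} [AddCommGroup W] [Module ℝ W]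
    (u : Module.Basis (Fin n) ℝ W) (a : GLin n) (x : R n) :
    lincomb (basisMul u a) x = lincomb u ((a : R n →L[ℝ] R n) x) := by
  rw [lincomb_eq, lincomb_eq, basisMul, Module.Basis.equivFun_ofEquivFun]
  rfl

namespace VBundle

variable {Z B : Type*} [TopologicalSpace Z] [Mfd Z] [TopologicalSpace B] [Mfd B] {π : Z → B}

/-- The set of pairs of a point of the base and a basis of the fibre over it. -/
def FrameBundle (A : VBundle π) (n : ℕ) : Type _ := Σ b : B, Module.Basis (Fin n) ℝ (A.Fiber b)

namespace FrameBundle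

variable {A : VBundle π} {n : ℕ}

/-- The projection to the base. -/
def proj (Ω : A.FrameBundle n) : B := Sigma.fst Ω

/-- The basis in the fibre over `Ω.proj`. -/
def basis (Ω : A.FrameBundle n) : Module.Basis (Fin n) ℝ (A.Fiber Ω.proj) := Sigma.snd Ω

/-- The vector with coordinates `x` in the frame `Ω`. -/
def eval (Ω : A.FrameBundle n) (x : R n) : Z := (lincomb Ω.basis x).pt

/-- The action of `GL(n)` on frames. -/
def act (Ω : A.FrameBundle n) (a : GLin n) : A.FrameBundle n := ⟨Ω.proj, basisMul Ω.basis a⟩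

lemma eval_act (Ω : A.FrameBundle n) (a : GLin n) (x : R n) :
    (Ω.act a).eval x = Ω.eval ((a : R n →L[ℝ] R n) x) :=
  congrArg Fiber.pt (lincomb_basisMul Ω.basis a x)

end FrameBundle

/-- The manifold structure on the set of frames is the usual one: every smooth local frame `s` over
an open set `U` of the base, smoothness meaning that `(b, x) ↦ ∑ xⁱ sᵢ(b)` is smooth, gives a
diffeomorphism `(b, a) ↦ s(b)a` of `U × GL(n)` onto the set of frames over `U`. As smooth local
frames exist, this determines the manifold structure. -/
def IsFrameManifold (A : VBundle π) (n : ℕ) [TopologicalSpace (A.FrameBundle n)]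
    [Mfd (A.FrameBundle n)] : Prop :=
  ∀ (U : Set B) (s : B → A.FrameBundle n), IsOpen U → (∀ b ∈ U, (s b).proj = b) →
    ContMDiffOn ((mdl B).prod 𝓘(ℝ, R n)) (mdl Z) ∞ (fun p : B × R n => (s p.1).eval p.2)
      (U ×ˢ Set.univ) →
    ∃ e : Bundle.Trivialization (GLin n) (FrameBundle.proj (A := A) (n := n)),
      e.baseSet = U ∧ IsSmoothTriv (mdl (GLin n)) e ∧
      ∀ b ∈ U, ∀ a, e.toOpenPartialHomeomorph.symm (b, a) = (s b).act a

end VBundle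

/-! ### Double vector bundles -/

/-- A double vector bundle `(E; E₁, E₂; M)`: the structure maps of either vector bundle structure on
`E` are morphisms for the other one. For the addition of either structure this means compatibility
with the projections and scalar multiplications, which is contained in the conditions on these,
and the interchange law. -/
structure DVBundle (E E₁ E₂ M : Type*) [TopologicalSpace E] [Mfd E] [TopologicalSpace E₁] [Mfd E₁]
    [TopologicalSpace E₂] [Mfd E₂] [TopologicalSpace M] [Mfd M] where
  /-- the projection to the first side bundle -/
  σ₁ : E → E₁
  /-- the projection to the second side bundle -/
  σ₂ : E → E₂
  /-- the projection of the first side bundle -/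
  δ₁ : E₁ → M
  /-- the projection of the second side bundle -/
  δ₂ : E₂ → M
  /-- the vector bundle structure of `E` over `E₁` -/
  vI : VBundle σ₁
  /-- the vector bundle structure of `E` over `E₂` -/
  vII : VBundle σ₂
  /-- the vector bundle structure of `E₁` over `M` -/
  v₁ : VBundle δ₁
  /-- the vector bundle structure of `E₂` over `M` -/
  v₂ : VBundle δ₂
  hom_σ₁ : IsVBHom vII v₁ σ₁ δ₂
  hom_σ₂ : IsVBHom vI v₂ σ₂ δ₁
  hom_zeroI : IsVBHom v₁ vII vI.zero v₂.zero
  hom_zeroII : IsVBHom v₂ vI vII.zero v₁.zero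
  hom_smulI : ∀ c, IsVBHom vII vII (vI.smul c) (v₂.smul c)
  hom_smulII : ∀ c, IsVBHom vI vI (vII.smul c) (v₁.smul c)
  interchange : ∀ u u' w w', σ₁ u = σ₁ u' → σ₁ w = σ₁ w' → σ₂ u = σ₂ w → σ₂ u' = σ₂ w' →
    vII.add (vI.add u u') (vI.add w w') = vI.add (vII.add u w) (vII.add u' w')

namespace DVBundle

variable {E E₁ E₂ M : Type*} [TopologicalSpace E] [Mfd E] [TopologicalSpace E₁] [Mfd E₁]
    [TopologicalSpace E₂] [Mfd E₂] [TopologicalSpace M] [Mfd M] (D : DVBundle E E₁ E₂ M)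

/-- The fibre of the core over `m`: the points that are projected to the zeros of both side bundles
over `m`, as a subspace of the fibre of `E → E₁` over the zero. -/
def core (m : M) : Submodule ℝ (D.vI.Fiber (D.v₁.zero m)) where
  carrier := {u | D.σ₂ u.pt = D.v₂.zero m}
  zero_mem' := by
    change D.σ₂ (D.vI.zero (D.v₁.zero m)) = D.v₂.zero m
    rw [D.hom_zeroI.comm, D.v₁.proj_zero]
  add_mem' := by
    intro u v (hu : D.σ₂ u.pt = _) (hv : D.σ₂ v.pt = _)
    change D.σ₂ (D.vI.add u.pt v.pt) = _
    rw [D.hom_σ₂.map_add _ _ (u.proj_pt.trans v.proj_pt.symm), hu, hv]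
    exact congrArg VBundle.Fiber.pt (add_zero (0 : D.v₂.Fiber m))
  smul_mem' := by
    intro c u (hu : D.σ₂ u.pt = _)
    change D.σ₂ (D.vI.smul c u.pt) = _
    rw [D.hom_σ₂.map_smul, hu]
    exact congrArg VBundle.Fiber.pt (smul_zero (A := D.v₂.Fiber m) c)

/-- The side bundles have ranks `n₁`, `n₂` and the core has rank `n₀`. -/
def HasFiberDim (n₁ n₂ n₀ : ℕ) : Prop :=
  ∀ m, Module.finrank ℝ (D.v₁.Fiber m) = n₁ ∧ Module.finrank ℝ (D.v₂.Fiber m) = n₂ ∧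
    Module.finrank ℝ (D.core m) = n₀

/-- A decomposition of the double vector space over `m`: an isomorphism from
`E₁ₘ ⊕ E₂ₘ ⊕ E₀ₘ` that induces the identity on the two sides and on the core. -/
structure Decomposition (m : M) where
  /-- the isomorphism -/
  Ψ : D.v₁.Fiber m × D.v₂.Fiber m × D.core m → E
  σ₁_Ψ : ∀ v, D.σ₁ (Ψ v) = v.1.pt
  σ₂_Ψ : ∀ v, D.σ₂ (Ψ v) = v.2.1.pt
  addI : ∀ v₁ v₂ w₂ v₀ w₀, Ψ (v₁, v₂ + w₂, v₀ + w₀) = D.vI.add (Ψ (v₁, v₂, v₀)) (Ψ (v₁, w₂, w₀))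
  smulI : ∀ (c : ℝ) v₁ v₂ v₀, Ψ (v₁, c • v₂, c • v₀) = D.vI.smul c (Ψ (v₁, v₂, v₀))
  addII : ∀ v₁ w₁ v₂ v₀ w₀, Ψ (v₁ + w₁, v₂, v₀ + w₀) = D.vII.add (Ψ (v₁, v₂, v₀)) (Ψ (w₁, v₂, w₀))
  smulII : ∀ (c : ℝ) v₁ v₂ v₀, Ψ (c • v₁, v₂, c • v₀) = D.vII.smul c (Ψ (v₁, v₂, v₀))
  Ψ_core : ∀ v₀ : D.core m, Ψ (0, 0, v₀) = v₀.1.pt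
  injective_Ψ : Function.Injective Ψ
  surjective_Ψ : ∀ e, D.δ₁ (D.σ₁ e) = m → ∃ v, Ψ v = e

variable {D}

/-- The decomposition `Ψ_μ = Ψ ∘ (id, id, id, μ)` obtained from `Ψ` by translation with the
bilinear map `μ`. -/
def Decomposition.shift {m : M} (Ψ : D.Decomposition m)
    (μ : D.v₁.Fiber m →ₗ[ℝ] D.v₂.Fiber m →ₗ[ℝ] D.core m) : D.Decomposition m where
  Ψ v := Ψ.Ψ (v.1, v.2.1, v.2.2 + μ v.1 v.2.1)
  σ₁_Ψ v := Ψ.σ₁_Ψ _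
  σ₂_Ψ v := Ψ.σ₂_Ψ _
  addI v₁ v₂ w₂ v₀ w₀ := by
    rw [← Ψ.addI, map_add, add_add_add_comm]
  smulI c v₁ v₂ v₀ := by
    rw [← Ψ.smulI, map_smul, smul_add]
  addII v₁ w₁ v₂ v₀ w₀ := by
    rw [← Ψ.addII, map_add, LinearMap.add_apply, add_add_add_comm]
  smulII c v₁ v₂ v₀ := by
    rw [← Ψ.smulII, map_smul, LinearMap.smul_apply, smul_add]
  Ψ_core v₀ := by simpa using Ψ.Ψ_core v₀
  injective_Ψ v w h := by
    have h' := Ψ.injective_Ψ h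
    have h1 : v.1 = w.1 := congrArg (fun t => t.1) h'
    have h2 : v.2.1 = w.2.1 := congrArg (fun t => t.2.1) h'
    have h3 := congrArg (fun t => t.2.2) h'
    simp only [h1, h2] at h3
    exact Prod.ext h1 (Prod.ext h2 (add_right_cancel h3))
  surjective_Ψ e he := by
    obtain ⟨v, hv⟩ := Ψ.surjective_Ψ e he
    exact ⟨(v.1, v.2.1, v.2.2 - μ v.1 v.2.1), by simpa using hv⟩

/-- The translated decomposition in terms of the operations of `E`. -/
lemma Decomposition.shift_apply {m : M} (Ψ : D.Decomposition m)
    (μ : D.v₁.Fiber m →ₗ[ℝ] D.v₂.Fiber m →ₗ[ℝ] D.core m) (v₁ : D.v₁.Fiber m) (v₂ : D.v₂.Fiber m)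
    (v₀ : D.core m) : (Ψ.shift μ).Ψ (v₁, v₂, v₀) =
      D.vII.add (D.vI.add (D.vI.add (μ v₁ v₂).1.pt v₀.1.pt) (D.vII.zero v₂.pt))
        (Ψ.Ψ (v₁, v₂, 0)) := by
  have h0 : Ψ.Ψ (0, v₂, 0) = D.vII.zero v₂.pt := by
    have h := Ψ.smulII 0 0 v₂ 0
    rw [smul_zero, smul_zero] at h
    exact h.trans (congrArg VBundle.Fiber.pt
      (zero_smul ℝ (show D.vII.Fiber v₂.pt from ⟨Ψ.Ψ (0, v₂, 0), Ψ.σ₂_Ψ _⟩)))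
  have h1 : Ψ.Ψ (0, v₂, μ v₁ v₂ + v₀) =
      D.vI.add (D.vI.add (μ v₁ v₂).1.pt v₀.1.pt) (D.vII.zero v₂.pt) := by
    have h := Ψ.addI 0 0 v₂ (μ v₁ v₂ + v₀) 0
    rw [zero_add, add_zero, h0, Ψ.Ψ_core] at h
    exact h
  have h2 := Ψ.addII 0 v₁ v₂ (μ v₁ v₂ + v₀) 0
  rw [zero_add, add_zero, h1] at h2
  rw [← h2, add_comm (μ v₁ v₂) v₀]
  rfl

variable (D)

/-- A frame at `m`: bases of the sides and of the core of the double vector space over `m`, and a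
decomposition of it. -/
structure Frame (n₁ n₂ n₀ : ℕ) (m : M) where
  /-- the basis of the first side -/
  u : Module.Basis (Fin n₁) ℝ (D.v₁.Fiber m)
  /-- the basis of the second side -/
  v : Module.Basis (Fin n₂) ℝ (D.v₂.Fiber m)
  /-- the basis of the core -/
  w : Module.Basis (Fin n₀) ℝ (D.core m)
  /-- the decomposition -/
  dec : D.Decomposition m

/-- The set of frames at all points of the base. -/
def FrameBundle (n₁ n₂ n₀ : ℕ) : Type _ := Σ m : M, D.Frame n₁ n₂ n₀ m

variable {D} {n₁ n₂ n₀ : ℕ}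

/-- The bilinear map `μ(ū x, v̄ y) = w μ̃(x, y)` between the sides and the core, where `ū = u a₁`,
`v̄ = v a₂` and `μ̃` is the bilinear part of `a`. -/
def Frame.transport {m : M} (Ω : D.Frame n₁ n₂ n₀ m) (a : AutR n₁ n₂ n₀) :
    D.v₁.Fiber m →ₗ[ℝ] D.v₂.Fiber m →ₗ[ℝ] D.core m :=
  LinearMap.mk₂ ℝ (fun e₁ e₂ => lincomb Ω.w
      (a.bil ((basisMul Ω.u a.a₁).equivFun e₁) ((basisMul Ω.v a.a₂).equivFun e₂)))
    (fun _ _ _ => by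
      simp only [lincomb_eq, map_add, add_apply])
    (fun _ _ _ => by
      simp only [lincomb_eq, map_smul, smul_apply])
    (fun _ _ _ => by simp only [lincomb_eq, map_add])
    (fun _ _ _ => by simp only [lincomb_eq, map_smul])

namespace FrameBundle

/-- The projection to the base. -/
def proj (Ω : D.FrameBundle n₁ n₂ n₀) : M := Sigma.fst Ω

/-- The frame at `Ω.proj`. -/
def frame (Ω : D.FrameBundle n₁ n₂ n₀) : D.Frame n₁ n₂ n₀ Ω.proj := Sigma.snd Ω

/-- The projection to the frame bundle of the first side bundle. -/
def proj₁ (Ω : D.FrameBundle n₁ n₂ n₀) : D.v₁.FrameBundle n₁ := ⟨Ω.proj, Ω.frame.u⟩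

/-- The projection to the frame bundle of the second side bundle. -/
def proj₂ (Ω : D.FrameBundle n₁ n₂ n₀) : D.v₂.FrameBundle n₂ := ⟨Ω.proj, Ω.frame.v⟩

/-- The point `Ωξ = Ψ(u x, v y, w z)` with coordinates `ξ = (x, y, z)` in the frame `Ω`. -/
def eval (Ω : D.FrameBundle n₁ n₂ n₀) (ξ : RR n₁ n₂ n₀) : E :=
  Ω.frame.dec.Ψ (lincomb Ω.frame.u ξ.1, lincomb Ω.frame.v ξ.2.1, lincomb Ω.frame.w ξ.2.2)

/-- The action `Ωa = (u a₁, v a₂, w a₀; Ψ_μ)` of the automorphism group of the trivial double vector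
space on frames. -/
def act (Ω : D.FrameBundle n₁ n₂ n₀) (a : AutR n₁ n₂ n₀) : D.FrameBundle n₁ n₂ n₀ :=
  ⟨Ω.proj, ⟨basisMul Ω.frame.u a.a₁, basisMul Ω.frame.v a.a₂, basisMul Ω.frame.w a.a₀,
    Ω.frame.dec.shift (Ω.frame.transport a)⟩⟩

lemma eval_act (Ω : D.FrameBundle n₁ n₂ n₀) (a : AutR n₁ n₂ n₀) (ξ : RR n₁ n₂ n₀) :
    (Ω.act a).eval ξ = Ω.eval (a.act ξ) := by
  have key : Ω.frame.transport a (lincomb (basisMul Ω.frame.u a.a₁) ξ.1)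
      (lincomb (basisMul Ω.frame.v a.a₂) ξ.2.1) = lincomb Ω.frame.w (a.bil ξ.1 ξ.2.1) := by
    simp only [Frame.transport, LinearMap.mk₂_apply]
    rw [lincomb_eq (basisMul Ω.frame.u a.a₁), lincomb_eq (basisMul Ω.frame.v a.a₂),
      LinearEquiv.apply_symm_apply, LinearEquiv.apply_symm_apply]
  change Ω.frame.dec.Ψ (lincomb (basisMul Ω.frame.u a.a₁) ξ.1,
    lincomb (basisMul Ω.frame.v a.a₂) ξ.2.1, lincomb (basisMul Ω.frame.w a.a₀) ξ.2.2 +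
      Ω.frame.transport a (lincomb (basisMul Ω.frame.u a.a₁) ξ.1)
        (lincomb (basisMul Ω.frame.v a.a₂) ξ.2.1)) = _
  rw [key, lincomb_basisMul, lincomb_basisMul, lincomb_basisMul, lincomb_eq Ω.frame.w,
    lincomb_eq Ω.frame.w, ← map_add, ← lincomb_eq]
  rfl

end FrameBundle

variable (D)

/-- The manifold structure on the set of frames of a double vector bundle is the natural one: every
smooth local frame `s` over an open set `U` of the base, smoothness meaning that `(m, ξ) ↦ s(m)ξ` is
smooth, gives a diffeomorphism `(m, a) ↦ s(m)a` of `U × AutR` onto the set of frames over `U`. As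
smooth local frames exist, this determines the manifold structure. -/
def IsFrameManifold (n₁ n₂ n₀ : ℕ) [TopologicalSpace (D.FrameBundle n₁ n₂ n₀)]
    [Mfd (D.FrameBundle n₁ n₂ n₀)] : Prop :=
  ∀ (U : Set M) (s : M → D.FrameBundle n₁ n₂ n₀), IsOpen U → (∀ m ∈ U, (s m).proj = m) →
    ContMDiffOn ((mdl M).prod 𝓘(ℝ, RR n₁ n₂ n₀)) (mdl E) ∞
      (fun p : M × RR n₁ n₂ n₀ => (s p.1).eval p.2) (U ×ˢ Set.univ) →
    ∃ e : Bundle.Trivialization (AutR n₁ n₂ n₀)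
        (FrameBundle.proj (D := D) (n₁ := n₁) (n₂ := n₂) (n₀ := n₀)),
      e.baseSet = U ∧ IsSmoothTriv (mdl (AutR n₁ n₂ n₀)) e ∧
      ∀ m ∈ U, ∀ a, e.toOpenPartialHomeomorph.symm (m, a) = (s m).act a

end DVBundle

/-- A morphism `(f; f₁, f₂; f_M)` of double vector bundles. -/
structure IsDVBHom {E E₁ E₂ M E' E₁' E₂' M' : Type*} [TopologicalSpace E] [Mfd E]
    [TopologicalSpace E₁] [Mfd E₁] [TopologicalSpace E₂] [Mfd E₂] [TopologicalSpace M] [Mfd M]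
    [TopologicalSpace E'] [Mfd E'] [TopologicalSpace E₁'] [Mfd E₁'] [TopologicalSpace E₂'] [Mfd E₂']
    [TopologicalSpace M'] [Mfd M'] (D : DVBundle E E₁ E₂ M) (D' : DVBundle E' E₁' E₂' M')
    (f : E → E') (f₁ : E₁ → E₁') (f₂ : E₂ → E₂') (fM : M → M') : Prop where
  homI : IsVBHom D.vI D'.vI f f₁
  homII : IsVBHom D.vII D'.vII f f₂
  hom₁ : IsVBHom D.v₁ D'.v₁ f₁ fM
  hom₂ : IsVBHom D.v₂ D'.v₂ f₂ fM

/-- An isomorphism of double vector bundles: an invertible morphism. -/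
def IsDVBIso {E E₁ E₂ M E' E₁' E₂' M' : Type*} [TopologicalSpace E] [Mfd E]
    [TopologicalSpace E₁] [Mfd E₁] [TopologicalSpace E₂] [Mfd E₂] [TopologicalSpace M] [Mfd M]
    [TopologicalSpace E'] [Mfd E'] [TopologicalSpace E₁'] [Mfd E₁'] [TopologicalSpace E₂'] [Mfd E₂']
    [TopologicalSpace M'] [Mfd M'] (D : DVBundle E E₁ E₂ M) (D' : DVBundle E' E₁' E₂' M')
    (f : E → E') (f₁ : E₁ → E₁') (f₂ : E₂ → E₂') (fM : M → M') : Prop :=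
  IsDVBHom D D' f f₁ f₂ fM ∧ ∃ (g : E' → E) (g₁ : E₁' → E₁) (g₂ : E₂' → E₂) (gM : M' → M),
    IsDVBHom D' D g g₁ g₂ gM ∧
    Function.LeftInverse g f ∧ Function.RightInverse g f ∧
    Function.LeftInverse g₁ f₁ ∧ Function.RightInverse g₁ f₁ ∧
    Function.LeftInverse g₂ f₂ ∧ Function.RightInverse g₂ f₂ ∧
    Function.LeftInverse gM fM ∧ Function.RightInverse gM fM

/-! ### Double principal bundles -/

/-- `π : P → B` is a smooth principal bundle for the right action `act` of the Lie group `K`. -/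
structure IsPrincipalBundle {P B K : Type*} [TopologicalSpace P] [Mfd P] [TopologicalSpace B]
    [Mfd B] [TopologicalSpace K] [Mfd K] [Group K] [LieGroup (mdl K) ∞ K]
    (π : P → B) (act : P → K → P) : Prop where
  contMDiff_proj : ContMDiff (mdl P) (mdl B) ∞ π
  contMDiff_act : ContMDiff ((mdl P).prod (mdl K)) (mdl P) ∞ (fun p : P × K => act p.1 p.2)
  act_one : ∀ p, act p 1 = p
  act_mul : ∀ p k l, act p (k * l) = act (act p k) l
  proj_act : ∀ p k, π (act p k) = π p
  exists_triv : ∀ b, ∃ e : Bundle.Trivialization K π, b ∈ e.baseSet ∧ IsSmoothTriv (mdl K) e ∧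
    ∀ p, π p ∈ e.baseSet → ∀ k, (e (act p k)).2 = (e p).2 * k

/-- A double principal bundle `(P; P₁, P₂; M)` with structure groups `G₁`, `G₂`, `K₁`, `K₂`. -/
structure IsDPB {P P₁ P₂ M G₁ G₂ G₀ K₁ K₂ : Type*}
    [TopologicalSpace P] [Mfd P] [TopologicalSpace P₁] [Mfd P₁] [TopologicalSpace P₂] [Mfd P₂]
    [TopologicalSpace M] [Mfd M]
    [TopologicalSpace G₁] [Mfd G₁] [Group G₁] [LieGroup (mdl G₁) ∞ G₁]
    [TopologicalSpace G₂] [Mfd G₂] [Group G₂] [LieGroup (mdl G₂) ∞ G₂]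
    [TopologicalSpace G₀] [Mfd G₀] [Group G₀] [LieGroup (mdl G₀) ∞ G₀]
    [TopologicalSpace K₁] [Mfd K₁] [Group K₁] [LieGroup (mdl K₁) ∞ K₁]
    [TopologicalSpace K₂] [Mfd K₂] [Group K₂] [LieGroup (mdl K₂) ∞ K₂]
    (i₁ : G₀ →* K₁) (φ₂ : K₁ →* G₂) (i₂ : G₀ →* K₂) (φ₁ : K₂ →* G₁)
    (π₁ : P → P₁) (π₂ : P → P₂) (lam₁ : P₁ → M) (lam₂ : P₂ → M)
    (actK₁ : P → K₁ → P) (actK₂ : P → K₂ → P) (act₁ : P₁ → G₁ → P₁) (act₂ : P₂ → G₂ → P₂) :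
    Prop where
  contMDiff_i₁ : ContMDiff (mdl G₀) (mdl K₁) ∞ i₁
  contMDiff_i₂ : ContMDiff (mdl G₀) (mdl K₂) ∞ i₂
  contMDiff_φ₁ : ContMDiff (mdl K₂) (mdl G₁) ∞ φ₁
  contMDiff_φ₂ : ContMDiff (mdl K₁) (mdl G₂) ∞ φ₂
  injective_i₁ : Function.Injective i₁
  injective_i₂ : Function.Injective i₂
  range_i₁ : i₁.range = φ₂.ker
  range_i₂ : i₂.range = φ₁.ker
  surjective_φ₁ : Function.Surjective φ₁
  surjective_φ₂ : Function.Surjective φ₂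
  principal_P₁ : IsPrincipalBundle lam₁ act₁
  principal_P₂ : IsPrincipalBundle lam₂ act₂
  principal_I : IsPrincipalBundle π₁ actK₁
  principal_II : IsPrincipalBundle π₂ actK₂
  comm : ∀ p, lam₁ (π₁ p) = lam₂ (π₂ p)
  hom_π₁ : ∀ p k, π₁ (actK₂ p k) = act₁ (π₁ p) (φ₁ k)
  hom_π₂ : ∀ p k, π₂ (actK₁ p k) = act₂ (π₂ p) (φ₂ k)
  act_core : ∀ p g, actK₁ p (i₁ g) = actK₂ p (i₂ g)

/-- A double principal bundle `(P; P₁, P₂; M)` whose structure group is the double Lie group `𝔾`: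
the actions of `K₁` and `K₂` on `P` are restrictions of the smooth right action `act` of `G`. -/
structure IsGDPB {P P₁ P₂ M : Type*} {G G₁ G₂ G₀ K₁ K₂ : Type}
    [TopologicalSpace P] [Mfd P] [TopologicalSpace P₁] [Mfd P₁] [TopologicalSpace P₂] [Mfd P₂]
    [TopologicalSpace M] [Mfd M]
    [TopologicalSpace G] [Mfd G] [Group G] [LieGroup (mdl G) ∞ G]
    [TopologicalSpace G₁] [Mfd G₁] [Group G₁] [LieGroup (mdl G₁) ∞ G₁]
    [TopologicalSpace G₂] [Mfd G₂] [Group G₂] [LieGroup (mdl G₂) ∞ G₂]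
    [TopologicalSpace G₀] [Mfd G₀] [Group G₀] [LieGroup (mdl G₀) ∞ G₀]
    [TopologicalSpace K₁] [Mfd K₁] [Group K₁] [LieGroup (mdl K₁) ∞ K₁]
    [TopologicalSpace K₂] [Mfd K₂] [Group K₂] [LieGroup (mdl K₂) ∞ K₂]
    (𝔾 : DoubleLieGroup G G₁ G₂ G₀ K₁ K₂)
    (π₁ : P → P₁) (π₂ : P → P₂) (lam₁ : P₁ → M) (lam₂ : P₂ → M)
    (act : P → G → P) (act₁ : P₁ → G₁ → P₁) (act₂ : P₂ → G₂ → P₂) : Prop where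
  contMDiff_act : ContMDiff ((mdl P).prod (mdl G)) (mdl P) ∞ (fun p : P × G => act p.1 p.2)
  act_one : ∀ p, act p 1 = p
  act_mul : ∀ p g h, act p (g * h) = act (act p g) h
  isDPB : IsDPB 𝔾.i₁ 𝔾.φ₂ 𝔾.i₂ 𝔾.φ₁ π₁ π₂ lam₁ lam₂ (fun p k => act p (𝔾.κ₁ k))
    (fun p k => act p (𝔾.κ₂ k)) act₁ act₂

/-! ### Associated bundles -/

/-- The associated bundle `P ×_G F`: the quotient of `P × F` by `(p, v) ∼ (pg, g⁻¹v)`. -/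
def Assoc {P G F : Type*} (act : P → G → P) (l : G → F → F) : Type _ :=
  Quot (fun a b : P × F => ∃ g : G, b.1 = act a.1 g ∧ a.2 = l g b.2)

/-- The class `[p, v]`. -/
def Assoc.mk {P G F : Type*} (act : P → G → P) (l : G → F → F) (p : P) (v : F) : Assoc act l :=
  Quot.mk _ (p, v)

/-- The manifold structure on `P ×_G F`, for a principal bundle `π : P → M` and a vector space `F`,
is the usual one: every smooth local section `s` of `P` over an open set `U` gives a
diffeomorphism `(m, v) ↦ [s(m), v]` of `U × F` onto the preimage of `U` under the projection
`Pr`. -/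
def IsAssocManifold {P G F M : Type*} [TopologicalSpace P] [Mfd P] [TopologicalSpace M] [Mfd M]
    [NormedAddCommGroup F] [NormedSpace ℝ F] (π : P → M) (act : P → G → P) (l : G → F → F)
    [TopologicalSpace (Assoc act l)] [Mfd (Assoc act l)] (Pr : Assoc act l → M) : Prop :=
  (∀ p v, Pr (Assoc.mk act l p v) = π p) ∧
  ∀ (U : Set M) (s : M → P), IsOpen U → (∀ m ∈ U, π (s m) = m) →
    ContMDiffOn (mdl M) (mdl P) ∞ s U →
    ∃ e : Bundle.Trivialization F Pr, e.baseSet = U ∧ IsSmoothTriv 𝓘(ℝ, F) e ∧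
      ∀ m ∈ U, ∀ v, e.toOpenPartialHomeomorph.symm (m, v) = Assoc.mk act l (s m) v

/-- `D` is the double vector bundle associated with the double principal bundle `(P; P₁, P₂; M)` and
actions `l`, `l₁`, `l₂` of its groups on the trivial double vector space `RR n₁ n₂ n₀` and its
sides: the projections are `[p, v] ↦ [πᵢ p, σᵢ v]`, and the operations are those of
`RR n₁ n₂ n₀`, computed on representatives with the same `p` (`[pg, v] = [p, gv]` gives such
representatives for any two points with the same projection). -/
structure IsAssocDVB {P P₁ P₂ M G G₁ G₂ : Type*} {n₁ n₂ n₀ : ℕ}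
    [TopologicalSpace P] [Mfd P] [TopologicalSpace P₁] [Mfd P₁] [TopologicalSpace P₂] [Mfd P₂]
    [TopologicalSpace M] [Mfd M]
    (π₁ : P → P₁) (π₂ : P → P₂) (lam₁ : P₁ → M) (lam₂ : P₂ → M)
    (act : P → G → P) (act₁ : P₁ → G₁ → P₁) (act₂ : P₂ → G₂ → P₂)
    (l : G → RR n₁ n₂ n₀ → RR n₁ n₂ n₀) (l₁ : G₁ → R n₁ → R n₁) (l₂ : G₂ → R n₂ → R n₂)
    [TopologicalSpace (Assoc act l)] [Mfd (Assoc act l)]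
    [TopologicalSpace (Assoc act₁ l₁)] [Mfd (Assoc act₁ l₁)]
    [TopologicalSpace (Assoc act₂ l₂)] [Mfd (Assoc act₂ l₂)]
    (D : DVBundle (Assoc act l) (Assoc act₁ l₁) (Assoc act₂ l₂) M) : Prop where
  manifold : IsAssocManifold (fun p => lam₁ (π₁ p)) act l (fun q => D.δ₁ (D.σ₁ q))
  manifold₁ : IsAssocManifold lam₁ act₁ l₁ D.δ₁
  manifold₂ : IsAssocManifold lam₂ act₂ l₂ D.δ₂
  σ₁_mk : ∀ p v, D.σ₁ (Assoc.mk act l p v) = Assoc.mk act₁ l₁ (π₁ p) v.1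
  σ₂_mk : ∀ p v, D.σ₂ (Assoc.mk act l p v) = Assoc.mk act₂ l₂ (π₂ p) v.2.1
  addI : ∀ p x y y' z z', D.vI.add (Assoc.mk act l p (x, y, z)) (Assoc.mk act l p (x, y', z')) =
    Assoc.mk act l p (x, y + y', z + z')
  smulI : ∀ (c : ℝ) p x y z, D.vI.smul c (Assoc.mk act l p (x, y, z)) =
    Assoc.mk act l p (x, c • y, c • z)
  addII : ∀ p x x' y z z', D.vII.add (Assoc.mk act l p (x, y, z)) (Assoc.mk act l p (x', y, z')) =
    Assoc.mk act l p (x + x', y, z + z')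
  smulII : ∀ (c : ℝ) p x y z, D.vII.smul c (Assoc.mk act l p (x, y, z)) =
    Assoc.mk act l p (c • x, y, c • z)
  add₁ : ∀ p x x', D.v₁.add (Assoc.mk act₁ l₁ p x) (Assoc.mk act₁ l₁ p x') =
    Assoc.mk act₁ l₁ p (x + x')
  smul₁ : ∀ (c : ℝ) p x, D.v₁.smul c (Assoc.mk act₁ l₁ p x) = Assoc.mk act₁ l₁ p (c • x)
  add₂ : ∀ p y y', D.v₂.add (Assoc.mk act₂ l₂ p y) (Assoc.mk act₂ l₂ p y') =
    Assoc.mk act₂ l₂ p (y + y')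
  smul₂ : ∀ (c : ℝ) p y, D.v₂.smul c (Assoc.mk act₂ l₂ p y) = Assoc.mk act₂ l₂ p (c • y)

/-- The natural action of `GL(n)` on `R n`. -/
def glAct {n : ℕ} (a : GLin n) (x : R n) : R n := (a : R n →L[ℝ] R n) x

/-- The associated bundle of the frame bundle of a vector bundle with fibre `R n`. -/
abbrev VBundle.FrameAssoc {Z B : Type*} [TopologicalSpace Z] [Mfd Z] [TopologicalSpace B] [Mfd B]
    {π : Z → B} (A : VBundle π) (n : ℕ) : Type _ :=
  Assoc (VBundle.FrameBundle.act (A := A) (n := n)) glAct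

/-- The associated bundle of the frame bundle of a double vector bundle with fibre
`RR n₁ n₂ n₀`. -/
abbrev DVBundle.FrameAssoc {E E₁ E₂ M : Type*} [TopologicalSpace E] [Mfd E] [TopologicalSpace E₁]
    [Mfd E₁] [TopologicalSpace E₂] [Mfd E₂] [TopologicalSpace M] [Mfd M]
    (D : DVBundle E E₁ E₂ M) (n₁ n₂ n₀ : ℕ) : Type _ :=
  Assoc (DVBundle.FrameBundle.act (D := D) (n₁ := n₁) (n₂ := n₂) (n₀ := n₀)) AutR.act

end DPB

end

open DPB

/-!
Frames of vector bundles and of double vector bundles are treated together. A `FrameSystem` consists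
of a set of frames, each of which identifies a model fibre `V` with a fibre of `Z → B`, and of a Lie
group `G` acting on `V` and simply transitively on the frames at each point, such that smooth local
frames with smooth inverse exist and a `G`-valued map is smooth as soon as its action on `V` is. Two
smooth local frames then differ by a smooth `G`-valued map. Hence the bijections
`(m, a) ↦ s(m)a` attached to the smooth local frames `s` are the trivializations of a principal
`G`-bundle (`FrameSystem.exists_isFrameMfd`, `FrameSystem.isPrincipalBundle`), and `[p, v] ↦ pv` is
a bijection of the associated bundle with `Z`. Under this bijection, trivializations of the
associated bundle become the trivializations of `Z` given by smooth local frames, so the natural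
manifold structure on the associated bundle is the one that makes the bijection a diffeomorphism
(`FrameSystem.isAssocManifold`). For vector bundles this is `VBundle.frameSystem`.

The heart of the matter is the local triviality of a double vector bundle, that is,
`DVBundle.HasFiberDim.frameSystem`. Over `m ∈ M` the map `σ₂` from the fibre of `E → E₁` over `e₁ ∈
E₁` to `E₂` is linear, and every element of its kernel is the sum, for the structure of `E` over
`E₂`, of the zero vector over `e₁` and a core element. The rank of `E → E₁` is locally constant,
hence constant along the segment from `0` to `e₁`, and over `0` the fibre is the sum of the image of
the zero section of `E → E₂` and the core. So the rank is `n₂ + n₀` everywhere and `σ₂` is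
surjective on the fibres (`DVBundle.HasFiberDim.lσ₂_surjective`). Over each section of a local frame
of `E₁` there is therefore a smooth linear lift of `E₂` to `E → E₁`
(`DVBundle.HasFiberDim.exists_lift`), and linear combinations of these lifts, taken with the other
structure of `E`, together with translations by the core give a smooth local decomposition
(`DVBundle.decompositionOfLift`). Two frames at the same point differ by an automorphism of the
trivial double vector space, an element of `AutR`.

As a manifold, `AutR` is `GL(nᵢ) × Kᵢ`, in such a way that `Kᵢ` acts by right multiplication on the
second factor. A trivialization of the `AutR`-bundle of frames thus splits into one of the frame
bundle of `Eᵢ` and one of a principal `Kᵢ`-bundle over it (`IsPrincipalBundle.of_factor`). Finally,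
the double vector bundle structure of `E` is transported to the associated bundles along the
evaluation diffeomorphisms (`DVBundle.transport`); its operations are those of the trivial double
vector space because evaluation in a frame is an isomorphism of double vector spaces.
-/

namespace DPB

/-! ### Manifold structures from charts with values in a manifold -/

section Glue

variable {P X ι : Type*} [TopologicalSpace X]

/-- The topology on a set `P` that is covered by the domains of injective partial maps `e i` to a
space `X`: a set is open if its images under all `e i` are open. -/
@[reducible] def glueTopology (e : ι → PartialEquiv P X) (ht : ∀ i, IsOpen (e i).target) :
    TopologicalSpace P where
  IsOpen O := ∀ i, IsOpen ((e i).target ∩ (e i).symm ⁻¹' O)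
  isOpen_univ i := by simpa using ht i
  isOpen_inter O O' h h' i := by
    rw [Set.preimage_inter, Set.inter_inter_distrib_left]
    exact (h i).inter (h' i)
  isOpen_sUnion S h i := by
    rw [Set.preimage_sUnion, Set.inter_iUnion₂]
    exact isOpen_biUnion fun O hO => h O hO i

/-- The maps `e i` are homeomorphisms for the glued topology when the changes of charts are
continuous. -/
def glueChart (e : ι → PartialEquiv P X) (ht : ∀ i, IsOpen (e i).target)
    (ho : ∀ i j, IsOpen ((e j).target ∩ (e j).symm ⁻¹' (e i).source))
    (hc : ∀ i j, ContinuousOn (fun x => e i ((e j).symm x))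
      ((e j).target ∩ (e j).symm ⁻¹' (e i).source)) (i : ι) :
    letI := glueTopology e ht
    OpenPartialHomeomorph P X :=
  letI := glueTopology e ht
  { e i with
    open_source := fun j => ho i j
    open_target := ht i
    continuousOn_toFun := by
      have hsrc : IsOpen (e i).source := fun j => ho i j
      refine (continuousOn_open_iff hsrc).2 fun O hO j => ?_
      have h := (hc i j).isOpen_inter_preimage (ho i j) hO
      rwa [Set.inter_assoc] at h
    continuousOn_invFun := (continuousOn_open_iff (ht i)).2 fun O hO => hO i }

/-- A manifold structure from homeomorphisms `e i` of open sets onto open sets of a manifold, when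
the changes of charts are smooth. -/
@[reducible] noncomputable def Mfd.ofCharts [Mfd X] [TopologicalSpace P] [T2Space P]
    [SecondCountableTopology P] (e : ι → OpenPartialHomeomorph P X)
    (hcov : ∀ p, ∃ i, p ∈ (e i).source)
    (hs : ∀ i j, ContMDiffOn (mdl X) (mdl X) ∞ (fun x => e i ((e j).symm x))
      ((e j).target ∩ (e j).symm ⁻¹' (e i).source)) : Mfd P :=
  letI charted : ChartedSpace (Mfd.H X) P :=
    { atlas := {f | ∃ i, ∃ c ∈ atlas (Mfd.H X) X, f = (e i).trans c}
      chartAt := fun p => (e (hcov p).choose).trans (chartAt (Mfd.H X) (e (hcov p).choose p))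
      mem_chart_source := fun p => by
        have := (hcov p).choose_spec
        simp [this]
      chart_mem_atlas := fun p => ⟨_, _, chart_mem_atlas _ _, rfl⟩ }
  { V := Mfd.V X
    H := Mfd.H X
    I := mdl X
    charted := charted
    isManifold := by
      refine isManifold_of_contDiffOn _ _ _ ?_
      rintro _ _ ⟨i, c, hc, rfl⟩ ⟨j, d, hd, rfl⟩
      rw [← contMDiffOn_iff_contDiffOn]
      have hc' := contMDiffOn_symm_of_mem_maximalAtlas (I := mdl X) (n := ∞)
        (StructureGroupoid.subset_maximalAtlas _ hc)
      have hd' := contMDiffOn_of_mem_maximalAtlas (I := mdl X) (n := ∞)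
        (StructureGroupoid.subset_maximalAtlas _ hd)
      apply (mdl X).contMDiff.comp_contMDiffOn
      have key : ContMDiffOn (mdl X) (mdl X) ∞ (fun x => d (e j ((e i).symm (c.symm x))))
          (((e i).trans c).symm.trans ((e j).trans d)).source := by
        refine hd'.comp ((hs j i).comp (hc'.mono ?_) ?_) ?_
        · intro x hx
          simp only [mfld_simps] at hx
          exact hx.1.1
        · intro x hx
          simp only [mfld_simps] at hx
          exact ⟨hx.1.2, hx.2.1⟩
        · intro x hx
          simp only [mfld_simps] at hx
          exact hx.2.2
      refine key.comp ((mdl X).contMDiffOn_symm.mono Set.inter_subset_right) ?_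
      intro x hx
      exact hx.1
    t2 := inferInstance
    secondCountable := inferInstance }

section

variable [Mfd X] [TopologicalSpace P] [T2Space P]
    [SecondCountableTopology P] (e : ι → OpenPartialHomeomorph P X)
    (hcov : ∀ p, ∃ i, p ∈ (e i).source)
    (hs : ∀ i j, ContMDiffOn (mdl X) (mdl X) ∞ (fun x => e i ((e j).symm x))
      ((e j).target ∩ (e j).symm ⁻¹' (e i).source))

lemma Mfd.contMDiffOn_ofCharts (i : ι) :
    letI := Mfd.ofCharts e hcov hs
    ContMDiffOn (mdl P) (mdl X) ∞ (e i) (e i).source := by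
  let _ := Mfd.ofCharts e hcov hs
  intro p hp
  set c := chartAt (Mfd.H X) (e i p)
  have hmem : (e i).trans c ∈ atlas (Mfd.H P) P := ⟨i, c, chart_mem_atlas _ _, rfl⟩
  have h1 : ContMDiffAt (mdl P) (mdl X) ∞ ((e i).trans c) p :=
    (contMDiffOn_of_mem_maximalAtlas (I := mdl P) (n := ∞) (e := (e i).trans c)
      (IsManifold.subset_maximalAtlas hmem)).contMDiffAt
      (((e i).trans c).open_source.mem_nhds (by simp [hp, c]))
  have h2 : ContMDiffAt (mdl X) (mdl X) ∞ c.symm (c (e i p)) :=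
    (contMDiffOn_symm_of_mem_maximalAtlas (I := mdl X) (n := ∞)
      (StructureGroupoid.subset_maximalAtlas _ (chart_mem_atlas _ _))).contMDiffAt
      (c.open_target.mem_nhds (c.map_source (mem_chart_source _ _)))
  have h3 : ContMDiffAt (mdl P) (mdl X) ∞ (fun q => c.symm ((e i).trans c q)) p :=
    ContMDiffAt.comp p h2 h1
  refine (h3.congr_of_eventuallyEq ?_).contMDiffWithinAt
  filter_upwards [((e i).trans c).open_source.mem_nhds (show p ∈ _ by simp [hp, c])] with q hq
  simp only [OpenPartialHomeomorph.trans_source] at hq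
  exact (c.left_inv hq.2).symm

lemma Mfd.contMDiffOn_ofCharts_symm (i : ι) :
    letI := Mfd.ofCharts e hcov hs
    ContMDiffOn (mdl X) (mdl P) ∞ (e i).symm (e i).target := by
  let _ := Mfd.ofCharts e hcov hs
  intro x hx
  set c := chartAt (Mfd.H X) x
  have hmem : (e i).trans c ∈ atlas (Mfd.H P) P := ⟨i, c, chart_mem_atlas _ _, rfl⟩
  have hx' : c x ∈ ((e i).trans c).target := by
    have : c.symm (c x) = x := c.left_inv (mem_chart_source _ _)
    simp only [OpenPartialHomeomorph.trans_target, Set.mem_inter_iff, Set.mem_preimage, this]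
    exact ⟨c.map_source (mem_chart_source _ _), hx⟩
  have h1 : ContMDiffAt (mdl X) (mdl P) ∞ ((e i).trans c).symm (c x) :=
    (contMDiffOn_symm_of_mem_maximalAtlas (I := mdl P) (n := ∞) (e := (e i).trans c)
      (IsManifold.subset_maximalAtlas hmem)).contMDiffAt
      (((e i).trans c).open_target.mem_nhds hx')
  have h2 : ContMDiffAt (mdl X) (mdl X) ∞ c x :=
    (contMDiffOn_of_mem_maximalAtlas (I := mdl X) (n := ∞)
      (StructureGroupoid.subset_maximalAtlas _ (chart_mem_atlas _ _))).contMDiffAt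
      (c.open_source.mem_nhds (mem_chart_source _ _))
  have h3 : ContMDiffAt (mdl X) (mdl P) ∞ (fun y => ((e i).trans c).symm (c y)) x :=
    ContMDiffAt.comp x h1 h2
  refine (h3.congr_of_eventuallyEq ?_).contMDiffWithinAt
  filter_upwards [c.open_source.mem_nhds (mem_chart_source _ _)] with y hy
  simp [c.left_inv hy]

end

/-- The transport of a manifold structure along a bijection. -/
theorem exists_mfd_transport [Mfd X] (f : P ≃ X) : ∃ (_ : TopologicalSpace P) (_ : Mfd P),
    ContMDiff (mdl P) (mdl X) ∞ f ∧ ContMDiff (mdl X) (mdl P) ∞ f.symm := by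
  let _ : TopologicalSpace P := TopologicalSpace.induced f inferInstance
  let φ : P ≃ₜ X := f.toHomeomorphOfIsInducing ⟨rfl⟩
  have := Mfd.t2 (X := X)
  have := Mfd.secondCountable (X := X)
  have : T2Space P := φ.isEmbedding.t2Space
  have : SecondCountableTopology P := φ.isEmbedding.secondCountableTopology
  have hs : ∀ i j : Unit, ContMDiffOn (mdl X) (mdl X) ∞
      (fun x => φ.toOpenPartialHomeomorph (φ.toOpenPartialHomeomorph.symm x))
      (φ.toOpenPartialHomeomorph.target ∩ φ.toOpenPartialHomeomorph.symm ⁻¹'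
        φ.toOpenPartialHomeomorph.source) := fun _ _ =>
    contMDiffOn_id.congr fun x _ => φ.apply_symm_apply x
  refine ⟨_, Mfd.ofCharts (fun _ : Unit => φ.toOpenPartialHomeomorph)
    (fun _ => ⟨(), Set.mem_univ _⟩) hs, ?_, ?_⟩
  · exact contMDiffOn_univ.1 (Mfd.contMDiffOn_ofCharts (fun _ : Unit => φ.toOpenPartialHomeomorph)
      (fun _ => ⟨(), Set.mem_univ _⟩) hs ())
  · exact contMDiffOn_univ.1 (Mfd.contMDiffOn_ofCharts_symm
      (fun _ : Unit => φ.toOpenPartialHomeomorph) (fun _ => ⟨(), Set.mem_univ _⟩) hs ())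

end Glue

/-! ### Frame systems -/

/-- An abstraction of frame bundles. The elements `p` of `P` are frames at points `π p` of a
manifold `B`: each one gives a bijection `eval p` of the model fibre `V` onto the fibre of
`pr : Z → B` over `π p`. The Lie group `G` acts on `V` by `l` and on frames by reparametrisation,
simply transitively on the frames at each point, and there are smooth local frames whose evaluation
maps have smooth inverses. No topology on `P` is assumed. -/
structure FrameSystem {P Z B G V : Type*} [TopologicalSpace Z] [Mfd Z] [TopologicalSpace B] [Mfd B]
    [TopologicalSpace G] [Mfd G] [Group G] [NormedAddCommGroup V]
    [NormedSpace ℝ V] (pr : Z → B) (π : P → B) (act : P → G → P) (l : G → V → V)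
    (eval : P → V → Z) : Prop where
  contMDiff_pr : ContMDiff (mdl Z) (mdl B) ∞ pr
  proj_eval : ∀ p v, pr (eval p v) = π p
  eval_injective : ∀ p, Function.Injective (eval p)
  eval_surjective : ∀ p z, pr z = π p → ∃ v, eval p v = z
  proj_act : ∀ p a, π (act p a) = π p
  eval_act : ∀ p a v, eval (act p a) v = eval p (l a v)
  ext : ∀ p q, π p = π q → (∀ v, eval p v = eval q v) → p = q
  exists_change : ∀ p q, π p = π q → ∃ a, ∀ v, eval q v = eval p (l a v)
  l_one : ∀ v, l 1 v = v
  l_mul : ∀ a b v, l (a * b) v = l a (l b v)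
  l_injective : ∀ a b, (∀ v, l a v = l b v) → a = b
  contMDiff_l : ContMDiff ((mdl G).prod 𝓘(ℝ, V)) 𝓘(ℝ, V) ∞ (fun x : G × V => l x.1 x.2)
  contMDiffOn_of_l : ∀ (U : Set B) (g : B → G),
    ContMDiffOn ((mdl B).prod 𝓘(ℝ, V)) 𝓘(ℝ, V) ∞ (fun x : B × V => l (g x.1) x.2)
      (U ×ˢ Set.univ) → ContMDiffOn (mdl B) (mdl G) ∞ g U
  exists_local : ∀ b, ∃ U : Set B, IsOpen U ∧ b ∈ U ∧ ∃ (Φ : B × V → Z) (k : Z → V),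
    ContMDiffOn ((mdl B).prod 𝓘(ℝ, V)) (mdl Z) ∞ Φ (U ×ˢ Set.univ) ∧
    ContMDiffOn (mdl Z) 𝓘(ℝ, V) ∞ k (pr ⁻¹' U) ∧
    ∀ m ∈ U, ∃ p, π p = m ∧ ∀ v, eval p v = Φ (m, v) ∧ k (Φ (m, v)) = v

namespace FrameSystem

variable {P Z B G V : Type*} [TopologicalSpace Z] [Mfd Z] [TopologicalSpace B] [Mfd B]
    [TopologicalSpace G] [Mfd G] [Group G] [NormedAddCommGroup V]
    [NormedSpace ℝ V] {pr : Z → B} {π : P → B} {act : P → G → P} {l : G → V → V}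
    {eval : P → V → Z}

/-- A smooth local frame over an open set `U`: a choice of frames at the points of `U` whose
evaluation map is smooth. -/
structure IsLocalFrame (π : P → B) (eval : P → V → Z) (U : Set B) (s : B → P) : Prop where
  isOpen : IsOpen U
  proj : ∀ m ∈ U, π (s m) = m
  contMDiffOn_eval : ContMDiffOn ((mdl B).prod 𝓘(ℝ, V)) (mdl Z) ∞
    (fun x : B × V => eval (s x.1) x.2) (U ×ˢ Set.univ)

section Algebra

variable (S : FrameSystem pr π act l eval)
include S

lemma act_one (p : P) : act p 1 = p :=
  S.ext _ _ (S.proj_act _ _) fun v => by rw [S.eval_act, S.l_one]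

lemma act_mul (p : P) (a b : G) : act p (a * b) = act (act p a) b :=
  S.ext _ _ (by simp only [S.proj_act]) fun v => by simp only [S.eval_act, S.l_mul]

lemma exists_diff (p q : P) : ∃ a, π p = π q → act p a = q := by
  by_cases h : π p = π q
  · obtain ⟨a, ha⟩ := S.exists_change p q h
    exact ⟨a, fun _ => S.ext _ _ ((S.proj_act _ _).trans h) fun v => by rw [S.eval_act, ha]⟩
  · exact ⟨1, fun h' => absurd h' h⟩

/-- The group element that carries a frame `p` to a frame `q` at the same point. -/
noncomputable def diff (p q : P) : G := (S.exists_diff p q).choose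

lemma act_diff {p q : P} (h : π p = π q) : act p (S.diff p q) = q :=
  (S.exists_diff p q).choose_spec h

lemma act_injective (p : P) : Function.Injective (act p) := fun a b h =>
  S.l_injective _ _ fun v => S.eval_injective p (by rw [← S.eval_act, ← S.eval_act, h])

lemma diff_act (p : P) (a : G) : S.diff p (act p a) = a :=
  S.act_injective p (S.act_diff (S.proj_act p a).symm)

lemma diff_act_right {p q : P} (h : π p = π q) (a : G) : S.diff p (act q a) = S.diff p q * a := by
  refine S.act_injective p ?_
  rw [S.act_diff (h.trans (S.proj_act q a).symm), S.act_mul, S.act_diff h]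

lemma diff_eq_inv_mul {p q r : P} (h : π r = π p) (h' : π r = π q) :
    S.diff p q = (S.diff r p)⁻¹ * S.diff r q := by
  have hpr : act p (S.diff r p)⁻¹ = r := by
    calc act p (S.diff r p)⁻¹ = act (act r (S.diff r p)) (S.diff r p)⁻¹ := by rw [S.act_diff h]
      _ = r := by rw [← S.act_mul, mul_inv_cancel, S.act_one]
  refine S.act_injective p ?_
  rw [S.act_diff (h.symm.trans h'), S.act_mul, hpr, S.act_diff h']

lemma eval_diff {p q : P} (h : π p = π q) (v : V) : eval p (l (S.diff p q) v) = eval q v := by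
  rw [← S.eval_act, S.act_diff h]

lemma exists_proj_eq (b : B) : ∃ p, π p = b := by
  obtain ⟨U, -, hb, Φ, k, -, -, h⟩ := S.exists_local b
  obtain ⟨p, hp, -⟩ := h b hb
  exact ⟨p, hp⟩

/-- Near every point there is a smooth local frame whose evaluation map has a smooth inverse. -/
lemma exists_isLocalFrame (b : B) : ∃ (U : Set B) (s : B → P) (k : Z → V), b ∈ U ∧
    IsLocalFrame π eval U s ∧ ContMDiffOn (mdl Z) 𝓘(ℝ, V) ∞ k (pr ⁻¹' U) ∧
    ∀ m ∈ U, ∀ v, k (eval (s m) v) = v := by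
  obtain ⟨U, hU, hb, Φ, k, hΦ, hk, h⟩ := S.exists_local b
  have : ∀ m, ∃ p, m ∈ U → π p = m ∧ ∀ v, eval p v = Φ (m, v) ∧ k (Φ (m, v)) = v := by
    intro m
    by_cases hm : m ∈ U
    · obtain ⟨p, hp⟩ := h m hm
      exact ⟨p, fun _ => hp⟩
    · exact ⟨(S.exists_proj_eq m).choose, fun h => absurd h hm⟩
  choose s hs using this
  refine ⟨U, s, k, hb, ⟨hU, fun m hm => (hs m hm).1, hΦ.congr ?_⟩, hk, fun m hm v => ?_⟩
  · rintro ⟨m, v⟩ ⟨hm, -⟩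
    exact ((hs m hm).2 v).1
  · rw [((hs m hm).2 v).1, ((hs m hm).2 v).2]

end Algebra

section Smooth

variable (S : FrameSystem pr π act l eval)

lemma contMDiffOn_diff [LieGroup (mdl G) ∞ G] {U U' : Set B} {s s' : B → P}
    (h : IsLocalFrame π eval U s) (h' : IsLocalFrame π eval U' s') :
    ContMDiffOn (mdl B) (mdl G) ∞ (fun m => S.diff (s m) (s' m)) (U ∩ U') := by
  refine contMDiffOn_of_locally_contMDiffOn fun b hb => ?_
  obtain ⟨W, r, k, hbW, hr, hk, hkr⟩ := S.exists_isLocalFrame b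
  have main : ∀ {U : Set B} {s : B → P}, IsLocalFrame π eval U s →
      ContMDiffOn (mdl B) (mdl G) ∞ (fun m => S.diff (r m) (s m)) (U ∩ W) := by
    intro U s h
    refine S.contMDiffOn_of_l _ _ ?_
    have h1 : ContMDiffOn ((mdl B).prod 𝓘(ℝ, V)) 𝓘(ℝ, V) ∞
        (fun x : B × V => k (eval (s x.1) x.2)) ((U ∩ W) ×ˢ Set.univ) := by
      refine hk.comp (h.contMDiffOn_eval.mono ?_) ?_
      · exact Set.prod_mono Set.inter_subset_left subset_rfl
      · rintro ⟨m, v⟩ ⟨hm, -⟩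
        simpa only [Set.mem_preimage, S.proj_eval, h.proj m hm.1] using hm.2
    refine h1.congr ?_
    rintro ⟨m, v⟩ ⟨hm, -⟩
    change _ = k (eval (s m) v)
    rw [← S.eval_diff ((hr.proj m hm.2).trans (h.proj m hm.1).symm) v, hkr m hm.2]
  refine ⟨W, hr.isOpen, hbW, ?_⟩
  have h1 := ((main h).mono (s := U ∩ W) (t := U ∩ U' ∩ W) fun x hx => ⟨hx.1.1, hx.2⟩)
  have h2 := ((main h').mono (s := U' ∩ W) (t := U ∩ U' ∩ W) fun x hx => ⟨hx.1.2, hx.2⟩)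
  refine (h1.inv.mul h2).congr fun m hm => ?_
  exact S.diff_eq_inv_mul ((hr.proj m hm.2).trans (h.proj m hm.1.1).symm)
    ((hr.proj m hm.2).trans (h'.proj m hm.1.2).symm)

/-- The bijection `(m, a) ↦ s(m)a` of `U × G` with the frames over `U`, for a local frame `s`. -/
noncomputable def chart {U : Set B} {s : B → P} (h : IsLocalFrame π eval U s) :
    PartialEquiv P (B × G) where
  toFun p := (π p, S.diff (s (π p)) p)
  invFun x := act (s x.1) x.2
  source := π ⁻¹' U
  target := U ×ˢ Set.univ
  map_source' p hp := ⟨hp, Set.mem_univ _⟩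
  map_target' x hx := by
    simpa only [Set.mem_preimage, S.proj_act, h.proj _ hx.1] using hx.1
  left_inv' p hp := S.act_diff (h.proj _ hp)
  right_inv' x hx := by
    have h1 : π (act (s x.1) x.2) = x.1 := by rw [S.proj_act, h.proj _ hx.1]
    refine Prod.ext h1 ?_
    simp only [h1]
    exact S.diff_act _ _

/-- The set of frames carries the natural manifold structure: every smooth local frame gives a
diffeomorphism `(m, a) ↦ s(m)a`. -/
def IsFrameMfd (π : P → B) (act : P → G → P) (eval : P → V → Z) [TopologicalSpace P] [Mfd P] :
    Prop :=
  ∀ (U : Set B) (s : B → P), IsLocalFrame π eval U s → ∃ e : Bundle.Trivialization G π,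
    e.baseSet = U ∧ IsSmoothTriv (mdl G) e ∧
      ∀ m ∈ U, ∀ a, e.toOpenPartialHomeomorph.symm (m, a) = act (s m) a

include S in
theorem exists_isFrameMfd [LieGroup (mdl G) ∞ G] : ∃ (_ : TopologicalSpace P) (_ : Mfd P),
    IsFrameMfd π act eval := by
  let ι := {x : Set B × (B → P) // IsLocalFrame π eval x.1 x.2}
  let e (i : ι) : PartialEquiv P (B × G) := S.chart i.2
  have ht (i : ι) : IsOpen (e i).target := i.2.isOpen.prod isOpen_univ
  have hdom (i j : ι) : (e j).target ∩ (e j).symm ⁻¹' (e i).source =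
      (i.1.1 ∩ j.1.1) ×ˢ Set.univ := by
    ext ⟨m, a⟩
    constructor
    · rintro ⟨⟨hm, -⟩, hm'⟩
      have hm'' : π (act (j.1.2 m) a) ∈ i.1.1 := hm'
      rw [S.proj_act, j.2.proj m hm] at hm''
      exact ⟨⟨hm'', hm⟩, trivial⟩
    · rintro ⟨⟨hm, hm'⟩, -⟩
      refine ⟨⟨hm', trivial⟩, ?_⟩
      change π (act (j.1.2 m) a) ∈ i.1.1
      rwa [S.proj_act, j.2.proj m hm']
  have ho (i j : ι) : IsOpen ((e j).target ∩ (e j).symm ⁻¹' (e i).source) := by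
    rw [hdom]
    exact (i.2.isOpen.inter j.2.isOpen).prod isOpen_univ
  have hs (i j : ι) : ContMDiffOn (mdl (B × G)) (mdl (B × G)) ∞ (fun x => e i ((e j).symm x))
      ((e j).target ∩ (e j).symm ⁻¹' (e i).source) := by
    rw [hdom]
    have h1 : ContMDiffOn ((mdl B).prod (mdl G)) ((mdl B).prod (mdl G)) ∞
        (fun x : B × G => (x.1, S.diff (i.1.2 x.1) (j.1.2 x.1) * x.2))
        ((i.1.1 ∩ j.1.1) ×ˢ Set.univ) := by
      refine contMDiffOn_fst.prodMk (ContMDiffOn.mul ?_ contMDiffOn_snd)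
      exact (S.contMDiffOn_diff i.2 j.2).comp contMDiffOn_fst fun x hx => hx.1
    refine h1.congr ?_
    rintro ⟨m, a⟩ ⟨hm, -⟩
    have h2 : π (act (j.1.2 m) a) = m := by rw [S.proj_act, j.2.proj m hm.2]
    refine Prod.ext h2 ?_
    change S.diff (i.1.2 (π (act (j.1.2 m) a))) (act (j.1.2 m) a) = _
    rw [h2, S.diff_act_right ((i.2.proj m hm.1).trans (j.2.proj m hm.2).symm)]
  let _ : TopologicalSpace P := glueTopology e ht
  let E (i : ι) : OpenPartialHomeomorph P (B × G) :=
    glueChart e ht ho (fun i j => (hs i j).continuousOn) i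
  have hcovB (b : B) : ∃ i : ι, b ∈ i.1.1 := by
    obtain ⟨U, s, k, hb, hs, -⟩ := S.exists_isLocalFrame b
    exact ⟨⟨(U, s), hs⟩, hb⟩
  have hπ : Continuous π := by
    refine continuous_def.2 fun O hO i => ?_
    have : (e i).target ∩ (e i).symm ⁻¹' (π ⁻¹' O) = (i.1.1 ∩ O) ×ˢ Set.univ := by
      ext ⟨m, a⟩
      have key : m ∈ i.1.1 → π (act (i.1.2 m) a) = m := fun hm => by rw [S.proj_act, i.2.proj m hm]
      constructor
      · rintro ⟨⟨hm, -⟩, hm'⟩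
        have hm'' : π (act (i.1.2 m) a) ∈ O := hm'
        rw [key hm] at hm''
        exact ⟨⟨hm, hm''⟩, trivial⟩
      · rintro ⟨⟨hm, hm'⟩, -⟩
        refine ⟨⟨hm, trivial⟩, ?_⟩
        change π (act (i.1.2 m) a) ∈ O
        rwa [key hm]
    rw [this]
    exact (i.2.isOpen.inter hO).prod isOpen_univ
  have hB2 := Mfd.t2 (X := B)
  have hG2 := Mfd.t2 (X := G)
  have hBc := Mfd.secondCountable (X := B)
  have hGc := Mfd.secondCountable (X := G)
  have : T2Space P := by
    refine ⟨fun p q hpq => ?_⟩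
    by_cases h : π p = π q
    · obtain ⟨i, hi⟩ := hcovB (π p)
      have hp : p ∈ (E i).source := hi
      have hq : q ∈ (E i).source := show π q ∈ i.1.1 from h ▸ hi
      obtain ⟨O, O', hO, hO', hpO, hqO', hd⟩ := t2_separation ((E i).injOn.ne hp hq hpq)
      exact ⟨_, _, (E i).isOpen_inter_preimage hO, (E i).isOpen_inter_preimage hO', ⟨hp, hpO⟩,
        ⟨hq, hqO'⟩, (hd.preimage (E i)).mono Set.inter_subset_right Set.inter_subset_right⟩
    · obtain ⟨O, O', hO, hO', hpO, hqO', hd⟩ := t2_separation h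
      exact ⟨_, _, hO.preimage hπ, hO'.preimage hπ, hpO, hqO', hd.preimage π⟩
  have : SecondCountableTopology P := by
    choose i hi using hcovB
    obtain ⟨T, hT, hTU⟩ := TopologicalSpace.countable_cover_nhds
      (fun b => (i b).2.isOpen.mem_nhds (hi b))
    have := hT.to_subtype
    have hsc : ∀ t : T, SecondCountableTopology (E (i t)).source := fun t =>
      (E (i t)).toHomeomorphSourceTarget.isEmbedding.secondCountableTopology
    refine TopologicalSpace.secondCountableTopology_of_countable_cover
      (U := fun t : T => (E (i t)).source) (fun t => (E (i t)).open_source) ?_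
    rw [Set.eq_univ_iff_forall] at hTU ⊢
    intro p
    obtain ⟨b, hb, hb'⟩ := Set.mem_iUnion₂.1 (hTU (π p))
    exact Set.mem_iUnion.2 ⟨⟨b, hb⟩, hb'⟩
  have hcov (p : P) : ∃ i, p ∈ (E i).source := hcovB (π p)
  refine ⟨_, Mfd.ofCharts E hcov hs, fun U s h => ?_⟩
  let i : ι := ⟨(U, s), h⟩
  exact ⟨⟨E i, U, h.isOpen, rfl, rfl, fun _ _ => rfl⟩, rfl,
    ⟨Mfd.contMDiffOn_ofCharts E hcov hs i, Mfd.contMDiffOn_ofCharts_symm E hcov hs i⟩,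
    fun _ _ _ => rfl⟩

end Smooth

end FrameSystem

namespace FrameSystem

variable {P Z B G V : Type*} [TopologicalSpace Z] [Mfd Z] [TopologicalSpace B] [Mfd B]
    [TopologicalSpace G] [Mfd G] [Group G] [NormedAddCommGroup V]
    [NormedSpace ℝ V] {pr : Z → B} {π : P → B} {act : P → G → P} {l : G → V → V}
    {eval : P → V → Z}

section Principal

variable [TopologicalSpace P] (S : FrameSystem pr π act l eval)

include S

lemma triv_act {e : Bundle.Trivialization G π} {s : B → P}
    (he : ∀ m ∈ e.baseSet, ∀ a, e.toOpenPartialHomeomorph.symm (m, a) = act (s m) a) (p : P)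
    (hp : π p ∈ e.baseSet) (a : G) : (e (act p a)).2 = (e p).2 * a := by
  have h1 : p = act (s (π p)) (e p).2 := by
    rw [← he _ hp]
    have h := e.left_inv (e.mem_source.2 hp)
    have h' : (e p).1 = π p := e.coe_fst (e.mem_source.2 hp)
    rw [← h']
    exact h.symm
  have h2 : act p a = e.toOpenPartialHomeomorph.symm (π p, (e p).2 * a) := by
    conv_lhs => rw [h1]
    rw [← S.act_mul, he _ hp]
  rw [h2]
  have h3 : (π p, (e p).2 * a) ∈ e.target := by
    rw [e.target_eq]
    exact ⟨hp, trivial⟩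
  exact congrArg Prod.snd (e.right_inv h3)

variable [Mfd P] (hP : IsFrameMfd π act eval)

/-- Near every point there is a trivialization of the frame bundle given by a local frame. -/
lemma exists_trivialization (hP : IsFrameMfd π act eval) (b : B) :
    ∃ (s : B → P) (e : Bundle.Trivialization G π), b ∈ e.baseSet ∧
    IsLocalFrame π eval e.baseSet s ∧ IsSmoothTriv (mdl G) e ∧
      (∀ m ∈ e.baseSet, ∀ a, e.toOpenPartialHomeomorph.symm (m, a) = act (s m) a) ∧
      ∀ p, π p ∈ e.baseSet → ∀ a, (e (act p a)).2 = (e p).2 * a := by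
  obtain ⟨U, s, k, hb, hs, -⟩ := S.exists_isLocalFrame b
  obtain ⟨e, rfl, hsm, he⟩ := hP U s hs
  exact ⟨s, e, hb, hs, hsm, he, fun p hp a => S.triv_act he p hp a⟩

include hP

lemma contMDiff_proj : ContMDiff (mdl P) (mdl B) ∞ π := by
  intro p
  obtain ⟨s, e, hb, hs, hsm, he, -⟩ := S.exists_trivialization hP (π p)
  have h1 : ContMDiffOn (mdl P) (mdl B) ∞ (fun q => (e q).1) e.source :=
    contMDiff_fst.comp_contMDiffOn hsm.1
  exact (h1.congr fun q hq => (e.coe_fst hq).symm).contMDiffAt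
    (e.open_source.mem_nhds (e.mem_source.2 hb))

lemma contMDiff_eval [LieGroup (mdl G) ∞ G] :
    ContMDiff ((mdl P).prod 𝓘(ℝ, V)) (mdl Z) ∞ (fun x : P × V => eval x.1 x.2) := by
  rintro ⟨p, v⟩
  obtain ⟨s, e, hb, hs, hsm, he, -⟩ := S.exists_trivialization hP (π p)
  have hπ := S.contMDiff_proj hP
  have h1 : ContMDiffOn ((mdl P).prod 𝓘(ℝ, V)) ((mdl B).prod 𝓘(ℝ, V)) ∞
      (fun x : P × V => (π x.1, l (e x.1).2 x.2)) (e.source ×ˢ Set.univ) := by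
    refine (hπ.comp_contMDiffOn contMDiffOn_fst).prodMk ?_
    refine S.contMDiff_l.comp_contMDiffOn (ContMDiffOn.prodMk ?_ contMDiffOn_snd)
    exact contMDiff_snd.comp_contMDiffOn (hsm.1.comp contMDiffOn_fst fun x hx => hx.1)
  have h2 := hs.contMDiffOn_eval.comp h1 fun x hx => ⟨e.mem_source.1 hx.1, trivial⟩
  refine (h2.congr ?_).contMDiffAt ((e.open_source.prod isOpen_univ).mem_nhds
    ⟨e.mem_source.2 hb, trivial⟩)
  rintro ⟨q, w⟩ ⟨hq, -⟩
  have hq' := e.mem_source.1 hq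
  have h3 : act (s (π q)) (e q).2 = q := by
    rw [← he _ hq', ← e.coe_fst hq]
    exact e.left_inv hq
  change eval q w = eval (s (π q)) (l (e q).2 w)
  rw [← S.eval_act, h3]

lemma contMDiff_act [LieGroup (mdl G) ∞ G] :
    ContMDiff ((mdl P).prod (mdl G)) (mdl P) ∞ (fun x : P × G => act x.1 x.2) := by
  rintro ⟨p, a⟩
  obtain ⟨s, e, hb, hs, hsm, he, hact⟩ := S.exists_trivialization hP (π p)
  have hπ := S.contMDiff_proj hP
  have h1 : ContMDiffOn ((mdl P).prod (mdl G)) ((mdl B).prod (mdl G)) ∞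
      (fun x : P × G => (π x.1, (e x.1).2 * x.2)) (e.source ×ˢ Set.univ) := by
    refine (hπ.comp_contMDiffOn contMDiffOn_fst).prodMk (ContMDiffOn.mul ?_ contMDiffOn_snd)
    exact contMDiff_snd.comp_contMDiffOn (hsm.1.comp contMDiffOn_fst fun x hx => hx.1)
  have h2 := hsm.2.comp h1 fun x hx => by
    rw [Set.mem_preimage, e.target_eq]
    exact ⟨e.mem_source.1 hx.1, trivial⟩
  refine (h2.congr ?_).contMDiffAt ((e.open_source.prod isOpen_univ).mem_nhds
    ⟨e.mem_source.2 hb, trivial⟩)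
  rintro ⟨q, b⟩ ⟨hq, -⟩
  have hq' := e.mem_source.1 hq
  have hq'' : π (act q b) ∈ e.baseSet := by rwa [S.proj_act]
  change act q b = e.toOpenPartialHomeomorph.symm (π q, (e q).2 * b)
  rw [← hact q hq' b, ← S.proj_act q b, ← e.coe_fst (e.mem_source.2 hq'')]
  exact (e.left_inv (e.mem_source.2 hq'')).symm

/-- The frames form a principal bundle. -/
theorem isPrincipalBundle [LieGroup (mdl G) ∞ G] : IsPrincipalBundle π act where
  contMDiff_proj := S.contMDiff_proj hP
  contMDiff_act := S.contMDiff_act hP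
  act_one := S.act_one
  act_mul := S.act_mul
  proj_act := S.proj_act
  exists_triv b := by
    obtain ⟨s, e, hb, hs, hsm, he, hact⟩ := S.exists_trivialization hP b
    exact ⟨e, hb, hsm, hact⟩

lemma isLocalFrame_of_contMDiffOn [LieGroup (mdl G) ∞ G] {U : Set B} {s : B → P} (hU : IsOpen U)
    (hs : ∀ m ∈ U, π (s m) = m) (h : ContMDiffOn (mdl B) (mdl P) ∞ s U) :
    IsLocalFrame π eval U s :=
  ⟨hU, hs, (S.contMDiff_eval hP).comp_contMDiffOn
    ((h.comp contMDiffOn_fst fun _ hx => hx.1).prodMk contMDiffOn_snd)⟩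

end Principal

section Associated

variable (S : FrameSystem pr π act l eval)

/-- The bijection `[p, v] ↦ eval p v` of the associated bundle with `Z`. -/
noncomputable def assocEquiv : Assoc act l ≃ Z := by
  refine Equiv.ofBijective (Quot.lift (fun x : P × V => eval x.1 x.2) ?_) ⟨?_, ?_⟩
  · rintro ⟨p, v⟩ ⟨q, w⟩ ⟨a, h, h'⟩
    simp only at h h' ⊢
    rw [h, h', S.eval_act]
  · rintro ⟨p, v⟩ ⟨q, w⟩ (h : eval p v = eval q w)
    have hpq : π p = π q := by rw [← S.proj_eval p v, h, S.proj_eval]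
    refine Quot.sound ⟨S.diff p q, (S.act_diff hpq).symm, ?_⟩
    exact S.eval_injective p (h.trans (S.eval_diff hpq w).symm)
  · intro z
    obtain ⟨p, hp⟩ := S.exists_proj_eq (pr z)
    obtain ⟨v, hv⟩ := S.eval_surjective p z hp.symm
    exact ⟨Assoc.mk act l p v, hv⟩

lemma assocEquiv_symm_eval (p : P) (v : V) : S.assocEquiv.symm (eval p v) = Assoc.mk act l p v :=
  S.assocEquiv.symm_apply_eq.2 rfl

include S in
/-- The inverse of the evaluation map of a smooth local frame is smooth. -/
lemma exists_coordinates [LieGroup (mdl G) ∞ G] {U : Set B} {s : B → P}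
    (hs : IsLocalFrame π eval U s) :
    ∃ k : Z → V, ContMDiffOn (mdl Z) 𝓘(ℝ, V) ∞ k (pr ⁻¹' U) ∧
      (∀ m ∈ U, ∀ v, k (eval (s m) v) = v) ∧ ∀ z, pr z ∈ U → eval (s (pr z)) (k z) = z := by
  let k (z : Z) : V := Function.invFun (eval (s (pr z))) z
  have hk : ∀ z, pr z ∈ U → eval (s (pr z)) (k z) = z := fun z hz =>
    Function.invFun_eq (S.eval_surjective _ _ (hs.proj _ hz).symm)
  refine ⟨k, contMDiffOn_of_locally_contMDiffOn fun z hz => ?_, fun m hm v => ?_, hk⟩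
  · obtain ⟨W, r, j, hb, hr, hj, hjr⟩ := S.exists_isLocalFrame (pr z)
    refine ⟨pr ⁻¹' W, hr.isOpen.preimage S.contMDiff_pr.continuous, hb, ?_⟩
    have h1 : ContMDiffOn (mdl Z) 𝓘(ℝ, V) ∞
        (fun z => l (S.diff (s (pr z)) (r (pr z))) (j z)) (pr ⁻¹' U ∩ pr ⁻¹' W) := by
      refine S.contMDiff_l.comp_contMDiffOn (ContMDiffOn.prodMk ?_
        (hj.mono Set.inter_subset_right))
      exact (S.contMDiffOn_diff hs hr).comp S.contMDiff_pr.contMDiffOn fun x hx => hx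
    refine h1.congr fun y hy => ?_
    have hy1 : π (s (pr y)) = pr y := hs.proj _ hy.1
    have hy2 : π (r (pr y)) = pr y := hr.proj _ hy.2
    refine S.eval_injective (s (pr y)) ?_
    rw [hk y hy.1, S.eval_diff (hy1.trans hy2.symm)]
    obtain ⟨v, hv⟩ := S.eval_surjective (r (pr y)) y hy2.symm
    conv_rhs => rw [← hv]
    rw [S.proj_eval, hy2, hjr _ hy.2, hv]
  · have h2 : pr (eval (s m) v) = m := by rw [S.proj_eval, hs.proj m hm]
    have h3 := hk (eval (s m) v) (by rwa [h2])
    rw [h2] at h3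
    exact S.eval_injective _ h3

/-- If `[p, v] ↦ eval p v` is a diffeomorphism, the associated bundle carries its natural manifold
structure. -/
theorem isAssocManifold [LieGroup (mdl G) ∞ G] [TopologicalSpace P] [Mfd P]
    (hP : IsFrameMfd π act eval)
    [TopologicalSpace (Assoc act l)] [Mfd (Assoc act l)]
    (h : ContMDiff (mdl (Assoc act l)) (mdl Z) ∞ S.assocEquiv)
    (h' : ContMDiff (mdl Z) (mdl (Assoc act l)) ∞ S.assocEquiv.symm)
    (Pr : Assoc act l → B) (hPr : ∀ q, Pr q = pr (S.assocEquiv q)) :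
    IsAssocManifold π act l Pr := by
  obtain rfl : Pr = fun q => pr (S.assocEquiv q) := funext hPr
  refine ⟨fun p v => S.proj_eval p v, fun U s hU hs hsm => ?_⟩
  have hs' := S.isLocalFrame_of_contMDiffOn hP hU hs hsm
  obtain ⟨k, hk, hk1, hk2⟩ := S.exists_coordinates hs'
  have hp : ContMDiff (mdl (Assoc act l)) (mdl B) ∞ (fun q => pr (S.assocEquiv q)) :=
    S.contMDiff_pr.comp h
  have h1 : ContMDiffOn (mdl (Assoc act l)) ((mdl B).prod 𝓘(ℝ, V)) ∞
      (fun q => (pr (S.assocEquiv q), k (S.assocEquiv q))) ((fun q => pr (S.assocEquiv q)) ⁻¹' U) :=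
    hp.contMDiffOn.prodMk (hk.comp h.contMDiffOn fun q hq => hq)
  have h2 : ContMDiffOn ((mdl B).prod 𝓘(ℝ, V)) (mdl (Assoc act l)) ∞
      (fun x : B × V => S.assocEquiv.symm (eval (s x.1) x.2)) (U ×ˢ Set.univ) :=
    h'.comp_contMDiffOn hs'.contMDiffOn_eval
  refine ⟨{ toFun := fun q => (pr (S.assocEquiv q), k (S.assocEquiv q))
            invFun := fun x : B × V => S.assocEquiv.symm (eval (s x.1) x.2)
            source := (fun q => pr (S.assocEquiv q)) ⁻¹' U
            target := U ×ˢ Set.univ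
            map_source' := fun q hq => ⟨hq, trivial⟩
            map_target' := ?_
            left_inv' := ?_
            right_inv' := ?_
            open_source := hU.preimage hp.continuous
            open_target := hU.prod isOpen_univ
            continuousOn_toFun := h1.continuousOn
            continuousOn_invFun := h2.continuousOn
            baseSet := U
            open_baseSet := hU
            source_eq := rfl
            target_eq := rfl
            proj_toFun := fun _ _ => rfl }, rfl, ⟨h1, h2⟩,
            fun m hm v => S.assocEquiv_symm_eval (s m) v⟩
  · rintro ⟨m, v⟩ ⟨hm, -⟩
    simpa only [Set.mem_preimage, Equiv.apply_symm_apply, S.proj_eval, hs m hm] using hm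
  · intro q hq
    exact S.assocEquiv.symm_apply_eq.2 (hk2 _ hq)
  · rintro ⟨m, v⟩ ⟨hm, -⟩
    simp only [Equiv.apply_symm_apply, S.proj_eval, hs m hm, hk1 m hm v]

end Associated

end FrameSystem

/-! ### Smooth maps into spaces of linear maps -/

section Linear

variable {V' H' X : Type*} [NormedAddCommGroup V'] [NormedSpace ℝ V']
    [TopologicalSpace H'] {J : ModelWithCorners ℝ V' H'} [TopologicalSpace X] [ChartedSpace H' X]
    {W : Type*} [NormedAddCommGroup W] [NormedSpace ℝ W] {s : Set X}

/-- A family of linear maps on `R n` is smooth if its values on every vector are smooth. -/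
lemma contMDiffOn_clm_of_apply {n : ℕ} {f : X → (R n →L[ℝ] W)}
    (h : ∀ v, ContMDiffOn J 𝓘(ℝ, W) ∞ (fun x => f x v) s) :
    ContMDiffOn J 𝓘(ℝ, R n →L[ℝ] W) ∞ f s := by
  let φ : (R n →L[ℝ] W) ≃L[ℝ] (Fin n → W) := ContinuousLinearEquiv.piRing (Fin n)
  have h1 : ContMDiffOn J 𝓘(ℝ, Fin n → W) ∞ (fun x => φ (f x)) s :=
    contMDiffOn_pi_space.2 fun i => h (Pi.single i 1)
  have h2 : ContMDiffOn J 𝓘(ℝ, R n →L[ℝ] W) ∞ (fun x => φ.symm (φ (f x))) s :=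
    φ.symm.contDiff.contMDiff.comp_contMDiffOn h1
  exact h2.congr fun x _ => (φ.symm_apply_apply _).symm

lemma contMDiffOn_apply_of_prod {V : Type*} [NormedAddCommGroup V] [NormedSpace ℝ V]
    {Z VZ HZ : Type*} [NormedAddCommGroup VZ] [NormedSpace ℝ VZ] [TopologicalSpace HZ]
    {I : ModelWithCorners ℝ VZ HZ} [TopologicalSpace Z] [ChartedSpace HZ Z]
    {f : X × V → Z} (h : ContMDiffOn (J.prod 𝓘(ℝ, V)) I ∞ f (s ×ˢ Set.univ)) (v : V) :
    ContMDiffOn J I ∞ (fun x => f (x, v)) s :=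
  h.comp (contMDiffOn_id.prodMk contMDiffOn_const) fun _ hx => ⟨hx, trivial⟩

lemma contMDiffOn_gl_of_val {n : ℕ} {f : X → GLin n}
    (h : ContMDiffOn J 𝓘(ℝ, R n →L[ℝ] R n) ∞ (fun x => (f x : R n →L[ℝ] R n)) s) :
    ContMDiffOn J (mdl (GLin n)) ∞ f s := by
  have h1 := (contMDiffOn_isOpenEmbedding_symm (I := 𝓘(ℝ, R n →L[ℝ] R n)) (n := ∞)
    (Units.isOpenEmbedding_val (R := R n →L[ℝ] R n))).comp h fun x _ => Set.mem_range_self (f x)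
  refine h1.congr fun x _ => ?_
  exact (Topology.IsOpenEmbedding.toOpenPartialHomeomorph_left_inv _
    (Units.isOpenEmbedding_val (R := R n →L[ℝ] R n))).symm

end Linear

/-! ### Smooth operations of a vector bundle -/

section Coordinates

variable {Z B F : Type*} [TopologicalSpace Z] [TopologicalSpace B] [TopologicalSpace F] {π : Z → B}
  {e : Bundle.Trivialization F π}

namespace Triv

lemma symm_coord {z : Z} (hz : π z ∈ e.baseSet) :
    e.toOpenPartialHomeomorph.symm (π z, (e z).2) = z := by
  have h := e.left_inv (e.mem_source.2 hz)
  rw [← e.coe_fst (e.mem_source.2 hz)]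
  exact h

lemma proj_symm {b : B} (hb : b ∈ e.baseSet) (x : F) :
    π (e.toOpenPartialHomeomorph.symm (b, x)) = b := e.proj_symm_apply' hb

lemma coord_symm {b : B} (hb : b ∈ e.baseSet) (x : F) :
    (e (e.toOpenPartialHomeomorph.symm (b, x))).2 = x :=
  congrArg Prod.snd (e.apply_symm_apply' hb)

lemma coord_injective {z w : Z} (hz : π z ∈ e.baseSet) (h : π z = π w)
    (h' : (e z).2 = (e w).2) : z = w := by
  rw [← symm_coord hz, ← symm_coord (h ▸ hz : π w ∈ e.baseSet), h, h']

end Triv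

end Coordinates

namespace VBundle

variable {Z B : Type*} [TopologicalSpace Z] [Mfd Z] [TopologicalSpace B] [Mfd B] {π : Z → B}

/-- A smooth fibrewise linear local trivialization. -/
structure IsLinearTriv (A : VBundle π) {r : ℕ} (e : Bundle.Trivialization (R r) π) : Prop where
  smooth : IsSmoothTriv 𝓘(ℝ, R r) e
  map_add : ∀ u v, π u ∈ e.baseSet → π u = π v → (e (A.add u v)).2 = (e u).2 + (e v).2
  map_smul : ∀ c u, π u ∈ e.baseSet → (e (A.smul c u)).2 = c • (e u).2
  map_zero : ∀ x ∈ e.baseSet, (e (A.zero x)).2 = 0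

lemma exists_isLinearTriv (A : VBundle π) (b : B) :
    ∃ (r : ℕ) (e : Bundle.Trivialization (R r) π), b ∈ e.baseSet ∧ A.IsLinearTriv e := by
  obtain ⟨r, e, hb, h1, h2, h3, h4⟩ := A.exists_triv b
  exact ⟨r, e, hb, h1, h2, h3, h4⟩

namespace IsLinearTriv

variable {A : VBundle π} {r : ℕ} {e : Bundle.Trivialization (R r) π}

variable (he : A.IsLinearTriv e)
include he

/-- The linear isomorphism of a fibre with the model space. -/
def fiberEquiv {b : B} (hb : b ∈ e.baseSet) : A.Fiber b ≃ₗ[ℝ] R r where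
  toFun u := (e u.pt).2
  map_add' u v := he.map_add _ _ (u.proj_pt.symm ▸ hb) (u.proj_pt.trans v.proj_pt.symm)
  map_smul' _ u := he.map_smul _ _ (u.proj_pt.symm ▸ hb)
  invFun x := ⟨e.toOpenPartialHomeomorph.symm (b, x), Triv.proj_symm hb x⟩
  left_inv u := Fiber.ext (Triv.coord_injective (e := e) ((Triv.proj_symm hb _).symm ▸ hb)
    ((Triv.proj_symm hb _).trans u.proj_pt.symm) (Triv.coord_symm hb _))
  right_inv x := Triv.coord_symm hb x

lemma finrank_eq {b : B} (hb : b ∈ e.baseSet) : Module.finrank ℝ (A.Fiber b) = r := by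
  rw [(he.fiberEquiv hb).finrank_eq, Module.finrank_fin_fun]

lemma contMDiffOn_coord : ContMDiffOn (mdl Z) 𝓘(ℝ, R r) ∞ (fun z => (e z).2) e.source :=
  contMDiff_snd.comp_contMDiffOn he.smooth.1

end IsLinearTriv

section Smooth

variable {V' H' X : Type*} [NormedAddCommGroup V'] [NormedSpace ℝ V']
    [TopologicalSpace H'] {J : ModelWithCorners ℝ V' H'} [TopologicalSpace X] [ChartedSpace H' X]
    {s : Set X}

/-- A map into a vector bundle is smooth if it covers a smooth map and its coordinates near every
point are smooth. -/
lemma contMDiffOn_of_coord (A : VBundle π) {f : X → Z}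
    (hπ : ContMDiffOn J (mdl B) ∞ (fun x => π (f x)) s)
    (h : ∀ x ∈ s, ∀ (r : ℕ) (e : Bundle.Trivialization (R r) π), A.IsLinearTriv e →
      π (f x) ∈ e.baseSet → ContMDiffWithinAt J 𝓘(ℝ, R r) ∞ (fun y => (e (f y)).2) s x) :
    ContMDiffOn J (mdl Z) ∞ f s := by
  intro x hx
  obtain ⟨r, e, hb, he⟩ := A.exists_isLinearTriv (π (f x))
  have h1 := (hπ x hx).prodMk (h x hx r e he hb)
  have h2 : ContMDiffAt ((mdl B).prod 𝓘(ℝ, R r)) (mdl Z) ∞ e.toOpenPartialHomeomorph.symm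
      (π (f x), (e (f x)).2) := he.smooth.2.contMDiffAt (e.open_target.mem_nhds (by
        rw [e.target_eq]; exact ⟨hb, trivial⟩))
  have h3 := ContMDiffAt.comp_contMDiffWithinAt x h2 h1
  refine h3.congr_of_eventuallyEq ?_ (Triv.symm_coord hb).symm
  filter_upwards [(hπ x hx).continuousWithinAt (e.open_baseSet.mem_nhds hb)] with y hy
  exact (Triv.symm_coord hy).symm

lemma contMDiffWithinAt_coord {A : VBundle π} {f : X → Z} (hf : ContMDiffOn J (mdl Z) ∞ f s)
    {x : X} (hx : x ∈ s) {r : ℕ} {e : Bundle.Trivialization (R r) π} (he : A.IsLinearTriv e)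
    (hb : π (f x) ∈ e.baseSet) : ContMDiffWithinAt J 𝓘(ℝ, R r) ∞ (fun y => (e (f y)).2) s x :=
  (he.contMDiffOn_coord.contMDiffAt (e.open_source.mem_nhds
    (e.mem_source.2 hb))).comp_contMDiffWithinAt x (hf x hx)

lemma eventually_mem_baseSet (A : VBundle π) {f : X → Z} (hf : ContMDiffOn J (mdl Z) ∞ f s)
    {x : X} (hx : x ∈ s) {U : Set B} (hU : IsOpen U) (hb : π (f x) ∈ U) :
    ∀ᶠ y in 𝓝[s] x, π (f y) ∈ U :=
  ((A.contMDiff_proj.comp_contMDiffOn hf) x hx).continuousWithinAt (hU.mem_nhds hb)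

lemma contMDiffOn_add (A : VBundle π) {f g : X → Z} (hf : ContMDiffOn J (mdl Z) ∞ f s)
    (hg : ContMDiffOn J (mdl Z) ∞ g s) (h : ∀ x ∈ s, π (f x) = π (g x)) :
    ContMDiffOn J (mdl Z) ∞ (fun x => A.add (f x) (g x)) s := by
  refine A.contMDiffOn_of_coord ((A.contMDiff_proj.comp_contMDiffOn hf).congr fun x hx =>
    A.proj_add _ _ (h x hx)) fun x hx r e he hb => ?_
  rw [A.proj_add _ _ (h x hx)] at hb
  refine ((contMDiffWithinAt_coord hf hx he hb).add
    (contMDiffWithinAt_coord hg hx he (h x hx ▸ hb))).congr_of_eventuallyEq_of_mem ?_ hx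
  filter_upwards [A.eventually_mem_baseSet hf hx e.open_baseSet hb, self_mem_nhdsWithin] with y hy
    hys
  exact he.map_add _ _ hy (h y hys)

lemma contMDiffOn_smul (A : VBundle π) {c : X → ℝ} {f : X → Z}
    (hc : ContMDiffOn J 𝓘(ℝ) ∞ c s) (hf : ContMDiffOn J (mdl Z) ∞ f s) :
    ContMDiffOn J (mdl Z) ∞ (fun x => A.smul (c x) (f x)) s := by
  refine A.contMDiffOn_of_coord ((A.contMDiff_proj.comp_contMDiffOn hf).congr fun x hx =>
    A.proj_smul _ _) fun x hx r e he hb => ?_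
  rw [A.proj_smul] at hb
  refine ((hc x hx).smul (contMDiffWithinAt_coord hf hx he hb)).congr_of_eventuallyEq_of_mem ?_ hx
  filter_upwards [A.eventually_mem_baseSet hf hx e.open_baseSet hb] with y hy
  exact he.map_smul _ _ hy

lemma contMDiff_zero (A : VBundle π) : ContMDiff (mdl B) (mdl Z) ∞ A.zero := by
  rw [← contMDiffOn_univ]
  refine A.contMDiffOn_of_coord (contMDiffOn_id.congr fun x _ => A.proj_zero x)
    fun x hx r e he hb => ?_
  rw [A.proj_zero] at hb
  refine (contMDiffWithinAt_const (c := (0 : R r))).congr_of_eventuallyEq_of_mem ?_ hx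
  filter_upwards [nhdsWithin_le_nhds (e.open_baseSet.mem_nhds hb)] with y hy
  exact he.map_zero _ hy

/-- Finite sums of smooth maps into the fibres over a smooth map `b` are smooth. -/
lemma contMDiffOn_sum (A : VBundle π) {b : X → B} (hb : ContMDiffOn J (mdl B) ∞ b s) {ι : Type*}
    (t : Finset ι) {f : ι → ∀ x, A.Fiber (b x)}
    (hf : ∀ i, ContMDiffOn J (mdl Z) ∞ (fun x => (f i x).pt) s) :
    ContMDiffOn J (mdl Z) ∞ (fun x => (∑ i ∈ t, f i x).pt) s := by
  classical
  induction t using Finset.induction with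
  | empty =>
    simp only [Finset.sum_empty, Fiber.pt_zero]
    exact A.contMDiff_zero.comp_contMDiffOn hb
  | insert i t hi ih =>
    simp only [Finset.sum_insert hi, Fiber.pt_add]
    exact A.contMDiffOn_add (hf i) ih fun x _ => (f i x).proj_pt.trans (Fiber.proj_pt _).symm

end Smooth

instance (A : VBundle π) (b : B) : FiniteDimensional ℝ (A.Fiber b) := by
  obtain ⟨r, e, hb, he⟩ := A.exists_isLinearTriv b
  exact (he.fiberEquiv hb).symm.finiteDimensional

lemma lincomb_single {n : ℕ} {W : Type*} [AddCommGroup W] [Module ℝ W]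
    (u : Module.Basis (Fin n) ℝ W) (i : Fin n) : lincomb u (Pi.single i 1) = u i := by
  rw [lincomb_eq, Module.Basis.equivFun_symm_apply]
  simp [Pi.single_apply]

lemma basis_ext {n : ℕ} {W : Type*} [AddCommGroup W] [Module ℝ W]
    {u v : Module.Basis (Fin n) ℝ W} (h : ∀ x, lincomb u x = lincomb v x) : u = v :=
  Module.Basis.eq_of_apply_eq fun i => by rw [← lincomb_single, h, lincomb_single]

lemma lincomb_injective {n : ℕ} {W : Type*} [AddCommGroup W] [Module ℝ W]
    (u : Module.Basis (Fin n) ℝ W) : Function.Injective (lincomb u) := by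
  have : lincomb u = u.equivFun.symm := funext (lincomb_eq u)
  rw [this]
  exact u.equivFun.symm.injective

lemma lincomb_surjective {n : ℕ} {W : Type*} [AddCommGroup W] [Module ℝ W]
    (u : Module.Basis (Fin n) ℝ W) : Function.Surjective (lincomb u) := by
  have : lincomb u = u.equivFun.symm := funext (lincomb_eq u)
  rw [this]
  exact u.equivFun.symm.surjective

/-- Any two bases are related by a matrix. -/
lemma exists_lincomb_eq {n : ℕ} {W : Type*} [AddCommGroup W] [Module ℝ W]
    (u v : Module.Basis (Fin n) ℝ W) :
    ∃ a : GLin n, ∀ x, lincomb v x = lincomb u ((a : R n →L[ℝ] R n) x) := by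
  refine ⟨ContinuousLinearEquiv.toUnit
    (v.equivFun.symm.trans u.equivFun).toContinuousLinearEquiv, fun x => ?_⟩
  rw [lincomb_eq, lincomb_eq]
  exact (u.equivFun.symm_apply_apply _).symm

/-- The frame of the fibre over `b` given by a linear trivialization. -/
noncomputable def IsLinearTriv.basis {A : VBundle π} {r : ℕ} {e : Bundle.Trivialization (R r) π}
    (he : A.IsLinearTriv e) {b : B} (hb : b ∈ e.baseSet) : Module.Basis (Fin r) ℝ (A.Fiber b) :=
  Module.Basis.ofEquivFun (he.fiberEquiv hb)

lemma IsLinearTriv.lincomb_basis_pt {A : VBundle π} {r : ℕ} {e : Bundle.Trivialization (R r) π}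
    (he : A.IsLinearTriv e) {b : B} (hb : b ∈ e.baseSet) (x : R r) :
    (lincomb (he.basis hb) x).pt = e.toOpenPartialHomeomorph.symm (b, x) := by
  rw [lincomb_eq, basis, Module.Basis.equivFun_ofEquivFun]
  rfl

/-- The frames of a vector bundle of constant rank form a frame system. -/
theorem frameSystem (A : VBundle π) (n : ℕ) (hA : ∀ b, Module.finrank ℝ (A.Fiber b) = n) :
    FrameSystem π (FrameBundle.proj (A := A) (n := n)) FrameBundle.act glAct FrameBundle.eval where
  contMDiff_pr := A.contMDiff_proj
  proj_eval p v := Fiber.proj_pt _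
  eval_injective p v w h := lincomb_injective p.basis (Fiber.ext h)
  eval_surjective p z h := by
    obtain ⟨v, hv⟩ := lincomb_surjective p.basis ⟨z, h⟩
    exact ⟨v, congrArg Fiber.pt hv⟩
  proj_act _ _ := rfl
  eval_act p a v := p.eval_act a v
  ext := by
    rintro ⟨b, u⟩ ⟨b', u'⟩ h h'
    obtain rfl : b = b' := h
    exact congrArg (Sigma.mk b) (basis_ext fun x => Fiber.ext (h' x))
  exists_change := by
    rintro ⟨b, u⟩ ⟨b', u'⟩ h
    obtain rfl : b = b' := h
    obtain ⟨a, ha⟩ := exists_lincomb_eq u u'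
    exact ⟨a, fun v => congrArg Fiber.pt (ha v)⟩
  l_one v := rfl
  l_mul a b v := rfl
  l_injective a b h := Units.ext (ContinuousLinearMap.ext h)
  contMDiff_l := (Units.contMDiff_val.comp contMDiff_fst).clm_apply contMDiff_snd
  contMDiffOn_of_l U g h := contMDiffOn_gl_of_val
    (contMDiffOn_clm_of_apply fun v => contMDiffOn_apply_of_prod h v)
  exists_local b := by
    obtain ⟨r, e, hb, he⟩ := A.exists_isLinearTriv b
    obtain rfl : r = n := (he.finrank_eq hb).symm.trans (hA b)
    refine ⟨e.baseSet, e.open_baseSet, hb, e.toOpenPartialHomeomorph.symm, fun z => (e z).2, ?_, ?_,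
      fun m hm => ⟨⟨m, he.basis hm⟩, rfl, fun v => ⟨he.lincomb_basis_pt hm v, ?_⟩⟩⟩
    · rw [← e.target_eq]
      exact he.smooth.2
    · rw [← e.source_eq]
      exact he.contMDiffOn_coord
    · exact Triv.coord_symm hm v

end VBundle

/-! ### The algebra of a double vector space -/

namespace IsVBHom

variable {Z B Z' B' : Type*} [TopologicalSpace Z] [Mfd Z] [TopologicalSpace B] [Mfd B]
    [TopologicalSpace Z'] [Mfd Z'] [TopologicalSpace B'] [Mfd B'] {π : Z → B} {π' : Z' → B'}
    {A : VBundle π} {A' : VBundle π'} {f : Z → Z'} {g : B → B'}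

/-- The linear map of fibres induced by a morphism of vector bundles. -/
def fiberMap (h : IsVBHom A A' f g) {b : B} {b' : B'} (hb : g b = b') :
    A.Fiber b →ₗ[ℝ] A'.Fiber b' where
  toFun u := ⟨f u.pt, (h.comm _).trans (by rw [u.proj_pt, hb])⟩
  map_add' u v := VBundle.Fiber.ext (h.map_add _ _ (u.proj_pt.trans v.proj_pt.symm))
  map_smul' c u := VBundle.Fiber.ext (h.map_smul _ _)

end IsVBHom

namespace VBundle

variable {Z B : Type*} [TopologicalSpace Z] [Mfd Z] [TopologicalSpace B] [Mfd B] {π : Z → B}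
  (A : VBundle π)

/-- A point of the total space as a point of the fibre that contains it. -/
def toFiber {b : B} (z : Z) (h : π z = b) : A.Fiber b := ⟨z, h⟩

@[simp] lemma pt_toFiber {b : B} (z : Z) (h : π z = b) : (A.toFiber z h).pt = z := rfl

lemma isLocallyConstant_finrank :
    IsLocallyConstant (fun b => Module.finrank ℝ (A.Fiber b)) := by
  refine (IsLocallyConstant.iff_eventually_eq _).2 fun b => ?_
  obtain ⟨r, e, hb, he⟩ := A.exists_isLinearTriv b
  filter_upwards [e.open_baseSet.mem_nhds hb] with y hy
  rw [he.finrank_eq hy, he.finrank_eq hb]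

end VBundle

namespace DVBundle

variable {E E₁ E₂ M : Type*} [TopologicalSpace E] [Mfd E] [TopologicalSpace E₁] [Mfd E₁]
    [TopologicalSpace E₂] [Mfd E₂] [TopologicalSpace M] [Mfd M] (D : DVBundle E E₁ E₂ M)

lemma δ₁_σ₁ (e : E) : D.δ₁ (D.σ₁ e) = D.δ₂ (D.σ₂ e) := D.hom_σ₁.comm e

variable {m : M}

/-- The projection of the fibre of `E → E₁` over a point to the fibre of `E₂`. -/
def lσ₂ {b : E₁} (hb : D.δ₁ b = m) : D.vI.Fiber b →ₗ[ℝ] D.v₂.Fiber m := D.hom_σ₂.fiberMap hb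

/-- The projection of the fibre of `E → E₂` over a point to the fibre of `E₁`. -/
def lσ₁ {b : E₂} (hb : D.δ₂ b = m) : D.vII.Fiber b →ₗ[ℝ] D.v₁.Fiber m := D.hom_σ₁.fiberMap hb

variable (m) in
/-- The zero section of `E → E₂` on the fibre over `m`. -/
def lzeroII : D.v₂.Fiber m →ₗ[ℝ] D.vI.Fiber (D.v₁.zero m) := D.hom_zeroII.fiberMap rfl

variable (m) in
/-- The zero section of `E → E₁` on the fibre over `m`. -/
def lzeroI : D.v₁.Fiber m →ₗ[ℝ] D.vII.Fiber (D.v₂.zero m) := D.hom_zeroI.fiberMap rfl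

lemma lσ₂_lzeroII (e₂ : D.v₂.Fiber m) : D.lσ₂ (D.v₁.proj_zero m) (D.lzeroII m e₂) = e₂ :=
  VBundle.Fiber.ext (D.vII.proj_zero _)

lemma lσ₁_lzeroI (e₁ : D.v₁.Fiber m) : D.lσ₁ (D.v₂.proj_zero m) (D.lzeroI m e₁) = e₁ :=
  VBundle.Fiber.ext (D.vI.proj_zero _)

lemma core_eq_ker : D.core m = LinearMap.ker (D.lσ₂ (D.v₁.proj_zero m)) := by
  ext u
  rw [LinearMap.mem_ker, VBundle.Fiber.ext_iff]
  rfl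

lemma σ₂_core (k : D.core m) : D.σ₂ k.1.pt = D.v₂.zero m := k.2

variable (m) in
lemma zeroI_zero : D.vI.zero (D.v₁.zero m) = D.vII.zero (D.v₂.zero m) :=
  congrArg VBundle.Fiber.pt (map_zero (D.lzeroI m))

/-- The two additions of `E` agree on the core. -/
lemma add_core (k k' : D.core m) : D.vII.add k.1.pt k'.1.pt = D.vI.add k.1.pt k'.1.pt := by
  let a : D.vII.Fiber (D.v₂.zero m) := D.vII.toFiber k.1.pt k.2
  let a' : D.vII.Fiber (D.v₂.zero m) := D.vII.toFiber k'.1.pt k'.2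
  let O := D.vI.zero (D.v₁.zero m)
  have hO₁ : D.σ₁ O = D.v₁.zero m := D.vI.proj_zero _
  have hO₂ : D.σ₂ O = D.v₂.zero m := by
    change D.σ₂ (D.vI.zero _) = _
    rw [zeroI_zero, D.vII.proj_zero]
  have h1 : D.vI.add k.1.pt O = k.1.pt := congrArg VBundle.Fiber.pt (add_zero k.1)
  have h2 : D.vI.add O k'.1.pt = k'.1.pt := congrArg VBundle.Fiber.pt (zero_add k'.1)
  have h3 : D.vII.add k.1.pt O = k.1.pt := by
    change D.vII.add k.1.pt (D.vI.zero _) = _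
    rw [zeroI_zero]
    exact congrArg VBundle.Fiber.pt (add_zero a)
  have h4 : D.vII.add O k'.1.pt = k'.1.pt := by
    change D.vII.add (D.vI.zero _) k'.1.pt = _
    rw [zeroI_zero]
    exact congrArg VBundle.Fiber.pt (zero_add a')
  have := D.interchange k.1.pt O O k'.1.pt (k.1.proj_pt.trans hO₁.symm)
    (hO₁.trans k'.1.proj_pt.symm) (k.2.trans hO₂.symm) (hO₂.trans k'.2.symm)
  rwa [h1, h2, h3, h4] at this

/-- The two scalar multiplications of `E` agree on the core. Since the additions do,
`c ↦ c k` for the first structure is additive for the second one, and a continuous additive map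
on `ℝ` is linear. -/
lemma smul_core (c : ℝ) (k : D.core m) : D.vII.smul c k.1.pt = D.vI.smul c k.1.pt := by
  obtain ⟨r, e, hb, he⟩ := D.vII.exists_isLinearTriv (D.v₂.zero m)
  have hsmul : ContMDiff 𝓘(ℝ) (mdl E) ∞ (fun c : ℝ => D.vI.smul c k.1.pt) := by
    rw [← contMDiffOn_univ]
    exact D.vI.contMDiffOn_smul contMDiffOn_id contMDiffOn_const
  have hmem (c : ℝ) : D.σ₂ (D.vI.smul c k.1.pt) ∈ e.baseSet := by
    have : D.σ₂ (D.vI.smul c k.1.pt) = D.v₂.zero m := (c • k).2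
    rwa [this]
  let φ : ℝ →+ R r :=
    { toFun := fun c => (e (D.vI.smul c k.1.pt)).2
      map_zero' := by
        have h : D.vI.smul 0 k.1.pt = D.vII.zero (D.v₂.zero m) := by
          rw [← zeroI_zero]
          exact congrArg VBundle.Fiber.pt (zero_smul ℝ k.1)
        rw [h, he.map_zero _ hb]
      map_add' := fun c d => by
        have h : D.vI.smul (c + d) k.1.pt =
            D.vII.add (D.vI.smul c k.1.pt) (D.vI.smul d k.1.pt) := by
          refine Eq.trans ?_ (D.add_core (c • k) (d • k)).symm
          exact congrArg VBundle.Fiber.pt (add_smul c d k.1)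
        rw [h]
        exact he.map_add _ _ (hmem c) ((c • k).2.trans (d • k).2.symm) }
  have hφ : Continuous φ := by
    rw [continuous_iff_continuousAt]
    intro c
    exact ContinuousAt.comp (f := fun c : ℝ => D.vI.smul c k.1.pt) (x := c)
      (he.contMDiffOn_coord.continuousOn.continuousAt (e.open_source.mem_nhds
      (e.mem_source.2 (hmem c)))) hsmul.continuous.continuousAt
  have hone : D.vI.smul 1 k.1.pt = k.1.pt := congrArg VBundle.Fiber.pt (one_smul ℝ k.1)
  have h1 : φ c = c • φ 1 := by
    simpa using map_real_smul φ hφ c 1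
  have hk : D.σ₂ k.1.pt ∈ e.baseSet := by
    rw [σ₂_core]
    exact hb
  refine Triv.coord_injective (e := e) (by rwa [D.vII.proj_smul]) ?_ ?_
  · rw [D.vII.proj_smul, σ₂_core]
    exact (c • k).2.symm
  · rw [he.map_smul _ _ hk]
    change _ = φ c
    rw [h1]
    change _ = c • (e (D.vI.smul 1 k.1.pt)).2
    rw [hone]

/-- Translation of the core to the fibre of `E → E₁` over a point. -/
def coreI {b : E₁} (hb : D.δ₁ b = m) : D.core m →ₗ[ℝ] D.vI.Fiber b where
  toFun k := D.vI.toFiber (D.vII.add (D.vI.zero b) k.1.pt) (by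
    have h := congrArg VBundle.Fiber.pt ((D.lσ₁ (D.v₂.proj_zero m)).map_add
      (D.lzeroI m (D.v₁.toFiber b hb)) (D.vII.toFiber k.1.pt k.2))
    refine h.trans ?_
    rw [lσ₁_lzeroI]
    have h' : D.lσ₁ (D.v₂.proj_zero m) (D.vII.toFiber k.1.pt k.2) = 0 :=
      VBundle.Fiber.ext k.1.proj_pt
    rw [h', add_zero]
    rfl)
  map_add' k k' := by
    have h0 : D.vI.add (D.vI.zero b) (D.vI.zero b) = D.vI.zero b :=
      congrArg VBundle.Fiber.pt (add_zero (0 : D.vI.Fiber b))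
    have hσ : D.σ₂ (D.vI.zero b) = D.v₂.zero m := by rw [D.hom_zeroI.comm, hb]
    have h := D.interchange (D.vI.zero b) (D.vI.zero b) k.1.pt k'.1.pt rfl
      (k.1.proj_pt.trans k'.1.proj_pt.symm) (hσ.trans k.2.symm) (hσ.trans k'.2.symm)
    rw [h0] at h
    exact VBundle.Fiber.ext h
  map_smul' c k := by
    have hσ : D.σ₂ (D.vI.zero b) = D.v₂.zero m := by rw [D.hom_zeroI.comm, hb]
    have h := (D.hom_smulI c).map_add (D.vI.zero b) k.1.pt (hσ.trans k.2.symm)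
    have h0 : D.vI.smul c (D.vI.zero b) = D.vI.zero b :=
      congrArg VBundle.Fiber.pt (smul_zero (A := D.vI.Fiber b) c)
    rw [h0] at h
    exact VBundle.Fiber.ext h.symm

lemma ker_lσ₂_le (e₁ : D.v₁.Fiber m) :
    LinearMap.ker (D.lσ₂ e₁.proj_pt) ≤ LinearMap.range (D.coreI e₁.proj_pt) := by
  intro e he
  have he' : D.σ₂ e.pt = D.v₂.zero m := congrArg VBundle.Fiber.pt (LinearMap.mem_ker.1 he)
  let e' : D.vII.Fiber (D.v₂.zero m) := D.vII.toFiber e.pt he'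
  let k := e' - D.lzeroI m e₁
  have hk : D.lσ₁ (D.v₂.proj_zero m) k = 0 := by
    rw [map_sub, lσ₁_lzeroI, sub_eq_zero]
    exact VBundle.Fiber.ext e.proj_pt
  refine ⟨⟨D.vI.toFiber k.pt (congrArg VBundle.Fiber.pt hk), k.proj_pt⟩, VBundle.Fiber.ext ?_⟩
  have h : D.lzeroI m e₁ + k = e' := add_sub_cancel (D.lzeroI m e₁) e'
  have h' := congrArg VBundle.Fiber.pt h
  exact h'

variable {D} {n₁ n₂ n₀ : ℕ}

lemma HasFiberDim.finrank_vI (hD : D.HasFiberDim n₁ n₂ n₀) (e₁ : D.v₁.Fiber m) :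
    Module.finrank ℝ (D.vI.Fiber e₁.pt) = n₂ + n₀ := by
  have h0 : Module.finrank ℝ (D.vI.Fiber (D.v₁.zero m)) = n₂ + n₀ := by
    rw [← LinearMap.finrank_range_add_finrank_ker (D.lσ₂ (D.v₁.proj_zero m)), ← core_eq_ker,
      (hD m).2.2, LinearMap.range_eq_top.2 fun e => ⟨_, D.lσ₂_lzeroII e⟩, finrank_top, (hD m).2.1]
  -- the rank is locally constant, hence constant along the path `c ↦ c e₁`
  have hc : Continuous (fun c : ℝ => D.v₁.smul c e₁.pt) := by
    rw [← continuousOn_univ]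
    exact (D.v₁.contMDiffOn_smul (J := 𝓘(ℝ)) (s := Set.univ) contMDiffOn_id
      contMDiffOn_const).continuousOn
  have h := (D.vI.isLocallyConstant_finrank.comp_continuous hc).apply_eq_of_preconnectedSpace 1 0
  have h1 : D.v₁.smul 1 e₁.pt = e₁.pt := congrArg VBundle.Fiber.pt (one_smul ℝ e₁)
  have h2 : D.v₁.smul 0 e₁.pt = D.v₁.zero m :=
    congrArg VBundle.Fiber.pt (zero_smul ℝ e₁)
  change Module.finrank ℝ (D.vI.Fiber (D.v₁.smul 1 e₁.pt)) =
    Module.finrank ℝ (D.vI.Fiber (D.v₁.smul 0 e₁.pt)) at h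
  rw [h1, h2] at h
  rw [h, h0]

/-- A double vector bundle of constant ranks projects onto the product of its sides: all fibres of
`E → E₁` have the same dimension, and the kernel of the projection to `E₂` is at most as large as
the core. -/
lemma HasFiberDim.lσ₂_surjective (hD : D.HasFiberDim n₁ n₂ n₀) (e₁ : D.v₁.Fiber m) :
    Function.Surjective (D.lσ₂ e₁.proj_pt) := by
  have h1 := LinearMap.finrank_range_add_finrank_ker (D.lσ₂ e₁.proj_pt)
  rw [hD.finrank_vI] at h1
  have h2 := (Submodule.finrank_mono (D.ker_lσ₂_le e₁)).trans (LinearMap.finrank_range_le _)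
  rw [(hD m).2.2] at h2
  rw [← LinearMap.range_eq_top]
  refine Submodule.eq_top_of_finrank_eq (le_antisymm (Submodule.finrank_le _) ?_)
  rw [(hD m).2.1]
  omega

variable (D)

/-- Translation of the core to the fibre of `E → E₂` over a point. -/
def coreII {b : E₂} (hb : D.δ₂ b = m) : D.core m →ₗ[ℝ] D.vII.Fiber b where
  toFun k := D.vII.toFiber (D.vI.add (D.vII.zero b) k.1.pt) (by
    have h := congrArg VBundle.Fiber.pt ((D.lσ₂ (D.v₁.proj_zero m)).map_add
      (D.lzeroII m (D.v₂.toFiber b hb)) k.1)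
    refine h.trans ?_
    rw [lσ₂_lzeroII]
    have h' : D.lσ₂ (D.v₁.proj_zero m) k.1 = 0 := VBundle.Fiber.ext k.2
    rw [h', add_zero]
    rfl)
  map_add' k k' := by
    have h0 : D.vII.add (D.vII.zero b) (D.vII.zero b) = D.vII.zero b :=
      congrArg VBundle.Fiber.pt (add_zero (0 : D.vII.Fiber b))
    have hσ : D.σ₁ (D.vII.zero b) = D.v₁.zero m := by rw [D.hom_zeroII.comm, hb]
    have h := D.interchange (D.vII.zero b) k.1.pt (D.vII.zero b) k'.1.pt
      (hσ.trans k.1.proj_pt.symm) (hσ.trans k'.1.proj_pt.symm) rfl (k.2.trans k'.2.symm)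
    rw [h0, add_core] at h
    exact VBundle.Fiber.ext h.symm
  map_smul' c k := by
    have hσ : D.σ₁ (D.vII.zero b) = D.v₁.zero m := by rw [D.hom_zeroII.comm, hb]
    have h := (D.hom_smulII c).map_add (D.vII.zero b) k.1.pt (hσ.trans k.1.proj_pt.symm)
    have h0 : D.vII.smul c (D.vII.zero b) = D.vII.zero b :=
      congrArg VBundle.Fiber.pt (smul_zero (A := D.vII.Fiber b) c)
    rw [h0, smul_core] at h
    exact VBundle.Fiber.ext h.symm

lemma coreII_pt (e₂ : D.v₂.Fiber m) (k : D.core m) :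
    (D.coreII e₂.proj_pt k).pt = (D.lzeroII m e₂ + k.1).pt := rfl

lemma lσ₁_coreII (e₂ : D.v₂.Fiber m) (k : D.core m) :
    D.lσ₁ e₂.proj_pt (D.coreII e₂.proj_pt k) = 0 :=
  VBundle.Fiber.ext (D.lzeroII m e₂ + k.1).proj_pt

/-- Sums for the second structure are compatible with the addition of the first one. -/
lemma sum_addI {ι : Type*} (t : Finset ι) {y y' : E₂} (hy : D.δ₂ y = D.δ₂ y')
    (a : ι → D.vII.Fiber y) (a' : ι → D.vII.Fiber y') (b : ι → D.vII.Fiber (D.v₂.add y y'))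
    (hσ : ∀ i, D.σ₁ (a i).pt = D.σ₁ (a' i).pt)
    (hb : ∀ i, (b i).pt = D.vI.add (a i).pt (a' i).pt) :
    (∑ i ∈ t, b i).pt = D.vI.add (∑ i ∈ t, a i).pt (∑ i ∈ t, a' i).pt := by
  classical
  have hσt (t : Finset ι) : D.σ₁ (∑ i ∈ t, a i).pt = D.σ₁ (∑ i ∈ t, a' i).pt := by
    have h : D.lσ₁ hy (∑ i ∈ t, a i) = D.lσ₁ rfl (∑ i ∈ t, a' i) := by
      rw [map_sum, map_sum]
      exact Finset.sum_congr rfl fun i _ => VBundle.Fiber.ext (hσ i)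
    exact congrArg VBundle.Fiber.pt h
  induction t using Finset.induction with
  | empty => exact D.hom_zeroII.map_add y y' hy
  | insert i t hi ih =>
    simp only [Finset.sum_insert hi, VBundle.Fiber.pt_add]
    rw [hb, ih]
    exact D.interchange _ _ _ _ (hσ i) (hσt t) ((a i).proj_pt.trans (VBundle.Fiber.proj_pt _).symm)
      ((a' i).proj_pt.trans (VBundle.Fiber.proj_pt _).symm)

section Construction

variable {n : ℕ} (u : Module.Basis (Fin n) ℝ (D.v₁.Fiber m)) (h : Fin n → D.v₂.Fiber m → E)
  (h₁ : ∀ i y, D.σ₁ (h i y) = (u i).pt) (h₂ : ∀ i y, D.σ₂ (h i y) = y.pt)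
  (hadd : ∀ i y y', h i (y + y') = D.vI.add (h i y) (h i y'))
  (hsmul : ∀ i (c : ℝ) y, h i (c • y) = D.vI.smul c (h i y))

/-- For lifts `h i` of the fibre of `E₂` to the fibres of `E → E₁` over a basis `u`, the linear map
`(∑ xⁱ uᵢ, k) ↦ ∑ xⁱ hᵢ(y) + k` to the fibre of `E → E₂` over `y`. -/
noncomputable def liftII (y : D.v₂.Fiber m) :
    D.v₁.Fiber m × D.core m →ₗ[ℝ] D.vII.Fiber y.pt where
  toFun v := (∑ i, u.equivFun v.1 i • D.vII.toFiber (h i y) (h₂ i y)) + D.coreII y.proj_pt v.2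
  map_add' v w := by
    simp only [Prod.fst_add, Prod.snd_add, map_add, Pi.add_apply, add_smul, Finset.sum_add_distrib]
    abel
  map_smul' c v := by
    simp only [Prod.smul_fst, Prod.smul_snd, map_smul, Pi.smul_apply, smul_eq_mul, mul_smul,
      smul_add, Finset.smul_sum, RingHom.id_apply]

lemma liftII_apply (y : D.v₂.Fiber m) (v : D.v₁.Fiber m × D.core m) :
    D.liftII u h h₂ y v =
      (∑ i, u.equivFun v.1 i • D.vII.toFiber (h i y) (h₂ i y)) + D.coreII y.proj_pt v.2 := rfl

include h₁ in
lemma lσ₁_liftII (y : D.v₂.Fiber m) (v : D.v₁.Fiber m × D.core m) :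
    D.lσ₁ y.proj_pt (D.liftII u h h₂ y v) = v.1 := by
  have hi (i : Fin n) : D.lσ₁ y.proj_pt (D.vII.toFiber (h i y) (h₂ i y)) = u i :=
    VBundle.Fiber.ext (h₁ i y)
  rw [liftII_apply, map_add, lσ₁_coreII, add_zero, map_sum]
  simp only [map_smul, hi]
  exact u.sum_equivFun v.1

/-- The decomposition of a double vector space given by lifts over a basis of the first side. -/
noncomputable def decompositionOfLift : D.Decomposition m where
  Ψ v := (D.liftII u h h₂ v.2.1 (v.1, v.2.2)).pt
  σ₁_Ψ v := congrArg VBundle.Fiber.pt (D.lσ₁_liftII u h h₁ h₂ v.2.1 (v.1, v.2.2))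
  σ₂_Ψ v := VBundle.Fiber.proj_pt _
  addI v₁ v₂ w₂ v₀ w₀ := by
    have hs := D.sum_addI Finset.univ (v₂.proj_pt.trans w₂.proj_pt.symm)
      (fun i => u.equivFun v₁ i • D.vII.toFiber (h i v₂) (h₂ i v₂))
      (fun i => u.equivFun v₁ i • D.vII.toFiber (h i w₂) (h₂ i w₂))
      (fun i => u.equivFun v₁ i • D.vII.toFiber (h i (v₂ + w₂)) (h₂ i (v₂ + w₂)))
      (fun i => by
        simp only [VBundle.Fiber.pt_smul, VBundle.pt_toFiber]
        rw [(D.hom_σ₁).map_smul, (D.hom_σ₁).map_smul, h₁, h₁])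
      (fun i => by
        change D.vII.smul _ (h i (v₂ + w₂)) = _
        rw [hadd]
        exact (D.hom_smulII _).map_add _ _ ((h₁ i v₂).trans (h₁ i w₂).symm))
    have hc : (D.coreII (v₂ + w₂).proj_pt (v₀ + w₀)).pt =
        D.vI.add (D.coreII v₂.proj_pt v₀).pt (D.coreII w₂.proj_pt w₀).pt := by
      rw [coreII_pt, map_add, Submodule.coe_add, add_add_add_comm]
      rfl
    have hσs : D.σ₁ (∑ i, u.equivFun v₁ i • D.vII.toFiber (h i v₂) (h₂ i v₂)).pt =
        D.σ₁ (∑ i, u.equivFun v₁ i • D.vII.toFiber (h i w₂) (h₂ i w₂)).pt := by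
      have e1 := D.lσ₁_liftII u h h₁ h₂ v₂ (v₁, 0)
      have e2 := D.lσ₁_liftII u h h₁ h₂ w₂ (v₁, 0)
      rw [liftII_apply, map_zero, add_zero] at e1 e2
      exact congrArg VBundle.Fiber.pt (e1.trans e2.symm)
    refine (congrArg₂ D.vII.add hs hc).trans ?_
    exact D.interchange _ _ _ _ hσs
      ((congrArg VBundle.Fiber.pt (D.lσ₁_coreII v₂ v₀)).trans
        (congrArg VBundle.Fiber.pt (D.lσ₁_coreII w₂ w₀)).symm)
      ((VBundle.Fiber.proj_pt _).trans (VBundle.Fiber.proj_pt _).symm)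
      ((VBundle.Fiber.proj_pt _).trans (VBundle.Fiber.proj_pt _).symm)
  smulI c v₁ v₂ v₀ := by
    let φ : D.vII.Fiber v₂.pt →ₗ[ℝ] D.vII.Fiber (c • v₂).pt := (D.hom_smulI c).fiberMap rfl
    have hφ : φ (D.liftII u h h₂ v₂ (v₁, v₀)) = D.liftII u h h₂ (c • v₂) (v₁, c • v₀) := by
      rw [liftII_apply, liftII_apply, map_add, map_sum]
      congr 1
      · refine Finset.sum_congr rfl fun i _ => ?_
        rw [map_smul]
        congr 1
        exact VBundle.Fiber.ext (hsmul i c v₂).symm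
      · refine VBundle.Fiber.ext ?_
        rw [coreII_pt, map_smul, Submodule.coe_smul, ← smul_add]
        rfl
    exact (congrArg VBundle.Fiber.pt hφ).symm
  addII v₁ w₁ v₂ v₀ w₀ :=
    congrArg VBundle.Fiber.pt ((D.liftII u h h₂ v₂).map_add (v₁, v₀) (w₁, w₀))
  smulII c v₁ v₂ v₀ := congrArg VBundle.Fiber.pt ((D.liftII u h h₂ v₂).map_smul c (v₁, v₀))
  Ψ_core v₀ := by
    simp only [liftII_apply, map_zero, Pi.zero_apply, zero_smul, Finset.sum_const_zero, zero_add]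
    rw [coreII_pt, map_zero, zero_add]
  injective_Ψ := by
    rintro ⟨v₁, v₂, v₀⟩ ⟨w₁, w₂, w₀⟩ hvw
    have e2 : v₂ = w₂ := VBundle.Fiber.ext ((VBundle.Fiber.proj_pt _).symm.trans
      ((congrArg D.σ₂ hvw).trans (VBundle.Fiber.proj_pt _)))
    subst e2
    have e := VBundle.Fiber.ext hvw
    have e1 := congrArg (D.lσ₁ v₂.proj_pt) e
    rw [D.lσ₁_liftII u h h₁ h₂, D.lσ₁_liftII u h h₁ h₂] at e1
    simp only at e1
    subst e1
    have e0 := add_left_cancel e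
    have e0p := congrArg VBundle.Fiber.pt e0
    have e0' : D.lzeroII m v₂ + v₀.1 = D.lzeroII m v₂ + w₀.1 := VBundle.Fiber.ext e0p
    rw [Subtype.ext (add_left_cancel e0')]
  surjective_Ψ e he := by
    let e₁ : D.v₁.Fiber m := D.v₁.toFiber (D.σ₁ e) he
    let e₂ : D.v₂.Fiber m := D.v₂.toFiber (D.σ₂ e) ((D.δ₁_σ₁ e).symm.trans he)
    let e' : D.vII.Fiber e₂.pt := D.vII.toFiber e rfl
    let d := e' - D.liftII u h h₂ e₂ (e₁, 0)
    have hd : D.lσ₁ e₂.proj_pt d = 0 := by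
      rw [map_sub, D.lσ₁_liftII u h h₁ h₂, sub_eq_zero]
      rfl
    let d' : D.vI.Fiber (D.v₁.zero m) := D.vI.toFiber d.pt (congrArg VBundle.Fiber.pt hd)
    let k := d' - D.lzeroII m e₂
    have hk : D.lσ₂ (D.v₁.proj_zero m) k = 0 := by
      rw [map_sub, lσ₂_lzeroII, sub_eq_zero]
      exact VBundle.Fiber.ext d.proj_pt
    have hkd : D.coreII e₂.proj_pt ⟨k, congrArg VBundle.Fiber.pt hk⟩ = d := by
      refine VBundle.Fiber.ext ?_
      rw [coreII_pt]
      exact congrArg VBundle.Fiber.pt (add_sub_cancel (D.lzeroII m e₂) d')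
    refine ⟨(e₁, e₂, ⟨k, congrArg VBundle.Fiber.pt hk⟩), ?_⟩
    have : D.liftII u h h₂ e₂ (e₁, ⟨k, congrArg VBundle.Fiber.pt hk⟩) = e' := by
      have e3 := D.liftII_apply u h h₂ e₂ (e₁, 0)
      rw [map_zero, add_zero] at e3
      rw [liftII_apply, hkd, ← e3]
      exact add_sub_cancel _ e'
    exact congrArg VBundle.Fiber.pt this

end Construction

end DVBundle

/-! ### Frames of a double vector bundle -/

lemma lincomb_add {n : ℕ} {W : Type*} [AddCommGroup W] [Module ℝ W]
    (u : Module.Basis (Fin n) ℝ W) (x y : R n) : lincomb u (x + y) = lincomb u x + lincomb u y := by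
  simp only [lincomb_eq, map_add]

lemma lincomb_smul {n : ℕ} {W : Type*} [AddCommGroup W] [Module ℝ W]
    (u : Module.Basis (Fin n) ℝ W) (c : ℝ) (x : R n) : lincomb u (c • x) = c • lincomb u x := by
  simp only [lincomb_eq, map_smul]

lemma lincomb_zero {n : ℕ} {W : Type*} [AddCommGroup W] [Module ℝ W]
    (u : Module.Basis (Fin n) ℝ W) : lincomb u 0 = 0 := by
  simp only [lincomb_eq, map_zero]

namespace DVBundle

variable {E E₁ E₂ M : Type*} [TopologicalSpace E] [Mfd E] [TopologicalSpace E₁] [Mfd E₁]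
    [TopologicalSpace E₂] [Mfd E₂] [TopologicalSpace M] [Mfd M] {D : DVBundle E E₁ E₂ M}
    {n₁ n₂ n₀ : ℕ}

namespace FrameBundle

variable (Ω : D.FrameBundle n₁ n₂ n₀)

lemma σ₁_eval (ξ : RR n₁ n₂ n₀) : D.σ₁ (Ω.eval ξ) = Ω.proj₁.eval ξ.1 := Ω.frame.dec.σ₁_Ψ _

lemma σ₂_eval (ξ : RR n₁ n₂ n₀) : D.σ₂ (Ω.eval ξ) = Ω.proj₂.eval ξ.2.1 := Ω.frame.dec.σ₂_Ψ _

lemma eval_addI (x : R n₁) (η η' : R n₂ × R n₀) :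
    Ω.eval (x, η + η') = D.vI.add (Ω.eval (x, η)) (Ω.eval (x, η')) := by
  simp only [eval, Prod.fst_add, Prod.snd_add, lincomb_add, Ω.frame.dec.addI]

lemma eval_smulI (c : ℝ) (x : R n₁) (η : R n₂ × R n₀) :
    Ω.eval (x, c • η) = D.vI.smul c (Ω.eval (x, η)) := by
  simp only [eval, Prod.smul_fst, Prod.smul_snd, lincomb_smul, Ω.frame.dec.smulI]

lemma eval_addII (x x' : R n₁) (y : R n₂) (z z' : R n₀) :
    Ω.eval (x + x', y, z + z') = D.vII.add (Ω.eval (x, y, z)) (Ω.eval (x', y, z')) := by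
  simp only [eval, lincomb_add, Ω.frame.dec.addII]

lemma eval_smulII (c : ℝ) (x : R n₁) (y : R n₂) (z : R n₀) :
    Ω.eval (c • x, y, c • z) = D.vII.smul c (Ω.eval (x, y, z)) := by
  simp only [eval, lincomb_smul, Ω.frame.dec.smulII]

lemma δ₁_σ₁_eval (ξ : RR n₁ n₂ n₀) : D.δ₁ (D.σ₁ (Ω.eval ξ)) = Ω.proj := by
  rw [σ₁_eval]
  exact VBundle.Fiber.proj_pt _

lemma eval_injective : Function.Injective Ω.eval := by
  intro ξ ξ' h
  have h' := Ω.frame.dec.injective_Ψ h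
  simp only [Prod.mk.injEq] at h'
  exact Prod.ext (VBundle.lincomb_injective _ h'.1) (Prod.ext (VBundle.lincomb_injective _ h'.2.1)
    (VBundle.lincomb_injective _ h'.2.2))

lemma eval_surjective (e : E) (h : D.δ₁ (D.σ₁ e) = Ω.proj) : ∃ ξ, Ω.eval ξ = e := by
  obtain ⟨⟨v₁, v₂, v₀⟩, rfl⟩ := Ω.frame.dec.surjective_Ψ e h
  obtain ⟨x, rfl⟩ := VBundle.lincomb_surjective Ω.frame.u v₁
  obtain ⟨y, rfl⟩ := VBundle.lincomb_surjective Ω.frame.v v₂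
  obtain ⟨z, rfl⟩ := VBundle.lincomb_surjective Ω.frame.w v₀
  exact ⟨(x, y, z), rfl⟩

lemma eval_ext (Ω Ω' : D.FrameBundle n₁ n₂ n₀) (hp : Ω.proj = Ω'.proj)
    (h : ∀ ξ, Ω.eval ξ = Ω'.eval ξ) : Ω = Ω' := by
  obtain ⟨m, u, v, w, Ψ⟩ := Ω
  obtain ⟨m', u', v', w', Ψ'⟩ := Ω'
  obtain rfl : m = m' := hp
  have h' : ∀ x y z, Ψ.Ψ (lincomb u x, lincomb v y, lincomb w z) =
      Ψ'.Ψ (lincomb u' x, lincomb v' y, lincomb w' z) := fun x y z => h (x, y, z)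
  obtain rfl : u = u' := VBundle.basis_ext fun x => VBundle.Fiber.ext (by
    have := congrArg D.σ₁ (h' x 0 0)
    rwa [Ψ.σ₁_Ψ, Ψ'.σ₁_Ψ] at this)
  obtain rfl : v = v' := VBundle.basis_ext fun y => VBundle.Fiber.ext (by
    have := congrArg D.σ₂ (h' 0 y 0)
    rwa [Ψ.σ₂_Ψ, Ψ'.σ₂_Ψ] at this)
  obtain rfl : w = w' := VBundle.basis_ext fun z => Subtype.ext (VBundle.Fiber.ext (by
    have := h' 0 0 z
    rwa [lincomb_zero, lincomb_zero, Ψ.Ψ_core, Ψ'.Ψ_core] at this))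
  have hΨ : Ψ.Ψ = Ψ'.Ψ := by
    funext ⟨v₁, v₂, v₀⟩
    obtain ⟨x, rfl⟩ := VBundle.lincomb_surjective u v₁
    obtain ⟨y, rfl⟩ := VBundle.lincomb_surjective v v₂
    obtain ⟨z, rfl⟩ := VBundle.lincomb_surjective w v₀
    exact h' x y z
  obtain rfl : Ψ = Ψ' := by
    cases Ψ
    cases Ψ'
    congr
  rfl

lemma exists_isDVSHom (Ω Ω' : D.FrameBundle n₁ n₂ n₀) (hp : Ω.proj = Ω'.proj) :
    ∃ f : RR n₁ n₂ n₀ → RR n₁ n₂ n₀, IsDVSHom f ∧ ∀ ξ, Ω.eval (f ξ) = Ω'.eval ξ := by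
  choose f hf using fun ξ => Ω.eval_surjective (Ω'.eval ξ) ((δ₁_σ₁_eval Ω' ξ).trans hp.symm)
  have hu : ∃ a : GLin n₁, ∀ x, Ω'.proj₁.eval x = Ω.proj₁.eval ((a : R n₁ →L[ℝ] R n₁) x) := by
    obtain ⟨m, u, v, w, Ψ⟩ := Ω
    obtain ⟨m', u', v', w', Ψ'⟩ := Ω'
    obtain rfl : m = m' := hp
    obtain ⟨a, ha⟩ := VBundle.exists_lincomb_eq u u'
    exact ⟨a, fun x => congrArg VBundle.Fiber.pt (ha x)⟩
  have hv : ∃ a : GLin n₂, ∀ x, Ω'.proj₂.eval x = Ω.proj₂.eval ((a : R n₂ →L[ℝ] R n₂) x) := by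
    obtain ⟨m, u, v, w, Ψ⟩ := Ω
    obtain ⟨m', u', v', w', Ψ'⟩ := Ω'
    obtain rfl : m = m' := hp
    obtain ⟨a, ha⟩ := VBundle.exists_lincomb_eq v v'
    exact ⟨a, fun x => congrArg VBundle.Fiber.pt (ha x)⟩
  obtain ⟨a₁, ha₁⟩ := hu
  obtain ⟨a₂, ha₂⟩ := hv
  have h₁ (ξ) : (f ξ).1 = (a₁ : R n₁ →L[ℝ] R n₁) ξ.1 := by
    have := congrArg D.σ₁ (hf ξ)
    rw [σ₁_eval, σ₁_eval, ha₁] at this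
    exact VBundle.lincomb_injective _ (VBundle.Fiber.ext this)
  have h₂ (ξ) : (f ξ).2.1 = (a₂ : R n₂ →L[ℝ] R n₂) ξ.2.1 := by
    have := congrArg D.σ₂ (hf ξ)
    rw [σ₂_eval, σ₂_eval, ha₂] at this
    exact VBundle.lincomb_injective _ (VBundle.Fiber.ext this)
  refine ⟨f, ⟨⟨(a₁ : R n₁ →L[ℝ] R n₁), h₁⟩, ⟨(a₂ : R n₂ →L[ℝ] R n₂), h₂⟩, fun x => ⟨fun η η' => ?_,
    fun c η => ?_⟩, fun y => ⟨fun η η' => ?_, fun c η => ?_⟩⟩, hf⟩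
  · have hd (η) : f (x, η) = ((a₁ : R n₁ →L[ℝ] R n₁) x, (f (x, η)).2) := Prod.ext (h₁ _) rfl
    have key : f (x, η + η') = ((a₁ : R n₁ →L[ℝ] R n₁) x, (f (x, η)).2 + (f (x, η')).2) := by
      refine Ω.eval_injective ?_
      rw [hf, eval_addI, eval_addI, ← hd, ← hd, hf, hf]
    rw [key]
  · have hd (η) : f (x, η) = ((a₁ : R n₁ →L[ℝ] R n₁) x, (f (x, η)).2) := Prod.ext (h₁ _) rfl
    have key : f (x, c • η) = ((a₁ : R n₁ →L[ℝ] R n₁) x, c • (f (x, η)).2) := by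
      refine Ω.eval_injective ?_
      rw [hf, eval_smulI, eval_smulI, ← hd, hf]
    rw [key]
  · have hd (η : R n₁ × R n₀) : f (η.1, y, η.2) = ((f (η.1, y, η.2)).1,
      (a₂ : R n₂ →L[ℝ] R n₂) y, (f (η.1, y, η.2)).2.2) := Prod.ext rfl (Prod.ext (h₂ _) rfl)
    have key : f (η.1 + η'.1, y, η.2 + η'.2) = ((f (η.1, y, η.2)).1 + (f (η'.1, y, η'.2)).1,
        (a₂ : R n₂ →L[ℝ] R n₂) y, (f (η.1, y, η.2)).2.2 + (f (η'.1, y, η'.2)).2.2) := by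
      refine Ω.eval_injective ?_
      rw [hf, eval_addII, eval_addII, ← hd, ← hd, hf, hf]
    simp only [Prod.fst_add, Prod.snd_add, key, Prod.mk_add_mk]
  · have hd (η : R n₁ × R n₀) : f (η.1, y, η.2) = ((f (η.1, y, η.2)).1,
      (a₂ : R n₂ →L[ℝ] R n₂) y, (f (η.1, y, η.2)).2.2) := Prod.ext rfl (Prod.ext (h₂ _) rfl)
    have key : f (c • η.1, y, c • η.2) = (c • (f (η.1, y, η.2)).1,
        (a₂ : R n₂ →L[ℝ] R n₂) y, c • (f (η.1, y, η.2)).2.2) := by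
      refine Ω.eval_injective ?_
      rw [hf, eval_smulII, eval_smulII, ← hd, hf]
    simp only [Prod.smul_fst, Prod.smul_snd, key, Prod.smul_mk]

/-- Two frames at the same point differ by an automorphism of the trivial double vector space. -/
lemma exists_change (Ω Ω' : D.FrameBundle n₁ n₂ n₀) (hp : Ω.proj = Ω'.proj) :
    ∃ a : AutR n₁ n₂ n₀, ∀ ξ, Ω'.eval ξ = Ω.eval (a.act ξ) := by
  obtain ⟨f, hf, hfe⟩ := exists_isDVSHom Ω Ω' hp
  obtain ⟨g, hg, hge⟩ := exists_isDVSHom Ω' Ω hp.symm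
  obtain ⟨a, rfl⟩ := (isAut_iff f).1 ⟨hf, g, hg,
    fun ξ => Ω'.eval_injective (by rw [hge, hfe]), fun ξ => Ω.eval_injective (by rw [hfe, hge])⟩
  exact ⟨a, fun ξ => (hfe ξ).symm⟩

end FrameBundle

end DVBundle

namespace AutR

variable {n₁ n₂ n₀ : ℕ}

lemma contMDiff_act : ContMDiff ((mdl (AutR n₁ n₂ n₀)).prod 𝓘(ℝ, RR n₁ n₂ n₀))
    𝓘(ℝ, RR n₁ n₂ n₀) ∞ (fun x : AutR n₁ n₂ n₀ × RR n₁ n₂ n₀ => act x.1 x.2) := by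
  have hξ : ContMDiff ((mdl (AutR n₁ n₂ n₀)).prod 𝓘(ℝ, RR n₁ n₂ n₀)) 𝓘(ℝ, RR n₁ n₂ n₀) ∞
    (Prod.snd : AutR n₁ n₂ n₀ × RR n₁ n₂ n₀ → _) := contMDiff_snd
  have ha : ContMDiff ((mdl (AutR n₁ n₂ n₀)).prod 𝓘(ℝ, RR n₁ n₂ n₀)) (mdl (AutR n₁ n₂ n₀)) ∞
    (Prod.fst : AutR n₁ n₂ n₀ × RR n₁ n₂ n₀ → _) := contMDiff_fst
  have h1 : ContMDiff ((mdl (AutR n₁ n₂ n₀)).prod 𝓘(ℝ, RR n₁ n₂ n₀)) 𝓘(ℝ, R n₁) ∞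
    (fun x : AutR n₁ n₂ n₀ × RR n₁ n₂ n₀ => x.2.1) := contDiff_fst.contMDiff.comp hξ
  have h2 : ContMDiff ((mdl (AutR n₁ n₂ n₀)).prod 𝓘(ℝ, RR n₁ n₂ n₀)) 𝓘(ℝ, R n₂) ∞
    (fun x : AutR n₁ n₂ n₀ × RR n₁ n₂ n₀ => x.2.2.1) :=
    (contDiff_fst.comp contDiff_snd).contMDiff.comp hξ
  have h0 : ContMDiff ((mdl (AutR n₁ n₂ n₀)).prod 𝓘(ℝ, RR n₁ n₂ n₀)) 𝓘(ℝ, R n₀) ∞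
    (fun x : AutR n₁ n₂ n₀ × RR n₁ n₂ n₀ => x.2.2.2) :=
    (contDiff_snd.comp contDiff_snd).contMDiff.comp hξ
  exact ((SemiT.contMDiff_a₁.comp ha).clm_apply h1).prodMk_space
    (((SemiT.contMDiff_a₂.comp ha).clm_apply h2).prodMk_space
      (((SemiT.contMDiff_a₀.comp ha).clm_apply h0).add
        (((SemiT.contMDiff_bil.comp ha).clm_apply h1).clm_apply h2)))

lemma contMDiffOn_of_act {V' H' X : Type*} [NormedAddCommGroup V'] [NormedSpace ℝ V']
    [TopologicalSpace H'] {J : ModelWithCorners ℝ V' H'} [TopologicalSpace X] [ChartedSpace H' X]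
    {s : Set X} {g : X → AutR n₁ n₂ n₀}
    (h : ∀ ξ, ContMDiffOn J 𝓘(ℝ, RR n₁ n₂ n₀) ∞ (fun x => act (g x) ξ) s) :
    ContMDiffOn J (mdl (AutR n₁ n₂ n₀)) ∞ g s := by
  have h1 : ContMDiffOn J (mdl (GLin n₁)) ∞ (fun x => (g x).a₁) s :=
    contMDiffOn_gl_of_val (contMDiffOn_clm_of_apply fun x =>
      contDiff_fst.contMDiff.comp_contMDiffOn (h (x, 0, 0)))
  have h2 : ContMDiffOn J (mdl (GLin n₂)) ∞ (fun x => (g x).a₂) s :=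
    contMDiffOn_gl_of_val (contMDiffOn_clm_of_apply fun y =>
      (contDiff_fst.comp contDiff_snd).contMDiff.comp_contMDiffOn (h (0, y, 0)))
  have hz : ∀ ξ, ContMDiffOn J 𝓘(ℝ, R n₀) ∞ (fun x => (act (g x) ξ).2.2) s := fun ξ =>
      (contDiff_snd.comp contDiff_snd).contMDiff.comp_contMDiffOn (h ξ)
  have h0 : ContMDiffOn J (mdl (GLin n₀)) ∞ (fun x => (g x).a₀) s :=
    contMDiffOn_gl_of_val (contMDiffOn_clm_of_apply fun z =>
      (hz (0, 0, z)).congr fun x _ => by simp [act])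
  have hb : ContMDiffOn J 𝓘(ℝ, Bil n₁ n₂ n₀) ∞ (fun x => (g x).bil) s :=
    contMDiffOn_clm_of_apply fun x => contMDiffOn_clm_of_apply fun y =>
      (hz (x, y, 0)).congr fun m _ => by simp [act]
  exact ContMDiffOn.prodMk (h1.prodMk (h2.prodMk h0)) hb

end AutR

/-! ### Smooth local frames of a double vector bundle -/

section Splitting

variable {V' H' X : Type*} [NormedAddCommGroup V'] [NormedSpace ℝ V']
    [TopologicalSpace H'] {J : ModelWithCorners ℝ V' H'} [TopologicalSpace X] [ChartedSpace H' X]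

lemma contMDiffOn_ringInverse {n : ℕ} {U : Set X} {g : X → (R n →L[ℝ] R n)}
    (hg : ContMDiffOn J 𝓘(ℝ, R n →L[ℝ] R n) ∞ g U) (hu : ∀ x ∈ U, IsUnit (g x)) :
    ContMDiffOn J 𝓘(ℝ, R n →L[ℝ] R n) ∞ (fun x => Ring.inverse (g x)) U := by
  intro x hx
  obtain ⟨u, hu'⟩ := hu x hx
  have h1 : ContMDiffAt 𝓘(ℝ, R n →L[ℝ] R n) 𝓘(ℝ, R n →L[ℝ] R n) ∞ Ring.inverse (g x) := by
    rw [← hu']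
    exact (contDiffAt_ringInverse ℝ u).contMDiffAt
  exact h1.comp_contMDiffWithinAt x (hg x hx)

/-- The invertible values of a continuous family of endomorphisms occur on an open set. -/
lemma exists_isOpen_isUnit {n : ℕ} {U : Set X} (hU : IsOpen U) {g : X → (R n →L[ℝ] R n)}
    (hg : ContinuousOn g U) {x₀ : X} (hx₀ : x₀ ∈ U) (h : g x₀ = 1) :
    ∃ U' ⊆ U, IsOpen U' ∧ x₀ ∈ U' ∧ ∀ x ∈ U', IsUnit (g x) :=
  ⟨U ∩ g ⁻¹' {a | IsUnit a}, Set.inter_subset_left, hg.isOpen_inter_preimage hU Units.isOpen,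
    ⟨hx₀, by simp [h]⟩, fun _ hx => hx.2⟩

/-- A smooth family of linear maps that is surjective at a point has, near this point, a smooth
right inverse and a smooth frame of the kernels with a smooth left inverse. -/
lemma exists_smooth_splitting {q k r : ℕ} (hr : r = q + k) {U : Set X} (hU : IsOpen U)
    {A : X → (R r →L[ℝ] R q)} (hA : ContMDiffOn J 𝓘(ℝ, R r →L[ℝ] R q) ∞ A U) {x₀ : X}
    (hx₀ : x₀ ∈ U) (hsurj : Function.Surjective (A x₀)) :
    ∃ U' ⊆ U, IsOpen U' ∧ x₀ ∈ U' ∧ ∃ (S : X → (R q →L[ℝ] R r)) (W : X → (R k →L[ℝ] R r))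
      (L : R r →L[ℝ] R k), ContMDiffOn J 𝓘(ℝ, R q →L[ℝ] R r) ∞ S U' ∧
      ContMDiffOn J 𝓘(ℝ, R k →L[ℝ] R r) ∞ W U' ∧ (∀ x ∈ U', ∀ y, A x (S x y) = y) ∧
      (∀ x ∈ U', ∀ z, A x (W x z) = 0) ∧ ∀ x ∈ U', ∀ z, L (W x z) = z := by
  obtain ⟨S₀, hS₀⟩ := (A x₀ : R r →ₗ[ℝ] R q).exists_rightInverse_of_surjective
    (LinearMap.range_eq_top.2 hsurj)
  have hker : Module.finrank ℝ (LinearMap.ker (A x₀ : R r →ₗ[ℝ] R q)) = k := by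
    have h := LinearMap.finrank_range_add_finrank_ker (A x₀ : R r →ₗ[ℝ] R q)
    rw [LinearMap.range_eq_top.2 hsurj, finrank_top, Module.finrank_fin_fun,
      Module.finrank_fin_fun] at h
    omega
  let b := (Module.finBasisOfFinrankEq ℝ _ hker).equivFun
  let W₀ : R k →ₗ[ℝ] R r := (LinearMap.ker (A x₀ : R r →ₗ[ℝ] R q)).subtype ∘ₗ b.symm.toLinearMap
  have hAW₀ (z) : A x₀ (W₀ z) = 0 := (b.symm z).2
  obtain ⟨L₀, hL₀⟩ := W₀.exists_leftInverse_of_injective (LinearMap.ker_eq_bot.2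
    (Subtype.val_injective.comp b.symm.injective))
  let S₁ : R q →L[ℝ] R r := LinearMap.toContinuousLinearMap S₀
  let W₁ : R k →L[ℝ] R r := LinearMap.toContinuousLinearMap W₀
  let L : R r →L[ℝ] R k := LinearMap.toContinuousLinearMap L₀
  let g (x : X) : R q →L[ℝ] R q := (A x).comp S₁
  have hg : ContMDiffOn J 𝓘(ℝ, R q →L[ℝ] R q) ∞ g U := hA.clm_comp contMDiffOn_const
  have hg₀ : g x₀ = 1 := by
    ext y : 1
    exact LinearMap.congr_fun hS₀ y
  obtain ⟨U₁, hU₁U, hU₁, hx₁, hu₁⟩ := exists_isOpen_isUnit hU hg.continuousOn hx₀ hg₀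
  let S (x : X) : R q →L[ℝ] R r := S₁.comp (Ring.inverse (g x))
  have hS : ContMDiffOn J 𝓘(ℝ, R q →L[ℝ] R r) ∞ S U₁ :=
    contMDiffOn_const.clm_comp (contMDiffOn_ringInverse (hg.mono hU₁U) hu₁)
  have hAS : ∀ x ∈ U₁, ∀ y, A x (S x y) = y := fun x hx y =>
    congrArg (fun a : R q →L[ℝ] R q => a y) (Ring.mul_inverse_cancel (g x) (hu₁ x hx))
  -- `1 - S A` projects onto the kernel of `A`
  let T (x : X) : R k →L[ℝ] R r := W₁ - (S x).comp ((A x).comp W₁)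
  have hT : ContMDiffOn J 𝓘(ℝ, R k →L[ℝ] R r) ∞ T U₁ :=
    contMDiffOn_const.sub (hS.clm_comp ((hA.mono hU₁U).clm_comp contMDiffOn_const))
  have hAT : ∀ x ∈ U₁, ∀ z, A x (T x z) = 0 := fun x hx z => by
    change A x (W₁ z - S x (A x (W₁ z))) = 0
    rw [map_sub, hAS x hx, sub_self]
  let h (x : X) : R k →L[ℝ] R k := L.comp (T x)
  have hh : ContMDiffOn J 𝓘(ℝ, R k →L[ℝ] R k) ∞ h U₁ := contMDiffOn_const.clm_comp hT
  have hh₀ : h x₀ = 1 := by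
    ext z : 1
    change L₀ (W₀ z - S x₀ (A x₀ (W₀ z))) = z
    rw [hAW₀, map_zero, sub_zero]
    exact LinearMap.congr_fun hL₀ z
  obtain ⟨U₂, hU₂U, hU₂, hx₂, hu₂⟩ := exists_isOpen_isUnit hU₁ hh.continuousOn hx₁ hh₀
  refine ⟨U₂, hU₂U.trans hU₁U, hU₂, hx₂, S, fun x => (T x).comp (Ring.inverse (h x)), L,
    hS.mono hU₂U, (hT.mono hU₂U).clm_comp (contMDiffOn_ringInverse (hh.mono hU₂U) hu₂),
    fun x hx => hAS x (hU₂U hx), fun x hx z => hAT x (hU₂U hx) _, fun x hx z => ?_⟩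
  exact congrArg (fun a : R k →L[ℝ] R k => a z) (Ring.mul_inverse_cancel (h x) (hu₂ x hx))

end Splitting

namespace VBundle.IsLinearTriv

variable {Z B : Type*} [TopologicalSpace Z] [Mfd Z] [TopologicalSpace B] [Mfd B] {π : Z → B}
  {A : VBundle π} {r : ℕ} {e : Bundle.Trivialization (R r) π}

lemma symm_add (he : A.IsLinearTriv e) {b : B} (hb : b ∈ e.baseSet) (x y : R r) :
    e.toOpenPartialHomeomorph.symm (b, x + y) =
      A.add (e.toOpenPartialHomeomorph.symm (b, x)) (e.toOpenPartialHomeomorph.symm (b, y)) :=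
  congrArg Fiber.pt ((he.fiberEquiv hb).symm.map_add x y)

lemma symm_smul (he : A.IsLinearTriv e) {b : B} (hb : b ∈ e.baseSet) (c : ℝ) (x : R r) :
    e.toOpenPartialHomeomorph.symm (b, c • x) =
      A.smul c (e.toOpenPartialHomeomorph.symm (b, x)) :=
  congrArg Fiber.pt ((he.fiberEquiv hb).symm.map_smul c x)

variable {V' H' X : Type*} [NormedAddCommGroup V'] [NormedSpace ℝ V']
    [TopologicalSpace H'] {J : ModelWithCorners ℝ V' H'} [TopologicalSpace X] [ChartedSpace H' X]
    {U : Set X}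

lemma contMDiffOn_symm (he : A.IsLinearTriv e) {c : X → B} {v : X → R r}
    (hc : ContMDiffOn J (mdl B) ∞ c U) (hv : ContMDiffOn J 𝓘(ℝ, R r) ∞ v U)
    (hcU : ∀ x ∈ U, c x ∈ e.baseSet) :
    ContMDiffOn J (mdl Z) ∞ (fun x => e.toOpenPartialHomeomorph.symm (c x, v x)) U :=
  he.smooth.2.comp (hc.prodMk hv) fun x hx => by
    rw [Set.mem_preimage, e.target_eq]
    exact ⟨hcU x hx, trivial⟩

lemma contMDiffOn_coord_comp (he : A.IsLinearTriv e) {f : X → Z}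
    (hf : ContMDiffOn J (mdl Z) ∞ f U) (hfU : ∀ x ∈ U, π (f x) ∈ e.baseSet) :
    ContMDiffOn J 𝓘(ℝ, R r) ∞ (fun x => (e (f x)).2) U :=
  he.contMDiffOn_coord.comp hf fun x hx => e.mem_source.2 (hfU x hx)

end VBundle.IsLinearTriv

/-- The matrix of a morphism of vector bundles in local trivializations, along a map to the base. -/
lemma IsVBHom.exists_matrix {Z B Z' B' : Type*} [TopologicalSpace Z] [Mfd Z] [TopologicalSpace B]
    [Mfd B] [TopologicalSpace Z'] [Mfd Z'] [TopologicalSpace B'] [Mfd B'] {π : Z → B}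
    {π' : Z' → B'} {A : VBundle π} {A' : VBundle π'} {f : Z → Z'} {g : B → B'}
    (h : IsVBHom A A' f g) {r q : ℕ} {e : Bundle.Trivialization (R r) π}
    {e' : Bundle.Trivialization (R q) π'} (he : A.IsLinearTriv e) (he' : A'.IsLinearTriv e')
    {V' H' X : Type*} [NormedAddCommGroup V'] [NormedSpace ℝ V']
    [TopologicalSpace H'] {J : ModelWithCorners ℝ V' H'} [TopologicalSpace X] [ChartedSpace H' X]
    {U : Set X} {c : X → B} (hc : ContMDiffOn J (mdl B) ∞ c U) (hcU : ∀ x ∈ U, c x ∈ e.baseSet)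
    (hgU : ∀ x ∈ U, g (c x) ∈ e'.baseSet) :
    ∃ a : X → (R r →L[ℝ] R q), ContMDiffOn J 𝓘(ℝ, R r →L[ℝ] R q) ∞ a U ∧
      ∀ x ∈ U, ∀ v, a x v = (e' (f (e.toOpenPartialHomeomorph.symm (c x, v)))).2 := by
  have : ∀ x, ∃ a : R r →L[ℝ] R q, x ∈ U → ∀ v,
      a v = (e' (f (e.toOpenPartialHomeomorph.symm (c x, v)))).2 := by
    intro x
    by_cases hx : x ∈ U
    · exact ⟨LinearMap.toContinuousLinearMap ((he'.fiberEquiv (hgU x hx)).toLinearMap ∘ₗ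
        h.fiberMap rfl ∘ₗ (he.fiberEquiv (hcU x hx)).symm.toLinearMap), fun _ v => rfl⟩
    · exact ⟨0, fun h => absurd h hx⟩
  choose a ha using this
  refine ⟨a, contMDiffOn_clm_of_apply fun v => ?_, ha⟩
  refine (he'.contMDiffOn_coord_comp (h.contMDiff_total.comp_contMDiffOn
    (he.contMDiffOn_symm hc contMDiffOn_const hcU)) fun x hx => ?_).congr fun x hx => ha x hx v
  change π' (f _) ∈ _
  rw [h.comm, Triv.proj_symm (hcU x hx)]
  exact hgU x hx

namespace DVBundle

variable {E E₁ E₂ M : Type*} [TopologicalSpace E] [Mfd E] [TopologicalSpace E₁] [Mfd E₁]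
    [TopologicalSpace E₂] [Mfd E₂] [TopologicalSpace M] [Mfd M] {D : DVBundle E E₁ E₂ M}
    {n₁ n₂ n₀ : ℕ}

/-- Along a smooth section `c` of `E₁`, there are near every point a smooth fibrewise linear lift
`H` of `E₂` to `E → E₁`, in coordinates of a trivialization `e₂` of `E₂`, a smooth frame `w` of the
kernels of the projection to `E₂`, and smooth coordinates `z` of the kernels with respect to `w`. -/
lemma HasFiberDim.exists_lift (hD : D.HasFiberDim n₁ n₂ n₀)
    {e₂ : Bundle.Trivialization (R n₂) D.δ₂} (he₂ : D.v₂.IsLinearTriv e₂) {c : M → E₁} {U : Set M}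
    (hU : IsOpen U) (hc : ContMDiffOn (mdl M) (mdl E₁) ∞ c U) (hcm : ∀ m ∈ U, D.δ₁ (c m) = m)
    (hU₂ : U ⊆ e₂.baseSet) {m₀ : M} (hm₀ : m₀ ∈ U) :
    ∃ U' ⊆ U, IsOpen U' ∧ m₀ ∈ U' ∧ ∃ (H : M × R n₂ → E) (w : M × R n₀ → E) (z : E → R n₀),
      ContMDiffOn ((mdl M).prod 𝓘(ℝ, R n₂)) (mdl E) ∞ H (U' ×ˢ Set.univ) ∧
      ContMDiffOn ((mdl M).prod 𝓘(ℝ, R n₀)) (mdl E) ∞ w (U' ×ˢ Set.univ) ∧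
      (∀ m ∈ U', ∀ y, D.σ₁ (H (m, y)) = c m ∧
        D.σ₂ (H (m, y)) = e₂.toOpenPartialHomeomorph.symm (m, y)) ∧
      (∀ m ∈ U', ∀ y y', H (m, y + y') = D.vI.add (H (m, y)) (H (m, y'))) ∧
      (∀ m ∈ U', ∀ (a : ℝ) y, H (m, a • y) = D.vI.smul a (H (m, y))) ∧
      (∀ m ∈ U', ∀ x, D.σ₁ (w (m, x)) = c m ∧ D.σ₂ (w (m, x)) = D.v₂.zero m) ∧
      (∀ m ∈ U', ∀ x x', w (m, x + x') = D.vI.add (w (m, x)) (w (m, x'))) ∧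
      (∀ m ∈ U', ∀ (a : ℝ) x, w (m, a • x) = D.vI.smul a (w (m, x))) ∧
      (∀ m ∈ U', ∀ x, z (w (m, x)) = x) ∧
      ∃ O : Set E₁, IsOpen O ∧ (∀ m ∈ U', c m ∈ O) ∧
        ContMDiffOn (mdl E) 𝓘(ℝ, R n₀) ∞ z (D.σ₁ ⁻¹' O) := by
  obtain ⟨r, e, hb, he⟩ := D.vI.exists_isLinearTriv (c m₀)
  let cf : D.v₁.Fiber m₀ := D.v₁.toFiber (c m₀) (hcm m₀ hm₀)
  have hr : r = n₂ + n₀ := (he.finrank_eq hb).symm.trans (hD.finrank_vI cf)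
  let U₁ := U ∩ c ⁻¹' e.baseSet
  have hU₁ : IsOpen U₁ := hc.continuousOn.isOpen_inter_preimage hU e.open_baseSet
  have hc₁ : ContMDiffOn (mdl M) (mdl E₁) ∞ c U₁ := hc.mono Set.inter_subset_left
  obtain ⟨a, hasm, ha⟩ := D.hom_σ₂.exists_matrix he he₂ hc₁ (fun m hm => hm.2)
    (fun m hm => (hcm m hm.1).symm ▸ hU₂ hm.1)
  have hsurj : Function.Surjective (a m₀) := by
    intro y
    obtain ⟨v, hv⟩ := hD.lσ₂_surjective cf ((he₂.fiberEquiv (hU₂ hm₀)).symm y)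
    refine ⟨he.fiberEquiv hb v, ?_⟩
    rw [ha m₀ ⟨hm₀, hb⟩]
    have h1 : e.toOpenPartialHomeomorph.symm (c m₀, he.fiberEquiv hb v) = v.pt :=
      congrArg VBundle.Fiber.pt ((he.fiberEquiv hb).symm_apply_apply v)
    have h2 : D.σ₂ v.pt = ((he₂.fiberEquiv (hU₂ hm₀)).symm y).pt :=
      congrArg VBundle.Fiber.pt hv
    rw [h1, h2]
    exact (he₂.fiberEquiv (hU₂ hm₀)).apply_symm_apply y
  obtain ⟨U', hU'U, hU', hm₀', S, W, L, hS, hW, hAS, hAW, hLW⟩ :=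
    exists_smooth_splitting hr hU₁ hasm ⟨hm₀, hb⟩ hsurj
  have hσ₂ {m : M} (hm : m ∈ U') (v : R r) :
      D.δ₂ (D.σ₂ (e.toOpenPartialHomeomorph.symm (c m, v))) = m := by
    rw [← D.δ₁_σ₁, Triv.proj_symm (hU'U hm).2, hcm m (hU'U hm).1]
  have hsm {k : ℕ} {T : M → (R k →L[ℝ] R r)}
      (hT : ContMDiffOn (mdl M) 𝓘(ℝ, R k →L[ℝ] R r) ∞ T U') :
      ContMDiffOn ((mdl M).prod 𝓘(ℝ, R k)) (mdl E) ∞ (fun x : M × R k =>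
        e.toOpenPartialHomeomorph.symm (c x.1, T x.1 x.2)) (U' ×ˢ Set.univ) :=
    he.contMDiffOn_symm ((hc₁.mono hU'U).comp contMDiffOn_fst fun x hx => hx.1)
      ((hT.comp contMDiffOn_fst fun x hx => hx.1).clm_apply contMDiffOn_snd)
      fun x hx => (hU'U hx.1).2
  refine ⟨U', hU'U.trans Set.inter_subset_left, hU', hm₀',
    fun x => e.toOpenPartialHomeomorph.symm (c x.1, S x.1 x.2),
    fun x => e.toOpenPartialHomeomorph.symm (c x.1, W x.1 x.2), fun z => L (e z).2,
    hsm hS, hsm hW, fun m hm y => ⟨Triv.proj_symm (hU'U hm).2 _, ?_⟩,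
    fun m hm y y' => ?_, fun m hm t y => ?_,
    fun m hm y => ⟨Triv.proj_symm (hU'U hm).2 _, ?_⟩,
    fun m hm y y' => ?_, fun m hm t y => ?_, fun m hm x => ?_, e.baseSet, e.open_baseSet,
    fun m hm => (hU'U hm).2, ?_⟩
  · have hm₂ : m ∈ e₂.baseSet := hU₂ (hU'U hm).1
    refine Triv.coord_injective (e := e₂) (by rwa [hσ₂ hm]) ?_ ?_
    · rw [hσ₂ hm, Triv.proj_symm hm₂]
    · rw [← ha m (hU'U hm), hAS m hm, Triv.coord_symm hm₂]
  · simp only [map_add, he.symm_add (hU'U hm).2]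
  · simp only [map_smul, he.symm_smul (hU'U hm).2]
  · have hm₂ : m ∈ e₂.baseSet := hU₂ (hU'U hm).1
    refine Triv.coord_injective (e := e₂) (by rwa [hσ₂ hm]) ?_ ?_
    · rw [hσ₂ hm, D.v₂.proj_zero]
    · rw [← ha m (hU'U hm), hAW m hm, he₂.map_zero _ hm₂]
  · simp only [map_add, he.symm_add (hU'U hm).2]
  · simp only [map_smul, he.symm_smul (hU'U hm).2]
  · simp only [Triv.coord_symm (hU'U hm).2, hLW m hm]
  · rw [← e.source_eq]
    exact L.contDiff.contMDiff.comp_contMDiffOn he.contMDiffOn_coord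

/-- Near every point, a double vector bundle of constant ranks has smooth frames, with smooth
coordinates: the decompositions are given by smooth lifts of `E₂` along the sections of a local
frame of `E₁`. -/
theorem HasFiberDim.exists_local (hD : D.HasFiberDim n₁ n₂ n₀) (m₀ : M) :
    ∃ U : Set M, IsOpen U ∧ m₀ ∈ U ∧ ∃ (Φ : M × RR n₁ n₂ n₀ → E) (k : E → RR n₁ n₂ n₀),
      ContMDiffOn ((mdl M).prod 𝓘(ℝ, RR n₁ n₂ n₀)) (mdl E) ∞ Φ (U ×ˢ Set.univ) ∧
      ContMDiffOn (mdl E) 𝓘(ℝ, RR n₁ n₂ n₀) ∞ k ((fun e => D.δ₁ (D.σ₁ e)) ⁻¹' U) ∧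
      ∀ m ∈ U, ∃ Ω : D.FrameBundle n₁ n₂ n₀, Ω.proj = m ∧
        ∀ ξ, Ω.eval ξ = Φ (m, ξ) ∧ k (Φ (m, ξ)) = ξ := by
  obtain ⟨r₁, e₁, hb₁, he₁⟩ := D.v₁.exists_isLinearTriv m₀
  obtain rfl : r₁ = n₁ := (he₁.finrank_eq hb₁).symm.trans (hD m₀).1
  obtain ⟨r₂, e₂, hb₂, he₂⟩ := D.v₂.exists_isLinearTriv m₀
  obtain rfl : r₂ = n₂ := (he₂.finrank_eq hb₂).symm.trans (hD m₀).2.1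
  let U₀ := e₁.baseSet ∩ e₂.baseSet
  have hU₀ : IsOpen U₀ := e₁.open_baseSet.inter e₂.open_baseSet
  -- lifts along the sections of the frame of `E₁`
  have lift (i : Fin r₁) := hD.exists_lift he₂ (U := U₀)
    (c := fun m => e₁.toOpenPartialHomeomorph.symm (m, Pi.single i 1)) hU₀
    (he₁.contMDiffOn_symm contMDiffOn_id contMDiffOn_const fun m hm => hm.1)
    (fun m hm => Triv.proj_symm hm.1 _) Set.inter_subset_right ⟨hb₁, hb₂⟩
  choose U₁ hU₁U hU₁ hm₁ H _ _ hH _ hHσ hHadd hHsmul _ using lift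
  -- the frame of the core
  obtain ⟨U₂, hU₂U, hU₂, hm₂, _, w, z, -, hw, -, -, -, hwσ, hwadd, hwsmul, hzw, O, hO, hOm, hz⟩ :=
    hD.exists_lift he₂ (U := U₀) hU₀ D.v₁.contMDiff_zero.contMDiffOn
      (fun m _ => D.v₁.proj_zero m) Set.inter_subset_right ⟨hb₁, hb₂⟩
  let U := U₂ ∩ ⋂ i, U₁ i
  have hU : IsOpen U := hU₂.inter (isOpen_iInter_of_finite hU₁)
  have hUU₂ {m} (hm : m ∈ U) : m ∈ U₂ := hm.1
  have hUU₁ {m} (hm : m ∈ U) (i) : m ∈ U₁ i := Set.mem_iInter.1 hm.2 i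
  have hUe₁ {m} (hm : m ∈ U) : m ∈ e₁.baseSet := (hU₂U hm.1).1
  have hUe₂ {m} (hm : m ∈ U) : m ∈ e₂.baseSet := (hU₂U hm.1).2
  let P := M × RR r₁ r₂ n₀
  let s : Set P := U ×ˢ Set.univ
  -- coordinates on `U × RR`
  have cm : ContMDiffOn ((mdl M).prod 𝓘(ℝ, RR r₁ r₂ n₀)) (mdl M) ∞ (fun p : P => p.1) s :=
    contMDiffOn_fst
  have cξ : ContMDiffOn ((mdl M).prod 𝓘(ℝ, RR r₁ r₂ n₀)) 𝓘(ℝ, RR r₁ r₂ n₀) ∞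
    (fun p : P => p.2) s := contMDiffOn_snd
  have cx (i : Fin r₁) : ContMDiffOn ((mdl M).prod 𝓘(ℝ, RR r₁ r₂ n₀)) 𝓘(ℝ) ∞
      (fun p : P => p.2.1 i) s :=
    contMDiffOn_pi_space.1 (contDiff_fst.contMDiff.comp_contMDiffOn cξ) i
  have cy : ContMDiffOn ((mdl M).prod 𝓘(ℝ, RR r₁ r₂ n₀)) 𝓘(ℝ, R r₂) ∞
      (fun p : P => p.2.2.1) s :=
    (contDiff_fst.comp contDiff_snd).contMDiff.comp_contMDiffOn cξ
  have cz : ContMDiffOn ((mdl M).prod 𝓘(ℝ, RR r₁ r₂ n₀)) 𝓘(ℝ, R n₀) ∞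
      (fun p : P => p.2.2.2) s :=
    (contDiff_snd.comp contDiff_snd).contMDiff.comp_contMDiffOn cξ
  let b₂ (p : P) : E₂ := e₂.toOpenPartialHomeomorph.symm (p.1, p.2.2.1)
  have hb₂ : ContMDiffOn ((mdl M).prod 𝓘(ℝ, RR r₁ r₂ n₀)) (mdl E₂) ∞ b₂ s :=
    he₂.contMDiffOn_symm cm cy fun p hp => hUe₂ hp.1
  have hHσ₂ (p : P) (hp : p ∈ s) (i) : D.σ₂ (H i (p.1, p.2.2.1)) = b₂ p :=
    (hHσ i p.1 (hUU₁ hp.1 i) _).2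
  -- the lifts as points of the fibres of `E → E₂`
  have hT : ∀ (i : Fin r₁) (p : P), ∃ t : D.vII.Fiber (b₂ p),
      p ∈ s → t.pt = H i (p.1, p.2.2.1) := by
    intro i p
    by_cases hp : p ∈ s
    · exact ⟨⟨_, hHσ₂ p hp i⟩, fun _ => rfl⟩
    · exact ⟨0, fun h => absurd h hp⟩
  choose T hT using hT
  have hHs (i) : ContMDiffOn ((mdl M).prod 𝓘(ℝ, RR r₁ r₂ n₀)) (mdl E) ∞ (fun p => (T i p).pt) s :=
    ((hH i).comp (cm.prodMk cy) fun p hp => ⟨hUU₁ hp.1 i, trivial⟩).congr fun p hp => hT i p hp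
  let c₀ (p : P) : E := D.vI.add (D.vII.zero (b₂ p)) (w (p.1, p.2.2.2))
  have hσ₁0 (p : P) (hp : p ∈ s) : D.σ₁ (D.vII.zero (b₂ p)) = D.v₁.zero p.1 := by
    rw [D.hom_zeroII.comm, Triv.proj_symm (hUe₂ hp.1)]
  have hc₀ : ContMDiffOn ((mdl M).prod 𝓘(ℝ, RR r₁ r₂ n₀)) (mdl E) ∞ c₀ s := by
    refine D.vI.contMDiffOn_add (D.vII.contMDiff_zero.comp_contMDiffOn hb₂)
      (hw.comp (cm.prodMk cz) fun p hp => ⟨hUU₂ hp.1, trivial⟩) fun p hp => ?_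
    rw [hσ₁0 p hp, (hwσ p.1 (hUU₂ hp.1) _).1]
  let Φ (p : P) : E := D.vII.add (∑ i, p.2.1 i • T i p).pt (c₀ p)
  -- the frame over a point of `U`
  have frame : ∀ m ∈ U, ∃ Ω : D.FrameBundle r₁ r₂ n₀, Ω.proj = m ∧ (∀ ξ, Ω.eval ξ = Φ (m, ξ)) ∧
      (∀ x, Ω.proj₁.eval x = e₁.toOpenPartialHomeomorph.symm (m, x)) ∧
      (∀ y, Ω.proj₂.eval y = e₂.toOpenPartialHomeomorph.symm (m, y)) := by
    intro m hm
    let u := he₁.basis (hUe₁ hm)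
    let v := he₂.basis (hUe₂ hm)
    let wl : R n₀ →ₗ[ℝ] D.core m :=
      { toFun := fun x => ⟨⟨w (m, x), (hwσ m (hUU₂ hm) x).1⟩, (hwσ m (hUU₂ hm) x).2⟩
        map_add' := fun x x' => Subtype.ext (VBundle.Fiber.ext (hwadd m (hUU₂ hm) x x'))
        map_smul' := fun c x => Subtype.ext (VBundle.Fiber.ext (hwsmul m (hUU₂ hm) c x)) }
    have hwl : Function.Injective wl := fun x x' h => by
      have h1 : w (m, x) = w (m, x') := congrArg (fun k : D.core m => k.1.pt) h
      rw [← hzw m (hUU₂ hm) x, h1, hzw m (hUU₂ hm)]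
    let wb : Module.Basis (Fin n₀) ℝ (D.core m) := Module.Basis.ofEquivFun
      (LinearEquiv.ofInjectiveOfFinrankEq wl hwl
        ((Module.finrank_fin_fun ℝ).trans (hD m).2.2.symm)).symm
    have hwb (x : R n₀) : (lincomb wb x).1.pt = w (m, x) := by
      rw [lincomb_eq, Module.Basis.equivFun_ofEquivFun]
      rfl
    have hu (i) : (u i).pt = e₁.toOpenPartialHomeomorph.symm (m, Pi.single i 1) := by
      rw [← VBundle.lincomb_single]
      exact he₁.lincomb_basis_pt _ _
    have hv (y : D.v₂.Fiber m) : e₂.toOpenPartialHomeomorph.symm (m, (e₂ y.pt).2) = y.pt :=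
      congrArg VBundle.Fiber.pt ((he₂.fiberEquiv (hUe₂ hm)).symm_apply_apply y)
    let h (i : Fin r₁) (y : D.v₂.Fiber m) : E := H i (m, he₂.fiberEquiv (hUe₂ hm) y)
    have h₁ (i y) : D.σ₁ (h i y) = (u i).pt := (hHσ i m (hUU₁ hm i) _).1.trans (hu i).symm
    have h₂ (i y) : D.σ₂ (h i y) = y.pt := (hHσ i m (hUU₁ hm i) _).2.trans (hv y)
    let Ψ := D.decompositionOfLift u h h₁ h₂
      (fun i y y' => by simp only [h, map_add, hHadd i m (hUU₁ hm i)])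
      (fun i c y => by simp only [h, map_smul, hHsmul i m (hUU₁ hm i)])
    refine ⟨⟨m, u, v, wb, Ψ⟩, rfl, ?_, fun x => he₁.lincomb_basis_pt _ _,
      fun y => he₂.lincomb_basis_pt _ _⟩
    rintro ⟨x, y, t⟩
    have hvy : (lincomb v y).pt = b₂ (m, x, y, t) := he₂.lincomb_basis_pt _ _
    have hvy' : he₂.fiberEquiv (hUe₂ hm) (lincomb v y) = y := by
      rw [lincomb_eq]
      simp only [v, VBundle.IsLinearTriv.basis, Module.Basis.equivFun_ofEquivFun]
      exact (he₂.fiberEquiv (hUe₂ hm)).apply_symm_apply y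
    change D.vII.add (∑ i, u.equivFun (lincomb u x) i •
        D.vII.toFiber (h i (lincomb v y)) (h₂ i (lincomb v y))).pt
      (D.vI.add (D.vII.zero (lincomb v y).pt) (lincomb wb t).1.pt) = _
    have hsum : ∀ (b : E₂) (hb : (lincomb v y).pt = b) (τ : Fin r₁ → D.vII.Fiber b),
        (∀ i, (τ i).pt = h i (lincomb v y)) →
        (∑ i, u.equivFun (lincomb u x) i •
          D.vII.toFiber (h i (lincomb v y)) (h₂ i (lincomb v y))).pt = (∑ i, x i • τ i).pt := by
      rintro _ rfl τ hτ
      congr 1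
      refine Finset.sum_congr rfl fun i _ => ?_
      have hux : u.equivFun (lincomb u x) = x := by rw [lincomb_eq, LinearEquiv.apply_symm_apply]
      rw [hux]
      congr 1
      exact VBundle.Fiber.ext (hτ i).symm
    rw [hsum _ hvy (fun i => T i (m, x, y, t)) fun i => by
      rw [hT i _ ⟨hm, trivial⟩]
      change H i (m, y) = H i (m, _)
      rw [hvy'], hvy, hwb]
  -- the coordinates: `z` is recovered by subtracting the part with `z = 0`
  let p₀ (e : E) : P := (D.δ₁ (D.σ₁ e), (e₁ (D.σ₁ e)).2, (e₂ (D.σ₂ e)).2, 0)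
  let d (e : E) : E := D.vII.add e (D.vII.smul (-1) (Φ (p₀ e)))
  let d' (e : E) : E := D.vI.add (d e) (D.vI.smul (-1) (D.vII.zero (D.σ₂ e)))
  let k (e : E) : RR r₁ r₂ n₀ := ((e₁ (D.σ₁ e)).2, (e₂ (D.σ₂ e)).2, z (d' e))
  have hΦ : ContMDiffOn ((mdl M).prod 𝓘(ℝ, RR r₁ r₂ n₀)) (mdl E) ∞ Φ s := by
    have h1 (i) : ContMDiffOn ((mdl M).prod 𝓘(ℝ, RR r₁ r₂ n₀)) (mdl E) ∞
        (fun p : P => (p.2.1 i • T i p).pt) s := D.vII.contMDiffOn_smul (cx i) (hHs i)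
    refine D.vII.contMDiffOn_add (D.vII.contMDiffOn_sum hb₂ Finset.univ h1) hc₀ fun p hp => ?_
    refine (VBundle.Fiber.proj_pt _).trans ?_
    have hpδ : D.δ₂ (b₂ p) = p.1 := Triv.proj_symm (hUe₂ hp.1) _
    rw [D.hom_σ₂.map_add _ _ ((hσ₁0 p hp).trans (hwσ p.1 (hUU₂ hp.1) _).1.symm),
      D.vII.proj_zero, (hwσ p.1 (hUU₂ hp.1) _).2]
    exact congrArg VBundle.Fiber.pt (add_zero (D.v₂.toFiber (b₂ p) hpδ)).symm
  let Q : Set E := (fun e => D.δ₁ (D.σ₁ e)) ⁻¹' U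
  have hkey : ∀ m ∈ U, ∀ ξ, k (Φ (m, ξ)) = ξ ∧ D.σ₂ (Φ (p₀ (Φ (m, ξ)))) = D.σ₂ (Φ (m, ξ)) ∧
      D.σ₁ (d (Φ (m, ξ))) = D.v₁.zero m ∧ d' (Φ (m, ξ)) = w (m, ξ.2.2) := by
    rintro m hm ⟨x, y, t⟩
    obtain ⟨Ω, hΩ, hev, hev₁, hev₂⟩ := frame m hm
    have hx : (e₁ (D.σ₁ (Φ (m, x, y, t)))).2 = x := by
      rw [← hev, Ω.σ₁_eval, hev₁, Triv.coord_symm (hUe₁ hm)]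
    have hy : (e₂ (D.σ₂ (Φ (m, x, y, t)))).2 = y := by
      rw [← hev, Ω.σ₂_eval, hev₂, Triv.coord_symm (hUe₂ hm)]
    have hp : p₀ (Φ (m, x, y, t)) = (m, x, y, 0) := by
      simp only [p₀, hx, hy]
      rw [← hev, Ω.δ₁_σ₁_eval, hΩ]
    have hd : d (Φ (m, x, y, t)) = Ω.eval (0, y, t) := by
      simp only [d, hp]
      rw [← hev, ← hev, ← Ω.eval_smulII, ← Ω.eval_addII]
      simp
    have hσd : D.σ₁ (d (Φ (m, x, y, t))) = D.v₁.zero m := by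
      rw [hd, Ω.σ₁_eval, hev₁]
      exact Triv.coord_injective (e := e₁)
        (by rw [Triv.proj_symm (hUe₁ hm)]; exact hUe₁ hm)
        (by rw [Triv.proj_symm (hUe₁ hm), D.v₁.proj_zero])
        (by rw [Triv.coord_symm (hUe₁ hm), he₁.map_zero _ (hUe₁ hm)])
    have hz0 : D.vII.zero (D.σ₂ (Φ (m, x, y, t))) = Ω.eval (0, y, 0) := by
      have h1 := Ω.eval_smulII 0 0 y 0
      rw [zero_smul, zero_smul] at h1
      have h2 : D.σ₂ (Φ (m, x, y, t)) = D.σ₂ (Ω.eval (0, y, 0)) := by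
        rw [← hev, Ω.σ₂_eval, Ω.σ₂_eval]
      rw [h1, h2]
      exact congrArg VBundle.Fiber.pt
        (zero_smul ℝ (D.vII.toFiber (Ω.eval (0, y, 0)) rfl)).symm
    have hd' : d' (Φ (m, x, y, t)) = w (m, t) := by
      simp only [d', hd, hz0]
      rw [← Ω.eval_smulI, ← Ω.eval_addI]
      have h3 : ((y, t) + (-1 : ℝ) • (y, (0 : R n₀))) = (0, t) := by simp
      rw [h3]
      have h4 : ∀ t, Ω.eval (0, 0, t) = (lincomb Ω.frame.w t).1.pt := fun t => by
        simp only [FrameBundle.eval, lincomb_zero, Ω.frame.dec.Ψ_core]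
      rw [hev]
      change D.vII.add (∑ i, (0 : R r₁) i • T i (m, 0, 0, t)).pt (D.vI.add
        (D.vII.zero (b₂ (m, 0, 0, t))) (w (m, t))) = w (m, t)
      have h5 : b₂ (m, 0, 0, t) = D.v₂.zero m :=
        Triv.coord_injective (e := e₂)
          (by rw [Triv.proj_symm (hUe₂ hm)]; exact hUe₂ hm)
          (by rw [Triv.proj_symm (hUe₂ hm), D.v₂.proj_zero])
          (by rw [Triv.coord_symm (hUe₂ hm), he₂.map_zero _ (hUe₂ hm)])
      simp only [Pi.zero_apply, zero_smul, Finset.sum_const_zero, VBundle.Fiber.pt_zero]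
      have h6 : D.vI.add (D.vII.zero (b₂ (m, 0, 0, t))) (w (m, t)) = w (m, t) := by
        rw [h5, ← D.zeroI_zero]
        exact congrArg VBundle.Fiber.pt
          (zero_add (D.vI.toFiber (w (m, t)) (hwσ m (hUU₂ hm) t).1))
      rw [h6, h5]
      exact congrArg VBundle.Fiber.pt
        (zero_add (D.vII.toFiber (w (m, t)) (hwσ m (hUU₂ hm) t).2))
    refine ⟨?_, ?_, hσd, hd'⟩
    · simp only [k, hx, hy, hd', hzw m (hUU₂ hm)]
    · rw [hp, ← hev, ← hev, Ω.σ₂_eval, Ω.σ₂_eval]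
  have hsurj : ∀ e ∈ Q, ∃ ξ, Φ (D.δ₁ (D.σ₁ e), ξ) = e := fun e he => by
    obtain ⟨Ω, hΩ, hev, -⟩ := frame _ he
    obtain ⟨ξ, hξ⟩ := Ω.eval_surjective e hΩ.symm
    exact ⟨ξ, (hev ξ).symm.trans hξ⟩
  refine ⟨U, hU, ⟨hm₂, Set.mem_iInter.2 hm₁⟩, Φ, k, hΦ, ?_, fun m hm => ?_⟩
  · have s₁ : ContMDiffOn (mdl E) (mdl E₁) ∞ D.σ₁ Q := D.vI.contMDiff_proj.contMDiffOn
    have s₂ : ContMDiffOn (mdl E) (mdl E₂) ∞ D.σ₂ Q := D.vII.contMDiff_proj.contMDiffOn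
    have x₁ := he₁.contMDiffOn_coord_comp s₁ fun e he => hUe₁ he
    have x₂ := he₂.contMDiffOn_coord_comp s₂ fun e he => by
      rw [← D.δ₁_σ₁]
      exact hUe₂ he
    have hp₀ : ContMDiffOn (mdl E) ((mdl M).prod 𝓘(ℝ, RR r₁ r₂ n₀)) ∞ p₀ Q :=
      (D.v₁.contMDiff_proj.comp_contMDiffOn s₁).prodMk
        (x₁.prodMk_space (x₂.prodMk_space contMDiffOn_const))
    have hΦ₀ : ContMDiffOn (mdl E) (mdl E) ∞ (fun e => Φ (p₀ e)) Q :=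
      hΦ.comp hp₀ fun e he => ⟨he, trivial⟩
    have hd : ContMDiffOn (mdl E) (mdl E) ∞ d Q := by
      refine D.vII.contMDiffOn_add contMDiffOn_id
        (D.vII.contMDiffOn_smul contMDiffOn_const hΦ₀) fun e he => ?_
      obtain ⟨ξ, hξ⟩ := hsurj e he
      have := (hkey _ he ξ).2.1
      rw [hξ] at this
      rw [D.vII.proj_smul, this]
    have hσd : ∀ e ∈ Q, D.σ₁ (d e) = D.v₁.zero (D.δ₁ (D.σ₁ e)) := fun e he => by
      obtain ⟨ξ, hξ⟩ := hsurj e he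
      have := (hkey _ he ξ).2.2.1
      rwa [hξ] at this
    have hd' : ContMDiffOn (mdl E) (mdl E) ∞ d' Q := by
      refine D.vI.contMDiffOn_add hd (D.vI.contMDiffOn_smul contMDiffOn_const
        (D.vII.contMDiff_zero.comp_contMDiffOn s₂)) fun e he => ?_
      rw [D.vI.proj_smul, D.hom_zeroII.comm, hσd e he, D.δ₁_σ₁]
    refine x₁.prodMk_space (x₂.prodMk_space (hz.comp hd' fun e he => ?_))
    obtain ⟨ξ, hξ⟩ := hsurj e he
    have := (hkey _ he ξ).2.2.2
    rw [hξ] at this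
    change D.σ₁ (d' e) ∈ O
    rw [this, (hwσ _ (hUU₂ he) _).1]
    exact hOm _ (hUU₂ he)
  · obtain ⟨Ω, hΩ, hev, -⟩ := frame m hm
    exact ⟨Ω, hΩ, fun ξ => ⟨hev ξ, (hkey m hm ξ).1⟩⟩

/-- The frames of a double vector bundle of constant ranks form a frame system. -/
theorem HasFiberDim.frameSystem (hD : D.HasFiberDim n₁ n₂ n₀) :
    FrameSystem (fun e => D.δ₁ (D.σ₁ e))
      (FrameBundle.proj (D := D) (n₁ := n₁) (n₂ := n₂) (n₀ := n₀))
      FrameBundle.act AutR.act FrameBundle.eval where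
  contMDiff_pr := D.v₁.contMDiff_proj.comp D.vI.contMDiff_proj
  proj_eval Ω ξ := Ω.δ₁_σ₁_eval ξ
  eval_injective Ω := Ω.eval_injective
  eval_surjective Ω e h := Ω.eval_surjective e h
  proj_act _ _ := rfl
  eval_act Ω a ξ := Ω.eval_act a ξ
  ext := FrameBundle.eval_ext
  exists_change := FrameBundle.exists_change
  l_one := AutR.act_one
  l_mul := AutR.act_mul
  l_injective _ _ := AutR.act_injective
  contMDiff_l := AutR.contMDiff_act
  contMDiffOn_of_l _ _ h := AutR.contMDiffOn_of_act fun v => contMDiffOn_apply_of_prod h v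
  exists_local := hD.exists_local

end DVBundle

/-! ### Principal bundles over frame bundles -/

section Factor

variable {P P₁ B G G₁ K : Type*} [TopologicalSpace P] [Mfd P] [TopologicalSpace P₁] [Mfd P₁]
  [TopologicalSpace B] [Mfd B] [TopologicalSpace G] [Mfd G] [Group G]
  [TopologicalSpace G₁] [Mfd G₁]
  [TopologicalSpace K] [Mfd K] [Group K]
  {π : P → B} {π₁ : P₁ → B} {act : P → G → P} {act₁ : P₁ → G₁ → P₁}

/-- Two trivializations of bundles with groups, related by a homomorphism `(q, φ)`. -/
structure CompatibleTriv (act : P → G → P) (q : P → P₁) (φ : G → G₁)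
    (e : Bundle.Trivialization G π) (e₁ : Bundle.Trivialization G₁ π₁) : Prop where
  baseSet_eq : e₁.baseSet = e.baseSet
  smooth : IsSmoothTriv (mdl G) e
  smooth₁ : IsSmoothTriv (mdl G₁) e₁
  map_act : ∀ p, π p ∈ e.baseSet → ∀ a, (e (act p a)).2 = (e p).2 * a
  map_q : ∀ p, π p ∈ e.baseSet → (e₁ (q p)).2 = φ (e p).2

/-- Let `q : P → P₁` be a homomorphism of principal bundles over `B` that is given in suitable
trivializations by `φ : G → G₁`. If `φ` and a map `τ` to a group `K` identify `G` with `G₁ × K`, so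
that `K` acts by right multiplication on the second factor, then `q` is a principal `K`-bundle. -/
theorem IsPrincipalBundle.of_factor [LieGroup (mdl G) ∞ G] [LieGroup (mdl K) ∞ K]
    (h : IsPrincipalBundle π act)
    {q : P → P₁} (hq : ∀ p, π₁ (q p) = π p) {φ : G → G₁} {τ : G → K} {j : G₁ × K → G} {κ : K →* G}
    (hφ : ContMDiff (mdl G) (mdl G₁) ∞ φ) (hτ : ContMDiff (mdl G) (mdl K) ∞ τ)
    (hj : ContMDiff ((mdl G₁).prod (mdl K)) (mdl G) ∞ j) (hκ : ContMDiff (mdl K) (mdl G) ∞ κ)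
    (hφj : ∀ x, φ (j x) = x.1) (hτj : ∀ x, τ (j x) = x.2) (hj' : ∀ a, j (φ a, τ a) = a)
    (hτκ : ∀ a k, τ (a * κ k) = τ a * k) (hqκ : ∀ p k, q (act p (κ k)) = q p)
    (hloc : ∀ b, ∃ (e : Bundle.Trivialization G π) (e₁ : Bundle.Trivialization G₁ π₁),
      b ∈ e.baseSet ∧ CompatibleTriv act q φ e e₁) :
    IsPrincipalBundle q (fun p k => act p (κ k)) := by
  have hqs : ContMDiff (mdl P) (mdl P₁) ∞ q := by
    intro p
    obtain ⟨e, e₁, hb, he⟩ := hloc (π p)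
    have h1 : ContMDiffOn (mdl P) ((mdl B).prod (mdl G₁)) ∞ (fun p => (π p, φ (e p).2)) e.source :=
      h.contMDiff_proj.contMDiffOn.prodMk
        (hφ.comp_contMDiffOn (contMDiff_snd.comp_contMDiffOn he.smooth.1))
    have h2 := he.smooth₁.2.comp h1 fun p hp => by
      rw [Set.mem_preimage, e₁.target_eq, he.baseSet_eq]
      exact ⟨e.mem_source.1 hp, trivial⟩
    refine (h2.congr fun p hp => ?_).contMDiffAt (e.open_source.mem_nhds (e.mem_source.2 hb))
    have hp' := e.mem_source.1 hp
    change q p = e₁.toOpenPartialHomeomorph.symm (π p, φ (e p).2)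
    rw [← he.map_q p hp', ← hq]
    exact (Triv.symm_coord (by rwa [hq, he.baseSet_eq])).symm
  refine ⟨hqs, h.contMDiff_act.comp (contMDiff_fst.prodMk (hκ.comp contMDiff_snd)),
    fun p => by rw [map_one, h.act_one], fun p k l => by rw [map_mul, h.act_mul], hqκ,
    fun b₁ => ?_⟩
  obtain ⟨e, e₁, hb, he⟩ := hloc (π₁ b₁)
  have hsrc : q ⁻¹' (π₁ ⁻¹' e.baseSet) = e.source := by
    rw [e.source_eq]
    ext p
    simp only [Set.mem_preimage, hq]
  have h1 : ContMDiffOn (mdl P) ((mdl P₁).prod (mdl K)) ∞ (fun p => (q p, τ (e p).2))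
      (q ⁻¹' (π₁ ⁻¹' e.baseSet)) := by
    rw [hsrc]
    exact hqs.contMDiffOn.prodMk (hτ.comp_contMDiffOn (contMDiff_snd.comp_contMDiffOn he.smooth.1))
  have hsrc₁ : π₁ ⁻¹' e.baseSet = e₁.source := by rw [e₁.source_eq, he.baseSet_eq]
  have hopen : IsOpen (π₁ ⁻¹' e.baseSet) := hsrc₁ ▸ e₁.open_source
  have h2 : ContMDiffOn ((mdl P₁).prod (mdl K)) (mdl P) ∞
      (fun x : P₁ × K => e.toOpenPartialHomeomorph.symm (π₁ x.1, j ((e₁ x.1).2, x.2)))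
      ((π₁ ⁻¹' e.baseSet) ×ˢ Set.univ) := by
    have hes : ContMDiffOn (mdl P₁) ((mdl B).prod (mdl G₁)) ∞ e₁ (π₁ ⁻¹' e.baseSet) := by
      rw [hsrc₁]
      exact he.smooth₁.1
    have hes' : ContMDiffOn ((mdl P₁).prod (mdl K)) ((mdl B).prod (mdl G₁)) ∞
        (fun x : P₁ × K => e₁ x.1) ((π₁ ⁻¹' e.baseSet) ×ˢ Set.univ) :=
      hes.comp contMDiffOn_fst fun x hx => hx.1
    have hπ₁ : ContMDiffOn ((mdl P₁).prod (mdl K)) (mdl B) ∞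
        (fun x : P₁ × K => π₁ x.1) ((π₁ ⁻¹' e.baseSet) ×ˢ Set.univ) :=
      (contMDiff_fst.comp_contMDiffOn hes').congr fun x hx =>
        (e₁.coe_fst (hsrc₁ ▸ hx.1 : x.1 ∈ e₁.source)).symm
    refine he.smooth.2.comp (hπ₁.prodMk (hj.comp_contMDiffOn
      ((contMDiff_snd.comp_contMDiffOn hes').prodMk contMDiffOn_snd))) fun x hx => ?_
    rw [Set.mem_preimage, e.target_eq]
    exact ⟨hx.1, trivial⟩
  have key : ∀ x : P₁ × K, π₁ x.1 ∈ e.baseSet →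
      q (e.toOpenPartialHomeomorph.symm (π₁ x.1, j ((e₁ x.1).2, x.2))) = x.1 := by
    intro x hx
    have h3 : π₁ (q (e.toOpenPartialHomeomorph.symm (π₁ x.1, j ((e₁ x.1).2, x.2)))) = π₁ x.1 := by
      rw [hq, Triv.proj_symm hx]
    refine Triv.coord_injective (e := e₁) (by rwa [h3, he.baseSet_eq]) h3 ?_
    rw [he.map_q _ (by rwa [Triv.proj_symm hx]), Triv.coord_symm hx, hφj]
  refine ⟨{ toFun := fun p => (q p, τ (e p).2)
            invFun := fun x : P₁ × K =>
              e.toOpenPartialHomeomorph.symm (π₁ x.1, j ((e₁ x.1).2, x.2))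
            source := q ⁻¹' (π₁ ⁻¹' e.baseSet)
            target := (π₁ ⁻¹' e.baseSet) ×ˢ Set.univ
            map_source' := fun p hp => ⟨hp, trivial⟩
            map_target' := fun x hx => by
              rw [Set.mem_preimage, key x hx.1]
              exact hx.1
            left_inv' := fun p hp => ?_
            right_inv' := fun x hx => Prod.ext (key x hx.1) ?_
            open_source := hsrc ▸ e.open_source
            open_target := hopen.prod isOpen_univ
            continuousOn_toFun := h1.continuousOn
            continuousOn_invFun := h2.continuousOn
            baseSet := π₁ ⁻¹' e.baseSet
            open_baseSet := hopen
            source_eq := rfl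
            target_eq := rfl
            proj_toFun := fun _ _ => rfl }, hb, ⟨h1, h2⟩, fun p hp k => ?_⟩
  · have hp' : π p ∈ e.baseSet := by
      rw [← hq]
      exact hp
    simp only [hq, he.map_q p hp', hj']
    exact Triv.symm_coord hp'
  · change τ (e (e.toOpenPartialHomeomorph.symm (π₁ x.1, j ((e₁ x.1).2, x.2)))).2 = x.2
    rw [Triv.coord_symm hx.1, hτj]
  · have hp' : π p ∈ e.baseSet := by
      rw [← hq]
      exact hp
    change τ (e (act p (κ k))).2 = τ (e p).2 * k
    rw [he.map_act p hp', hτκ]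

end Factor

namespace FrameSystem

variable {P Z B G V P₁ Z₁ G₁ V₁ : Type*} [TopologicalSpace Z] [Mfd Z] [TopologicalSpace B] [Mfd B]
    [TopologicalSpace G] [Mfd G] [Group G] [NormedAddCommGroup V]
    [NormedSpace ℝ V] {pr : Z → B} {π : P → B} {act : P → G → P} {l : G → V → V}
    {eval : P → V → Z} [TopologicalSpace Z₁] [Mfd Z₁]
    [TopologicalSpace G₁] [Mfd G₁] [NormedAddCommGroup V₁]
    [NormedSpace ℝ V₁] {pr₁ : Z₁ → B} {π₁ : P₁ → B} {act₁ : P₁ → G₁ → P₁} {l₁ : G₁ → V₁ → V₁}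
    {eval₁ : P₁ → V₁ → Z₁}
    [TopologicalSpace P] [Mfd P] [TopologicalSpace P₁] [Mfd P₁]

/-- An equivariant map of frames that preserves smooth local frames is given by the homomorphism of
groups in suitable trivializations. -/
lemma exists_compatibleTriv (S : FrameSystem pr π act l eval) (hP : IsFrameMfd π act eval)
    (hP₁ : IsFrameMfd π₁ act₁ eval₁) {q : P → P₁} {φ : G → G₁}
    (hqφ : ∀ p a, q (act p a) = act₁ (q p) (φ a))
    (hframe : ∀ U s, IsLocalFrame π eval U s → IsLocalFrame π₁ eval₁ U (fun m => q (s m))) (b : B) :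
    ∃ (e : Bundle.Trivialization G π) (e₁ : Bundle.Trivialization G₁ π₁),
      b ∈ e.baseSet ∧ CompatibleTriv act q φ e e₁ := by
  obtain ⟨s, e, hb, hs, hsm, hes, hact⟩ := S.exists_trivialization hP b
  obtain ⟨e₁, he₁, hsm₁, hes₁⟩ := hP₁ _ _ (hframe _ _ hs)
  refine ⟨e, e₁, hb, he₁, hsm, hsm₁, hact, fun p hp => ?_⟩
  have h1 : p = act (s (π p)) (e p).2 := by
    rw [← hes _ hp, Triv.symm_coord hp]
  conv_lhs => rw [h1]
  rw [hqφ, ← hes₁ _ hp, Triv.coord_symm (by rwa [he₁])]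

end FrameSystem

/-! ### Transport of double vector bundles along diffeomorphisms -/

section Transport

variable {Z B Z' B' : Type*} [TopologicalSpace Z] [Mfd Z] [TopologicalSpace B] [Mfd B]
    [TopologicalSpace Z'] [Mfd Z'] [TopologicalSpace B'] [Mfd B'] {π : Z → B}

/-- The diffeomorphisms of two manifolds. -/
abbrev Diffeo (X Y : Type*) [TopologicalSpace X] [Mfd X] [TopologicalSpace Y] [Mfd Y] :=
  Diffeomorph (mdl X) (mdl Y) X Y ∞

/-- The transport of a vector bundle along diffeomorphisms of the total space and the base. -/
noncomputable def VBundle.transport (A : VBundle π) (f : Diffeo Z' Z) (g : Diffeo B' B) :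
    VBundle (fun z => g.symm (π (f z))) where
  add u v := f.symm (A.add (f u) (f v))
  smul c u := f.symm (A.smul c (f u))
  zero b := f.symm (A.zero (g b))
  contMDiff_proj := g.symm.contMDiff.comp (A.contMDiff_proj.comp f.contMDiff)
  proj_add u v h := by
    rw [f.apply_symm_apply, A.proj_add _ _ (g.symm.injective h)]
  proj_smul c u := by rw [f.apply_symm_apply, A.proj_smul]
  proj_zero b := by rw [f.apply_symm_apply, A.proj_zero, g.symm_apply_apply]
  exists_triv b := by
    obtain ⟨r, e, hb, he⟩ := A.exists_isLinearTriv (g b)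
    have hsrc : (fun z => g.symm (π (f z))) ⁻¹' (g ⁻¹' e.baseSet) = f ⁻¹' e.source := by
      rw [e.source_eq]
      ext z
      simp only [Set.mem_preimage, g.apply_symm_apply]
    have h1 : ContMDiffOn (mdl Z') ((mdl B').prod 𝓘(ℝ, R r)) ∞
        (fun z => (g.symm (π (f z)), (e (f z)).2))
        ((fun z => g.symm (π (f z))) ⁻¹' (g ⁻¹' e.baseSet)) := by
      rw [hsrc]
      exact (g.symm.contMDiff.comp (A.contMDiff_proj.comp f.contMDiff)).contMDiffOn.prodMk
        (he.contMDiffOn_coord.comp f.contMDiff.contMDiffOn fun z hz => hz)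
    have h2 : ContMDiffOn ((mdl B').prod 𝓘(ℝ, R r)) (mdl Z') ∞
        (fun x : B' × R r => f.symm (e.toOpenPartialHomeomorph.symm (g x.1, x.2)))
        ((g ⁻¹' e.baseSet) ×ˢ Set.univ) :=
      f.symm.contMDiff.comp_contMDiffOn (he.contMDiffOn_symm
        (g.contMDiff.comp_contMDiffOn contMDiffOn_fst) contMDiffOn_snd fun x hx => hx.1)
    refine ⟨r, { toFun := fun z => (g.symm (π (f z)), (e (f z)).2)
                 invFun := fun x : B' × R r =>
                   f.symm (e.toOpenPartialHomeomorph.symm (g x.1, x.2))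
                 source := (fun z => g.symm (π (f z))) ⁻¹' (g ⁻¹' e.baseSet)
                 target := (g ⁻¹' e.baseSet) ×ˢ Set.univ
                 map_source' := fun z hz => ⟨hz, trivial⟩
                 map_target' := fun x hx => ?_
                 left_inv' := fun z hz => ?_
                 right_inv' := fun x hx => ?_
                 open_source := hsrc ▸ e.open_source.preimage f.continuous
                 open_target := (e.open_baseSet.preimage g.continuous).prod isOpen_univ
                 continuousOn_toFun := h1.continuousOn
                 continuousOn_invFun := h2.continuousOn
                 baseSet := g ⁻¹' e.baseSet
                 open_baseSet := e.open_baseSet.preimage g.continuous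
                 source_eq := rfl
                 target_eq := rfl
                 proj_toFun := fun _ _ => rfl }, hb, ⟨h1, h2⟩, fun u v hu h => ?_, fun c u hu => ?_,
                 fun x hx => ?_⟩
    · have hx' : g x.1 ∈ e.baseSet := hx.1
      change g (g.symm (π (f (f.symm _)))) ∈ e.baseSet
      rwa [f.apply_symm_apply, Triv.proj_symm hx', g.apply_symm_apply]
    · have hz' : π (f z) ∈ e.baseSet := by
        have : g (g.symm (π (f z))) ∈ e.baseSet := hz
        rwa [g.apply_symm_apply] at this
      simp only [g.apply_symm_apply, Triv.symm_coord hz', f.symm_apply_apply]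
    · have hx' : g x.1 ∈ e.baseSet := hx.1
      simp only [f.apply_symm_apply, Triv.proj_symm hx', Triv.coord_symm hx', g.symm_apply_apply]
    · have hu' : π (f u) ∈ e.baseSet := by
        have : g (g.symm (π (f u))) ∈ e.baseSet := hu
        rwa [g.apply_symm_apply] at this
      change (e (f (f.symm _))).2 = _
      rw [f.apply_symm_apply]
      exact he.map_add _ _ hu' (g.symm.injective h)
    · have hu' : π (f u) ∈ e.baseSet := by
        have : g (g.symm (π (f u))) ∈ e.baseSet := hu
        rwa [g.apply_symm_apply] at this
      change (e (f (f.symm _))).2 = _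
      rw [f.apply_symm_apply]
      exact he.map_smul _ _ hu'
    · change (e (f (f.symm _))).2 = _
      rw [f.apply_symm_apply]
      exact he.map_zero _ hx

lemma VBundle.isVBHom_transport (A : VBundle π) (f : Diffeo Z' Z) (g : Diffeo B' B) :
    IsVBHom (A.transport f g) A f g where
  contMDiff_total := f.contMDiff
  contMDiff_base := g.contMDiff
  comm _ := (g.apply_symm_apply _).symm
  map_add _ _ _ := f.apply_symm_apply _
  map_smul _ _ := f.apply_symm_apply _

lemma VBundle.isVBHom_transport_symm (A : VBundle π) (f : Diffeo Z' Z) (g : Diffeo B' B) :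
    IsVBHom A (A.transport f g) f.symm g.symm where
  contMDiff_total := f.symm.contMDiff
  contMDiff_base := g.symm.contMDiff
  comm u := by rw [f.apply_symm_apply]
  map_add u v _ := by simp only [VBundle.transport, f.apply_symm_apply]
  map_smul c u := by simp only [VBundle.transport, f.apply_symm_apply]

lemma IsVBHom.comp {Z₂ B₂ Z₃ B₃ : Type*} [TopologicalSpace Z₂] [Mfd Z₂] [TopologicalSpace B₂]
    [Mfd B₂] [TopologicalSpace Z₃] [Mfd Z₃] [TopologicalSpace B₃] [Mfd B₃] {π₂ : Z₂ → B₂}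
    {π₃ : Z₃ → B₃} {A : VBundle π} {A₂ : VBundle π₂} {A₃ : VBundle π₃} {f : Z → Z₂} {g : B → B₂}
    {f' : Z₂ → Z₃} {g' : B₂ → B₃} (h' : IsVBHom A₂ A₃ f' g') (h : IsVBHom A A₂ f g) :
    IsVBHom A A₃ (f' ∘ f) (g' ∘ g) where
  contMDiff_total := h'.contMDiff_total.comp h.contMDiff_total
  contMDiff_base := h'.contMDiff_base.comp h.contMDiff_base
  comm u := by rw [Function.comp, h'.comm, h.comm, Function.comp]
  map_add u v huv := by
    simp only [Function.comp]
    rw [h.map_add u v huv, h'.map_add _ _ (by rw [h.comm, h.comm, huv])]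
  map_smul c u := by simp only [Function.comp, h.map_smul, h'.map_smul]

lemma IsVBHom.transport {Z₂ B₂ Z₂' B₂' : Type*} [TopologicalSpace Z₂] [Mfd Z₂] [TopologicalSpace B₂]
    [Mfd B₂] [TopologicalSpace Z₂'] [Mfd Z₂'] [TopologicalSpace B₂'] [Mfd B₂'] {π₂ : Z₂ → B₂}
    {A : VBundle π} {A₂ : VBundle π₂} {φ : Z → Z₂} {γ : B → B₂} (h : IsVBHom A A₂ φ γ)
    (f : Diffeo Z' Z) (g : Diffeo B' B) (f₂ : Diffeo Z₂' Z₂) (g₂ : Diffeo B₂' B₂) :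
    IsVBHom (A.transport f g) (A₂.transport f₂ g₂) (fun z => f₂.symm (φ (f z)))
      (fun b => g₂.symm (γ (g b))) :=
  (A₂.isVBHom_transport_symm f₂ g₂).comp (h.comp (A.isVBHom_transport f g))

variable {E E₁ E₂ M E' E₁' E₂' : Type*} [TopologicalSpace E] [Mfd E] [TopologicalSpace E₁] [Mfd E₁]
    [TopologicalSpace E₂] [Mfd E₂] [TopologicalSpace M] [Mfd M] [TopologicalSpace E'] [Mfd E']
    [TopologicalSpace E₁'] [Mfd E₁'] [TopologicalSpace E₂'] [Mfd E₂']

/-- The transport of a double vector bundle along diffeomorphisms of the total space and the side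
bundles. -/
noncomputable def DVBundle.transport (D : DVBundle E E₁ E₂ M) (f : Diffeo E' E) (f₁ : Diffeo E₁' E₁)
    (f₂ : Diffeo E₂' E₂) : DVBundle E' E₁' E₂' M where
  σ₁ e := f₁.symm (D.σ₁ (f e))
  σ₂ e := f₂.symm (D.σ₂ (f e))
  δ₁ e := D.δ₁ (f₁ e)
  δ₂ e := D.δ₂ (f₂ e)
  vI := D.vI.transport f f₁
  vII := D.vII.transport f f₂
  v₁ := D.v₁.transport f₁ (Diffeomorph.refl _ _ _)
  v₂ := D.v₂.transport f₂ (Diffeomorph.refl _ _ _)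
  hom_σ₁ := D.hom_σ₁.transport f f₂ f₁ (Diffeomorph.refl _ _ _)
  hom_σ₂ := D.hom_σ₂.transport f f₁ f₂ (Diffeomorph.refl _ _ _)
  hom_zeroI := D.hom_zeroI.transport f₁ (Diffeomorph.refl _ _ _) f f₂
  hom_zeroII := D.hom_zeroII.transport f₂ (Diffeomorph.refl _ _ _) f f₁
  hom_smulI c := (D.hom_smulI c).transport f f₂ f f₂
  hom_smulII c := (D.hom_smulII c).transport f f₁ f f₁
  interchange u u' w w' h h' k k' := by
    simp only [VBundle.transport, f.apply_symm_apply]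
    rw [D.interchange _ _ _ _ (f₁.symm.injective h) (f₁.symm.injective h') (f₂.symm.injective k)
      (f₂.symm.injective k')]

lemma DVBundle.isDVBIso_transport (D : DVBundle E E₁ E₂ M) (f : Diffeo E' E) (f₁ : Diffeo E₁' E₁)
    (f₂ : Diffeo E₂' E₂) : IsDVBIso (D.transport f f₁ f₂) D f f₁ f₂ id :=
  ⟨⟨D.vI.isVBHom_transport f f₁, D.vII.isVBHom_transport f f₂,
    D.v₁.isVBHom_transport f₁ (Diffeomorph.refl _ _ _),
    D.v₂.isVBHom_transport f₂ (Diffeomorph.refl _ _ _)⟩, f.symm, f₁.symm, f₂.symm, id,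
    ⟨D.vI.isVBHom_transport_symm f f₁, D.vII.isVBHom_transport_symm f f₂,
      D.v₁.isVBHom_transport_symm f₁ (Diffeomorph.refl _ _ _),
      D.v₂.isVBHom_transport_symm f₂ (Diffeomorph.refl _ _ _)⟩,
    f.symm_apply_apply, f.apply_symm_apply, f₁.symm_apply_apply, f₁.apply_symm_apply,
    f₂.symm_apply_apply, f₂.apply_symm_apply, fun _ => rfl, fun _ => rfl⟩

end Transport

/-! ### The kernels of the projections of the automorphism group -/

section Factors

variable {n₁ n₂ n₀ : ℕ}

/-- The factor of `a` in `K₁`, with respect to `AutR = GL(n₁) × K₁` (as manifolds). -/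
noncomputable def AutR.toK₁ (a : AutR n₁ n₂ n₀) : AutK₁ n₁ n₂ n₀ := SemiT.mk _ a.lin.2 a.bil

/-- The factor of `a` in `K₂`, with respect to `AutR = GL(n₂) × K₂` (as manifolds). -/
noncomputable def AutR.toK₂ (a : AutR n₁ n₂ n₀) : AutK₂ n₁ n₂ n₀ :=
  SemiT.mk _ (a.lin.1, a.lin.2.2) a.bil

/-- The inverse of `a ↦ (a₁, a.toK₁)`. -/
noncomputable def AutR.ofK₁ (x : GLin n₁ × AutK₁ n₁ n₂ n₀) : AutR n₁ n₂ n₀ :=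
  SemiT.mk _ (x.1, x.2.lin) x.2.bil

/-- The inverse of `a ↦ (a₂, a.toK₂)`. -/
noncomputable def AutR.ofK₂ (x : GLin n₂ × AutK₂ n₁ n₂ n₀) : AutR n₁ n₂ n₀ :=
  SemiT.mk _ (x.2.lin.1, x.1, x.2.lin.2) x.2.bil

lemma AutR.contMDiff_toK₁ : ContMDiff (mdl (AutR n₁ n₂ n₀)) (mdl (AutK₁ n₁ n₂ n₀)) ∞
    (AutR.toK₁ : AutR n₁ n₂ n₀ → AutK₁ n₁ n₂ n₀) :=
  SemiT.contMDiff_of ((contMDiff_snd (I := mdl (GLin n₁)) (J := mdl (GLin n₂ × GLin n₀))).comp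
    SemiT.contMDiff_lin) SemiT.contMDiff_bil

lemma AutR.contMDiff_toK₂ : ContMDiff (mdl (AutR n₁ n₂ n₀)) (mdl (AutK₂ n₁ n₂ n₀)) ∞
    (AutR.toK₂ : AutR n₁ n₂ n₀ → AutK₂ n₁ n₂ n₀) :=
  SemiT.contMDiff_of (ContMDiff.prodMk (I' := mdl (GLin n₁)) (J' := mdl (GLin n₀))
    ((contMDiff_fst (I := mdl (GLin n₁)) (J := mdl (GLin n₂ × GLin n₀))).comp SemiT.contMDiff_lin)
    ((contMDiff_snd (I := mdl (GLin n₂)) (J := mdl (GLin n₀))).comp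
      ((contMDiff_snd (I := mdl (GLin n₁)) (J := mdl (GLin n₂ × GLin n₀))).comp
        SemiT.contMDiff_lin))) SemiT.contMDiff_bil

lemma AutR.contMDiff_ofK₁ : ContMDiff ((mdl (GLin n₁)).prod (mdl (AutK₁ n₁ n₂ n₀)))
    (mdl (AutR n₁ n₂ n₀)) ∞ (AutR.ofK₁ : GLin n₁ × AutK₁ n₁ n₂ n₀ → AutR n₁ n₂ n₀) := by
  have hb : ContMDiff ((mdl (GLin n₁)).prod (mdl (AutK₁ n₁ n₂ n₀))) 𝓘(ℝ, Bil n₁ n₂ n₀) ∞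
      (fun x : GLin n₁ × AutK₁ n₁ n₂ n₀ => x.2.bil) := SemiT.contMDiff_bil.comp contMDiff_snd
  exact SemiT.contMDiff_of (ContMDiff.prodMk (I' := mdl (GLin n₁)) (J' := mdl (GLin n₂ × GLin n₀))
    contMDiff_fst (SemiT.contMDiff_lin.comp contMDiff_snd))
    hb

lemma AutR.contMDiff_ofK₂ : ContMDiff ((mdl (GLin n₂)).prod (mdl (AutK₂ n₁ n₂ n₀)))
    (mdl (AutR n₁ n₂ n₀)) ∞ (AutR.ofK₂ : GLin n₂ × AutK₂ n₁ n₂ n₀ → AutR n₁ n₂ n₀) := by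
  have h : ContMDiff ((mdl (GLin n₂)).prod (mdl (AutK₂ n₁ n₂ n₀))) (mdl (GLin n₁ × GLin n₀)) ∞
      (fun x : GLin n₂ × AutK₂ n₁ n₂ n₀ => x.2.lin) := SemiT.contMDiff_lin.comp contMDiff_snd
  have hb : ContMDiff ((mdl (GLin n₂)).prod (mdl (AutK₂ n₁ n₂ n₀))) 𝓘(ℝ, Bil n₁ n₂ n₀) ∞
      (fun x : GLin n₂ × AutK₂ n₁ n₂ n₀ => x.2.bil) := SemiT.contMDiff_bil.comp contMDiff_snd
  exact SemiT.contMDiff_of (ContMDiff.prodMk (I' := mdl (GLin n₁)) (J' := mdl (GLin n₂ × GLin n₀))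
    ((contMDiff_fst (I := mdl (GLin n₁)) (J := mdl (GLin n₀))).comp h)
    (ContMDiff.prodMk (I' := mdl (GLin n₂)) (J' := mdl (GLin n₀)) contMDiff_fst
    ((contMDiff_snd (I := mdl (GLin n₁)) (J := mdl (GLin n₀))).comp h)))
    hb

lemma AutR.toK₁_mul (a : AutR n₁ n₂ n₀) (k : AutK₁ n₁ n₂ n₀) :
    (a * (autDLG n₁ n₂ n₀).κ₁ k).toK₁ = a.toK₁ * k := by
  refine SemiT.ext rfl ?_
  ext x y : 2
  rfl

lemma AutR.toK₂_mul (a : AutR n₁ n₂ n₀) (k : AutK₂ n₁ n₂ n₀) :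
    (a * (autDLG n₁ n₂ n₀).κ₂ k).toK₂ = a.toK₂ * k := by
  refine SemiT.ext rfl ?_
  ext x y : 2
  rfl

lemma contMDiff_autDLG_φ₁ :
    ContMDiff (mdl (AutK₂ n₁ n₂ n₀)) (mdl (GLin n₁)) ∞ (autDLG n₁ n₂ n₀).φ₁ :=
  (contMDiff_fst (I := mdl (GLin n₁)) (J := mdl (GLin n₂))).comp
    ((autDLG n₁ n₂ n₀).contMDiff_φ.comp (autDLG n₁ n₂ n₀).contMDiff_κ₂)

lemma contMDiff_autDLG_φ₂ :
    ContMDiff (mdl (AutK₁ n₁ n₂ n₀)) (mdl (GLin n₂)) ∞ (autDLG n₁ n₂ n₀).φ₂ :=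
  (contMDiff_snd (I := mdl (GLin n₁)) (J := mdl (GLin n₂))).comp
    ((autDLG n₁ n₂ n₀).contMDiff_φ.comp (autDLG n₁ n₂ n₀).contMDiff_κ₁)

lemma range_autDLG_i₁ : (autDLG n₁ n₂ n₀).i₁.range = (autDLG n₁ n₂ n₀).φ₂.ker := by
  ext g
  constructor
  · rintro ⟨a, rfl⟩
    rfl
  · intro (hg : g.a₂ = 1)
    exact ⟨SemiT.mk _ g.a₀ g.bil, SemiT.ext (Prod.ext hg.symm rfl) rfl⟩

lemma range_autDLG_i₂ : (autDLG n₁ n₂ n₀).i₂.range = (autDLG n₁ n₂ n₀).φ₁.ker := by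
  ext g
  constructor
  · rintro ⟨a, rfl⟩
    rfl
  · intro (hg : g.a₁ = 1)
    exact ⟨SemiT.mk _ g.a₀ g.bil, SemiT.ext (Prod.ext hg.symm rfl) rfl⟩

lemma injective_autDLG_i₁ : Function.Injective (autDLG n₁ n₂ n₀).i₁ := fun _ _ h =>
  (autDLG n₁ n₂ n₀).injective_i (congrArg (autDLG n₁ n₂ n₀).κ₁ h)

lemma injective_autDLG_i₂ : Function.Injective (autDLG n₁ n₂ n₀).i₂ := fun _ _ h =>
  (autDLG n₁ n₂ n₀).injective_i (congrArg (autDLG n₁ n₂ n₀).κ₂ h)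

lemma contMDiff_autDLG_i₁ : ContMDiff (mdl (AutCore n₁ n₂ n₀)) (mdl (AutK₁ n₁ n₂ n₀)) ∞
    (autDLG n₁ n₂ n₀).i₁ :=
  SemiT.contMDiff_map (fun _ => rfl)
    (ContMDiff.prodMk (I' := mdl (GLin n₂)) contMDiff_const contMDiff_id)

lemma contMDiff_autDLG_i₂ : ContMDiff (mdl (AutCore n₁ n₂ n₀)) (mdl (AutK₂ n₁ n₂ n₀)) ∞
    (autDLG n₁ n₂ n₀).i₂ :=
  SemiT.contMDiff_map (fun _ => rfl)
    (ContMDiff.prodMk (I' := mdl (GLin n₁)) contMDiff_const contMDiff_id)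

end Factors

/-! ### The frame bundle as a double principal bundle -/

section Frames

variable {E E₁ E₂ M : Type*} [TopologicalSpace E] [Mfd E] [TopologicalSpace E₁] [Mfd E₁]
    [TopologicalSpace E₂] [Mfd E₂] [TopologicalSpace M] [Mfd M] {D : DVBundle E E₁ E₂ M}
    {n₁ n₂ n₀ : ℕ}

open FrameSystem

lemma DVBundle.isLocalFrame_proj₁ (U : Set M) (s : M → D.FrameBundle n₁ n₂ n₀)
    (h : IsLocalFrame FrameBundle.proj FrameBundle.eval U s) :
    IsLocalFrame VBundle.FrameBundle.proj VBundle.FrameBundle.eval U (fun m => (s m).proj₁) := by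
  refine ⟨h.isOpen, h.proj, ?_⟩
  have h1 : ContMDiffOn ((mdl M).prod 𝓘(ℝ, R n₁)) ((mdl M).prod 𝓘(ℝ, RR n₁ n₂ n₀)) ∞
      (fun x : M × R n₁ => (x.1, ((x.2, 0, 0) : RR n₁ n₂ n₀))) (U ×ˢ Set.univ) :=
    contMDiffOn_fst.prodMk (((ContinuousLinearMap.inl ℝ (R n₁)
      (R n₂ × R n₀)).contMDiff).comp_contMDiffOn contMDiffOn_snd)
  have h2 : ContMDiffOn ((mdl M).prod 𝓘(ℝ, R n₁)) (mdl E₁) ∞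
      (fun x : M × R n₁ => D.σ₁ ((s x.1).eval (x.2, 0, 0))) (U ×ˢ Set.univ) :=
    D.hom_σ₁.contMDiff_total.comp_contMDiffOn (h.contMDiffOn_eval.comp h1 fun x hx => hx)
  refine h2.congr fun x _ => ?_
  exact ((s x.1).σ₁_eval (x.2, 0, 0)).symm

lemma DVBundle.isLocalFrame_proj₂ (U : Set M) (s : M → D.FrameBundle n₁ n₂ n₀)
    (h : IsLocalFrame FrameBundle.proj FrameBundle.eval U s) :
    IsLocalFrame VBundle.FrameBundle.proj VBundle.FrameBundle.eval U (fun m => (s m).proj₂) := by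
  refine ⟨h.isOpen, h.proj, ?_⟩
  have h1 : ContMDiffOn ((mdl M).prod 𝓘(ℝ, R n₂)) ((mdl M).prod 𝓘(ℝ, RR n₁ n₂ n₀)) ∞
      (fun x : M × R n₂ => (x.1, ((0, x.2, 0) : RR n₁ n₂ n₀))) (U ×ˢ Set.univ) :=
    contMDiffOn_fst.prodMk (((ContinuousLinearMap.inr ℝ (R n₁) (R n₂ × R n₀)).comp
      (ContinuousLinearMap.inl ℝ (R n₂) (R n₀))).contMDiff.comp_contMDiffOn contMDiffOn_snd)
  have h2 : ContMDiffOn ((mdl M).prod 𝓘(ℝ, R n₂)) (mdl E₂) ∞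
      (fun x : M × R n₂ => D.σ₂ ((s x.1).eval (0, x.2, 0))) (U ×ˢ Set.univ) :=
    D.hom_σ₂.contMDiff_total.comp_contMDiffOn (h.contMDiffOn_eval.comp h1 fun x hx => hx)
  refine h2.congr fun x _ => ?_
  exact ((s x.1).σ₂_eval (0, x.2, 0)).symm

variable [TopologicalSpace (D.FrameBundle n₁ n₂ n₀)] [Mfd (D.FrameBundle n₁ n₂ n₀)]
    [TopologicalSpace (D.v₁.FrameBundle n₁)] [Mfd (D.v₁.FrameBundle n₁)]
    [TopologicalSpace (D.v₂.FrameBundle n₂)] [Mfd (D.v₂.FrameBundle n₂)]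

/-- With their natural manifold structures, the frames of a double vector bundle and of its sides
form a double principal bundle. The identification `AutR = GL(nᵢ) × Kᵢ` splits the `AutR`-bundle of
frames over the base into the `GL(nᵢ)`-bundle of frames of `Eᵢ` and a `Kᵢ`-bundle over it. -/
theorem DVBundle.HasFiberDim.isGDPB (hD : D.HasFiberDim n₁ n₂ n₀)
    (hP : IsFrameMfd (FrameBundle.proj (D := D) (n₁ := n₁) (n₂ := n₂) (n₀ := n₀)) FrameBundle.act
      FrameBundle.eval)
    (hP₁ : IsFrameMfd (VBundle.FrameBundle.proj (A := D.v₁) (n := n₁)) VBundle.FrameBundle.act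
      VBundle.FrameBundle.eval)
    (hP₂ : IsFrameMfd (VBundle.FrameBundle.proj (A := D.v₂) (n := n₂)) VBundle.FrameBundle.act
      VBundle.FrameBundle.eval) :
    IsGDPB (autDLG n₁ n₂ n₀) (FrameBundle.proj₁ (D := D)) (FrameBundle.proj₂ (D := D))
      (VBundle.FrameBundle.proj (A := D.v₁)) (VBundle.FrameBundle.proj (A := D.v₂))
      FrameBundle.act VBundle.FrameBundle.act VBundle.FrameBundle.act := by
  have S := hD.frameSystem
  have S₁ := D.v₁.frameSystem n₁ fun b => (hD b).1
  have S₂ := D.v₂.frameSystem n₂ fun b => (hD b).2.1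
  -- elements of `Kᵢ` do not change the frame of `Eᵢ`
  have hκ₁ : ∀ (Ω : D.FrameBundle n₁ n₂ n₀) (k : AutK₁ n₁ n₂ n₀),
      (Ω.act ((autDLG n₁ n₂ n₀).κ₁ k)).proj₁ = Ω.proj₁ := fun Ω _ => S₁.act_one Ω.proj₁
  have hκ₂ : ∀ (Ω : D.FrameBundle n₁ n₂ n₀) (k : AutK₂ n₁ n₂ n₀),
      (Ω.act ((autDLG n₁ n₂ n₀).κ₂ k)).proj₂ = Ω.proj₂ := fun Ω _ => S₂.act_one Ω.proj₂
  refine ⟨S.contMDiff_act hP, S.act_one, S.act_mul, ?_⟩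
  exact
    { contMDiff_i₁ := contMDiff_autDLG_i₁
      contMDiff_i₂ := contMDiff_autDLG_i₂
      contMDiff_φ₁ := contMDiff_autDLG_φ₁
      contMDiff_φ₂ := contMDiff_autDLG_φ₂
      injective_i₁ := injective_autDLG_i₁
      injective_i₂ := injective_autDLG_i₂
      range_i₁ := range_autDLG_i₁
      range_i₂ := range_autDLG_i₂
      surjective_φ₁ := fun a => ⟨SemiT.mk _ (a, 1) 0, rfl⟩
      surjective_φ₂ := fun a => ⟨SemiT.mk _ (a, 1) 0, rfl⟩
      principal_P₁ := S₁.isPrincipalBundle hP₁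
      principal_P₂ := S₂.isPrincipalBundle hP₂
      principal_I := (S.isPrincipalBundle hP).of_factor (π₁ := VBundle.FrameBundle.proj)
        (fun _ => rfl)
        ((contMDiff_fst (I := mdl (GLin n₁)) (J := mdl (GLin n₂))).comp
          (autDLG n₁ n₂ n₀).contMDiff_φ)
        AutR.contMDiff_toK₁ AutR.contMDiff_ofK₁ (autDLG n₁ n₂ n₀).contMDiff_κ₁
        (fun _ => rfl) (fun _ => rfl) (fun _ => rfl) AutR.toK₁_mul hκ₁
        (S.exists_compatibleTriv hP hP₁ (fun _ _ => rfl) D.isLocalFrame_proj₁)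
      principal_II := (S.isPrincipalBundle hP).of_factor (π₁ := VBundle.FrameBundle.proj)
        (fun _ => rfl)
        ((contMDiff_snd (I := mdl (GLin n₁)) (J := mdl (GLin n₂))).comp
          (autDLG n₁ n₂ n₀).contMDiff_φ)
        AutR.contMDiff_toK₂ AutR.contMDiff_ofK₂ (autDLG n₁ n₂ n₀).contMDiff_κ₂
        (fun _ => rfl) (fun _ => rfl) (fun _ => rfl) AutR.toK₂_mul hκ₂
        (S.exists_compatibleTriv hP hP₂ (fun _ _ => rfl) D.isLocalFrame_proj₂)
      comm := fun _ => rfl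
      hom_π₁ := fun _ _ => rfl
      hom_π₂ := fun _ _ => rfl
      act_core := fun _ _ => rfl }

end Frames

lemma VBundle.FrameBundle.eval_add {Z B : Type*} [TopologicalSpace Z] [Mfd Z] [TopologicalSpace B]
    [Mfd B] {π : Z → B} {A : VBundle π} {n : ℕ} (u : A.FrameBundle n) (x y : R n) :
    u.eval (x + y) = A.add (u.eval x) (u.eval y) :=
  congrArg VBundle.Fiber.pt (lincomb_add u.basis x y)

lemma VBundle.FrameBundle.eval_smul {Z B : Type*} [TopologicalSpace Z] [Mfd Z] [TopologicalSpace B]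
    [Mfd B] {π : Z → B} {A : VBundle π} {n : ℕ} (u : A.FrameBundle n) (c : ℝ) (x : R n) :
    u.eval (c • x) = A.smul c (u.eval x) :=
  congrArg VBundle.Fiber.pt (lincomb_smul u.basis c x)

end DPB

theorem theorem3p2 {E E₁ E₂ M : Type*} [TopologicalSpace E] [Mfd E] [TopologicalSpace E₁] [Mfd E₁]
    [TopologicalSpace E₂] [Mfd E₂] [TopologicalSpace M] [Mfd M] (D : DVBundle E E₁ E₂ M)
    (n₁ n₂ n₀ : ℕ) (hD : D.HasFiberDim n₁ n₂ n₀) :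
    -- the natural manifold structures on the sets of frames of `D`, `E₁` and `E₂`
    ∃ (_ : TopologicalSpace (D.FrameBundle n₁ n₂ n₀)) (_ : Mfd (D.FrameBundle n₁ n₂ n₀))
      (_ : TopologicalSpace (D.v₁.FrameBundle n₁)) (_ : Mfd (D.v₁.FrameBundle n₁))
      (_ : TopologicalSpace (D.v₂.FrameBundle n₂)) (_ : Mfd (D.v₂.FrameBundle n₂)),
      D.IsFrameManifold n₁ n₂ n₀ ∧ D.v₁.IsFrameManifold n₁ ∧ D.v₂.IsFrameManifold n₂ ∧
      -- the frame bundle is a double principal bundle with structure group `AutR n₁ n₂ n₀`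
      IsGDPB (autDLG n₁ n₂ n₀)
        (DVBundle.FrameBundle.proj₁ (D := D)) (DVBundle.FrameBundle.proj₂ (D := D))
        (VBundle.FrameBundle.proj (A := D.v₁)) (VBundle.FrameBundle.proj (A := D.v₂))
        DVBundle.FrameBundle.act VBundle.FrameBundle.act VBundle.FrameBundle.act ∧
      -- the associated double vector bundle
      ∃ (_ : TopologicalSpace (D.FrameAssoc n₁ n₂ n₀)) (_ : Mfd (D.FrameAssoc n₁ n₂ n₀))
        (_ : TopologicalSpace (D.v₁.FrameAssoc n₁)) (_ : Mfd (D.v₁.FrameAssoc n₁))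
        (_ : TopologicalSpace (D.v₂.FrameAssoc n₂)) (_ : Mfd (D.v₂.FrameAssoc n₂))
        (A : DVBundle (D.FrameAssoc n₁ n₂ n₀) (D.v₁.FrameAssoc n₁) (D.v₂.FrameAssoc n₂) M),
        IsAssocDVB
          (DVBundle.FrameBundle.proj₁ (D := D)) (DVBundle.FrameBundle.proj₂ (D := D))
          (VBundle.FrameBundle.proj (A := D.v₁)) (VBundle.FrameBundle.proj (A := D.v₂))
          DVBundle.FrameBundle.act VBundle.FrameBundle.act VBundle.FrameBundle.act
          AutR.act glAct glAct A ∧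
        -- the natural isomorphism `[Ω, ξ] ↦ Ωξ`, over the maps `[u, x] ↦ ux`, `[v, y] ↦ vy`
        ∃ (f : D.FrameAssoc n₁ n₂ n₀ → E) (f₁ : D.v₁.FrameAssoc n₁ → E₁)
          (f₂ : D.v₂.FrameAssoc n₂ → E₂),
          (∀ Ω ξ, f (Assoc.mk _ _ Ω ξ) = Ω.eval ξ) ∧
          (∀ u x, f₁ (Assoc.mk _ _ u x) = u.eval x) ∧
          (∀ v y, f₂ (Assoc.mk _ _ v y) = v.eval y) ∧
          IsDVBIso A D f f₁ f₂ id := by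
  have S := hD.frameSystem
  have S₁ := D.v₁.frameSystem n₁ fun b => (hD b).1
  have S₂ := D.v₂.frameSystem n₂ fun b => (hD b).2.1
  obtain ⟨tP, mP, hP⟩ := S.exists_isFrameMfd
  obtain ⟨tP₁, mP₁, hP₁⟩ := S₁.exists_isFrameMfd
  obtain ⟨tP₂, mP₂, hP₂⟩ := S₂.exists_isFrameMfd
  refine ⟨tP, mP, tP₁, mP₁, tP₂, mP₂, fun U s h h' h'' => hP U s ⟨h, h', h''⟩,
    fun U s h h' h'' => hP₁ U s ⟨h, h', h''⟩, fun U s h h' h'' => hP₂ U s ⟨h, h', h''⟩,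
    hD.isGDPB hP hP₁ hP₂, ?_⟩
  obtain ⟨tA, mA, h, h'⟩ := exists_mfd_transport S.assocEquiv
  obtain ⟨tA₁, mA₁, h₁, h₁'⟩ := exists_mfd_transport S₁.assocEquiv
  obtain ⟨tA₂, mA₂, h₂, h₂'⟩ := exists_mfd_transport S₂.assocEquiv
  let f : Diffeo (D.FrameAssoc n₁ n₂ n₀) E := ⟨S.assocEquiv, h, h'⟩
  let f₁ : Diffeo (D.v₁.FrameAssoc n₁) E₁ := ⟨S₁.assocEquiv, h₁, h₁'⟩
  let f₂ : Diffeo (D.v₂.FrameAssoc n₂) E₂ := ⟨S₂.assocEquiv, h₂, h₂'⟩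
  refine ⟨tA, mA, tA₁, mA₁, tA₂, mA₂, D.transport f f₁ f₂, ?_, f, f₁, f₂, fun _ _ => rfl,
    fun _ _ => rfl, fun _ _ => rfl, D.isDVBIso_transport f f₁ f₂⟩
  exact
    { manifold := S.isAssocManifold hP h h' _ fun q =>
        congrArg D.δ₁ (f₁.apply_symm_apply (D.σ₁ (f q)))
      manifold₁ := S₁.isAssocManifold hP₁ h₁ h₁' _ fun _ => rfl
      manifold₂ := S₂.isAssocManifold hP₂ h₂ h₂' _ fun _ => rfl
      σ₁_mk := fun Ω ξ => (congrArg f₁.symm (Ω.σ₁_eval ξ)).trans (S₁.assocEquiv_symm_eval _ _)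
      σ₂_mk := fun Ω ξ => (congrArg f₂.symm (Ω.σ₂_eval ξ)).trans (S₂.assocEquiv_symm_eval _ _)
      addI := fun Ω x y y' z z' => (congrArg f.symm (Ω.eval_addI x (y, z) (y', z')).symm).trans
        (S.assocEquiv_symm_eval _ _)
      smulI := fun c Ω x y z => (congrArg f.symm (Ω.eval_smulI c x (y, z)).symm).trans
        (S.assocEquiv_symm_eval _ _)
      addII := fun Ω x x' y z z' => (congrArg f.symm (Ω.eval_addII x x' y z z').symm).trans
        (S.assocEquiv_symm_eval _ _)
      smulII := fun c Ω x y z => (congrArg f.symm (Ω.eval_smulII c x y z).symm).trans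
        (S.assocEquiv_symm_eval _ _)
      add₁ := fun u x x' => (congrArg f₁.symm (u.eval_add x x').symm).trans
        (S₁.assocEquiv_symm_eval _ _)
      smul₁ := fun c u x => (congrArg f₁.symm (u.eval_smul c x).symm).trans
        (S₁.assocEquiv_symm_eval _ _)
      add₂ := fun u x x' => (congrArg f₂.symm (u.eval_add x x').symm).trans
        (S₂.assocEquiv_symm_eval _ _)
      smul₂ := fun c u x => (congrArg f₂.symm (u.eval_smul c x).symm).trans
        (S₂.assocEquiv_symm_eval _ _) }
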